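/- Let $f\in\mathbb{R}[x]$ be a polynomial of degree $d\ge 0$ with $f(x)>0$ for all real $x\ge 0$, and let $g(x)=x^d f(1/x)$. The series $$\zeta_f(s)=\sum_{n,m\ge 1}\left(n\,m^{d+1} f\!\left(\frac nm\right)\right)^{-s}$$ converges absolutely for $\operatorname{Re}(s)>\frac{2}{d+2}$ and has a meromorphic continuation to $\mathbb{C}$, again denoted $\zeta_f$. This continuation is analytic at $s=0,-1,-2,\dots$, and for every integer $n\ge 0$ $$\zeta_f(-n)=\frac{\zeta(-(d+2)n-1)}{d+1}\Big([-f(x)^n\log f(x)][x^{1+(d+1)n}]+[-g(x)^n\log g(x)][x^{1+(d+1)n}]\Big)+\sum_{i=0}^{nd}[f(x)^n][x^i]\,\zeta(-n-i)\,\zeta(-(d+1)n+i),$$ where $\zeta$ is the Riemann zeta function and $[h(x)][x^k]$ denotes the coefficient of $x^k$ in the Taylor expansion of $h$ around $x=0$. -/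

import Mathlib

/-- The general term `(n m^{d+1} f(n/m))^{-s}`, with `d = deg f`, of the double series `ζ_f(s)`.
For `f` positive on `[0, ∞)` the base is a positive real number. -/
noncomputable def zetaTerm (f : Polynomial ℝ) (s : ℂ) (p : ℕ+ × ℕ+) : ℂ :=
  (((p.1 : ℝ) * (p.2 : ℝ) ^ (f.natDegree + 1) * f.eval ((p.1 : ℝ) / (p.2 : ℝ)) : ℝ) : ℂ) ^ (-s)

/-- `Z` is the meromorphic continuation to `ℂ` of `ζ_f(s) = ∑_{n,m ≥ 1} (n m^{d+1} f(n/m))^{-s}`: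
it is meromorphic on `ℂ`, in normal form (removable singularities have been removed), and it is
the sum of the absolutely convergent series on the half-plane `Re s > 2 / (d + 2)`. -/
def IsZetaContinuation (f : Polynomial ℝ) (Z : ℂ → ℂ) : Prop :=
  MeromorphicNFOn Z Set.univ ∧
    ∀ s : ℂ, 2 / ((f.natDegree : ℝ) + 2) < s.re → HasSum (zetaTerm f s) (Z s)

/-- `[h(x)][x^k]`: the coefficient of `x^k` in the Taylor expansion of `h` around `x = 0`. -/
noncomputable def taylorCoeffZero (h : ℝ → ℝ) (k : ℕ) : ℝ :=
  iteratedDeriv k h 0 / (k.factorial : ℝ)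

/-- `[-f(x)^n log f(x)][x^k]`. -/
noncomputable def negPowLogCoeff (f : Polynomial ℝ) (n k : ℕ) : ℝ :=
  taylorCoeffZero (fun x => -(f.eval x) ^ n * Real.log (f.eval x)) k

/-- `f.reverse` is the polynomial `g(x) = x^d f(1/x)`, `d = deg f`. -/
theorem eval_reverse_eq (f : Polynomial ℝ) (x : ℝ) (hx : x ≠ 0) :
    f.reverse.eval x = x ^ f.natDegree * f.eval (1 / x) := by
  let _ : Invertible x⁻¹ := invertibleOfNonzero (inv_ne_zero hx)
  have h := Polynomial.eval₂_reverse_mul_pow (RingHom.id ℝ) x⁻¹ f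
  simp only [invOf_eq_inv, inv_inv] at h
  change f.reverse.eval x * _ = f.eval x⁻¹ at h
  rw [one_div, ← h, mul_comm, mul_assoc, ← mul_pow, inv_mul_cancel₀ hx, one_pow, mul_one]

/-!
Write `F(n, m) = m^d f(n/m)`, so that the terms of the series are `(n m F(n, m))^{-s}`, and let
`g = f.reverse`, which again has degree `d` and is positive on `[0, ∞)`. The bounds `f(x) ≥ c` and
`f(x) ≥ c x^d` on `x > 0` give `n m F(n, m) ≥ c (n m)^{(d+2)/2}`, hence absolute convergence
(`exists_le_zetaBase`, `summable_zetaTerm`).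

*Splitting.* Put `ψ_e(x) = f(x)^{-e} / (1 + x^K)` (`cutoffPower`) with `K` large. Since
`m^K / (n^K + m^K) + n^K / (n^K + m^K) = 1`, the double series is a sum of two half sums
`∑ n^{-s} m^{-w} ψ_e(n/m)` with `w = (d+1) s`, `e = s`, one for `f` and one for `g` with the roles
of `n` and `m` exchanged (`cutoffPower_add_reverse`). The function `t ↦ t^{-w} ψ_e(n/t)` is flat at
`0` and decays at infinity together with its derivatives, so Euler–Maclaurin summation over `m` has
no boundary terms. Its main term sums to `ζ(s+w-1)` times the Mellin transform of `ψ_e` at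
`w-1`, and its remainder is holomorphic in a half-plane as large as desired (`hasSum_half`,
`differentiableAt_remainderSum`). Repeated integration by parts continues the Mellin transform to the
left, with poles only at non-positive integers (`mellin_cutoffPower_eq`). This continues the zeta
series to vertical strips (`exists_strip_continuation`). Putting each continuation in normal form
makes them agree on overlaps, and they glue to a meromorphic function on `ℂ`.

*Values.* Let `k = 1 + (d+1) n`. At `s = -n` the parameter `w = (d+1) s` passes through `1 - k`, a
pole of the factor produced by the integrations by parts. The Mellin transform left over vanishes
there, being a Taylor coefficient of `f^n` beyond its degree, so the singularity is removable and the
value is a derivative along the curve `s ↦ ((d+1) s, s)` of parameters `(w, e)`. That derivative is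
found by comparison with the series of `(n m)^{-s} F(n, m)^n`, in which `e = -n` is constant and
`w = s - d n`. The same continuation applies to it, and on the other hand it is literally the finite
sum of products of zeta values in the formula (`hasSum_comparison`). At `s = -n` both curves pass
through the same point, where the Euler–Maclaurin remainders agree. The velocity `(d+1, 1)` of the
first curve is `d+1` times the velocity `(1, 0)` of the second plus the vector `(0, 1)`. The
derivative in the direction `(0, 1)` is that of the `k`-th Taylor coefficient of `f^{-e}` with
respect to `e`, that is, the Taylor coefficient of `-f^n log f` (`hasDerivAt_deriv_chain_zero`,
`exists_tendsto_halfContinuation`). Adding the contributions of `f` and `g` gives the formula.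
-/


/-! ### Rational symbols and their derivatives -/

/-- Families of functions of a real variable `x > -δ`, depending on a parameter `p ∈ ℂ × ℂ`: the
algebra generated by the entire functions of `p` alone and by the rational functions `P(x) / Q(x)`
with `Q > 0` on `(-δ, ∞)` and `deg P ≤ deg Q`. It is stable under `d/dx` and `x d/dx`, and its
members are bounded on `[0, ∞)`, locally uniformly in `p`. -/
inductive RationalSymbol (δ : ℝ) : (ℂ × ℂ → ℝ → ℂ) → Prop
  | param (c : ℂ × ℂ → ℂ) (hc : Differentiable ℂ c) : RationalSymbol δ (fun p _ => c p)
  | ratio (P Q : Polynomial ℝ) (hQ : ∀ x, -δ < x → 0 < Q.eval x)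
      (hdeg : P.natDegree ≤ Q.natDegree) :
      RationalSymbol δ (fun _ x => ((P.eval x / Q.eval x : ℝ) : ℂ))
  | add {M N : ℂ × ℂ → ℝ → ℂ} : RationalSymbol δ M → RationalSymbol δ N →
      RationalSymbol δ (fun p x => M p x + N p x)
  | mul {M N : ℂ × ℂ → ℝ → ℂ} : RationalSymbol δ M → RationalSymbol δ N →
      RationalSymbol δ (fun p x => M p x * N p x)

/-- The degree bound that keeps `x (P / Q)'` among the quotients bounded at infinity. -/
theorem Polynomial.natDegree_wronskian_numerator_le {P Q : Polynomial ℝ}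
    (h : P.natDegree ≤ Q.natDegree) :
    (Polynomial.X * (P.derivative * Q - P * Q.derivative)).natDegree ≤ (Q ^ 2).natDegree := by
  rcases Nat.eq_zero_or_pos Q.natDegree with h0 | h0
  · have hP : P.natDegree = 0 := by omega
    rw [Polynomial.natDegree_eq_zero_iff_degree_le_zero, Polynomial.degree_le_zero_iff] at h0 hP
    rw [h0, hP]; simp
  · rw [Polynomial.natDegree_pow]
    refine Polynomial.natDegree_mul_le.trans ?_
    have h1 : (P.derivative * Q - P * Q.derivative).natDegree ≤ 2 * Q.natDegree - 1 := by
      refine (Polynomial.natDegree_sub_le _ _).trans (max_le ?_ ?_)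
      · refine Polynomial.natDegree_mul_le.trans ?_
        have := Polynomial.natDegree_derivative_le P
        omega
      · refine Polynomial.natDegree_mul_le.trans ?_
        have := Polynomial.natDegree_derivative_le Q
        omega
    have := Polynomial.natDegree_X_le (R := ℝ)
    omega

namespace RationalSymbol

variable {δ : ℝ} {M N : ℂ × ℂ → ℝ → ℂ}

/-- Rational symbols are stable under `d/dx` and under `x d/dx`. -/
theorem exists_hasDerivAt (hM : RationalSymbol δ M) :
    ∃ M' : ℂ × ℂ → ℝ → ℂ, RationalSymbol δ M' ∧ RationalSymbol δ (fun p x => (x : ℂ) * M' p x) ∧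
      ∀ p x, -δ < x → HasDerivAt (M p) (M' p x) x := by
  induction hM with
  | param c hc =>
    refine ⟨fun _ _ => 0, .param (fun _ => 0) (differentiable_const _), ?_, fun p x _ =>
      hasDerivAt_const _ _⟩
    simpa using RationalSymbol.param (δ := δ) (fun _ => 0) (differentiable_const _)
  | ratio P Q hQ hdeg =>
    have hQ2 : ∀ x, -δ < x → 0 < (Q ^ 2).eval x := fun x hx => by
      rw [Polynomial.eval_pow]; exact pow_pos (hQ x hx) 2
    have hd := Polynomial.natDegree_wronskian_numerator_le hdeg
    refine ⟨_, .ratio (P.derivative * Q - P * Q.derivative) (Q ^ 2) hQ2 ?_, ?_, ?_⟩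
    · by_cases h0 : P.derivative * Q - P * Q.derivative = 0
      · simp [h0]
      · rw [Polynomial.natDegree_X_mul h0] at hd
        omega
    · have := RationalSymbol.ratio _ _ hQ2 hd
      simpa [mul_div_assoc] using this
    · intro p x hx
      have := ((P.hasDerivAt x).div (Q.hasDerivAt x) (hQ x hx).ne').ofReal_comp
      convert! this using 2
      simp
  | @add M N _ _ hM hN =>
    obtain ⟨M', h1, h2, h3⟩ := hM
    obtain ⟨N', k1, k2, k3⟩ := hN
    refine ⟨_, h1.add k1, ?_, fun p x hx => (h3 p x hx).add (k3 p x hx)⟩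
    simpa [mul_add] using h2.add k2
  | @mul M N hM0 hN0 hM hN =>
    obtain ⟨M', h1, h2, h3⟩ := hM
    obtain ⟨N', k1, k2, k3⟩ := hN
    refine ⟨_, (h1.mul hN0).add (hM0.mul k1), ?_, fun p x hx => (h3 p x hx).mul (k3 p x hx)⟩
    convert (h2.mul hN0).add (hM0.mul k2) using 3
    ring

theorem differentiable (hM : RationalSymbol δ M) (x : ℝ) : Differentiable ℂ (fun p => M p x) := by
  induction hM with
  | param c hc => exact hc
  | ratio P Q hQ hdeg => exact differentiable_const _
  | add _ _ h1 h2 => exact h1.add h2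
  | mul _ _ h1 h2 => exact h1.mul h2

theorem exists_bound (hM : RationalSymbol δ M) (hδ : 0 < δ) (R : ℝ) :
    ∃ C : ℝ, 0 ≤ C ∧ ∀ p : ℂ × ℂ, ‖p‖ ≤ R → ∀ x : ℝ, 0 ≤ x → ‖M p x‖ ≤ C := by
  induction hM with
  | param c hc =>
    obtain ⟨C, hC⟩ := (isCompact_closedBall (0 : ℂ × ℂ) R).exists_bound_of_continuousOn
      hc.continuous.continuousOn
    exact ⟨max C 0, le_max_right _ _, fun p hp x _ =>
      (hC p (by simpa using hp)).trans (le_max_left _ _)⟩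
  | ratio P Q hQ hdeg =>
    have hQ0 : ∀ x : ℝ, 0 ≤ x → 0 < Q.eval x := fun x hx => hQ x (by linarith)
    have hQne : Q ≠ 0 := by
      rintro rfl
      simpa using hQ0 0 le_rfl
    have hO := Polynomial.isBigO_atTop_of_degree_le P Q (by
      by_cases hP : P = 0
      · simp [hP]
      · rw [Polynomial.degree_eq_natDegree hP, Polynomial.degree_eq_natDegree hQne]
        exact_mod_cast hdeg)
    obtain ⟨C1, hC1⟩ := hO.bound
    obtain ⟨a, ha⟩ := Filter.eventually_atTop.1 hC1
    have hcont : ContinuousOn (fun x => P.eval x / Q.eval x) (Set.Icc 0 a) :=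
      P.continuous.continuousOn.div Q.continuous.continuousOn fun x hx => (hQ0 x hx.1).ne'
    obtain ⟨C2, hC2⟩ := isCompact_Icc.exists_bound_of_continuousOn hcont
    refine ⟨max (max C1 C2) 0, le_max_right _ _, fun p _ x hx => ?_⟩
    rw [Complex.norm_real]
    rcases le_total x a with h | h
    · exact (hC2 x ⟨hx, h⟩).trans ((le_max_right _ _).trans (le_max_left _ _))
    · rw [norm_div, div_le_iff₀ (norm_pos_iff.2 (hQ0 x hx).ne')]
      exact (ha x h).trans (by gcongr; exact (le_max_left _ _).trans (le_max_left _ _))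
  | add _ _ h1 h2 =>
    obtain ⟨C1, h10, h11⟩ := h1
    obtain ⟨C2, h20, h21⟩ := h2
    exact ⟨C1 + C2, by positivity, fun p hp x hx =>
      (norm_add_le _ _).trans (add_le_add (h11 p hp x hx) (h21 p hp x hx))⟩
  | mul _ _ h1 h2 =>
    obtain ⟨C1, h10, h11⟩ := h1
    obtain ⟨C2, h20, h21⟩ := h2
    exact ⟨C1 * C2, by positivity, fun p hp x hx => by
      rw [norm_mul]; exact mul_le_mul (h11 p hp x hx) (h21 p hp x hx) (norm_nonneg _) h10⟩

theorem const (c : ℂ) : RationalSymbol δ (fun _ _ => c) := .param _ (differentiable_const c)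

end RationalSymbol

/-! ### Powers of a positive polynomial, cut off at infinity -/

/-- `f(x)^{-e} / (1 + x^K)` for a polynomial `f` that is positive where this is used. The factor
`1 / (1 + x^K)` is flat of order `K` at `0` and makes the function decay at infinity. -/
noncomputable def cutoffPower (f : Polynomial ℝ) (K : ℕ) (e : ℂ) (x : ℝ) : ℂ :=
  Complex.exp (-e * (Real.log (f.eval x) : ℂ)) / ((1 + x ^ K : ℝ) : ℂ)

theorem one_add_pow_pos {K : ℕ} (hK : K ≠ 0) {x : ℝ} (hx : -1 < x) : 0 < 1 + x ^ K := by
  rcases le_or_gt 0 x with h | h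
  · positivity
  · have : |x ^ K| < 1 := by
      rw [abs_pow]
      exact pow_lt_one₀ (abs_nonneg x) (abs_lt.2 ⟨hx, by linarith⟩) hK
    linarith [(abs_lt.1 this).1]

/-- The families `M(p, x) f(x)^{-e} / (1 + x^K)`, where `p = (w, e)` and `M` is a rational
symbol. -/
def IsCutoffFamily (δ : ℝ) (f : Polynomial ℝ) (K : ℕ) (χ : ℂ × ℂ → ℝ → ℂ) : Prop :=
  ∃ M : ℂ × ℂ → ℝ → ℂ, RationalSymbol δ M ∧ ∀ p x, χ p x = M p x * cutoffPower f K p.2 x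

theorem norm_cutoffPower (f : Polynomial ℝ) (K : ℕ) (e : ℂ) {x : ℝ} (hx : 0 ≤ x) :
    ‖cutoffPower f K e x‖ = Real.exp (-e.re * Real.log (f.eval x)) / (1 + x ^ K) := by
  rw [cutoffPower, norm_div, Complex.norm_exp, Complex.norm_real, Real.norm_of_nonneg (by positivity)]
  simp [Complex.mul_re]

theorem cutoffPower_hasDerivAt {f : Polynomial ℝ} {K : ℕ} (hK : K ≠ 0) (e : ℂ) {x : ℝ}
    (hx : -1 < x) (hf : 0 < f.eval x) :
    HasDerivAt (cutoffPower f K e)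
      ((-e * ((f.derivative.eval x / f.eval x : ℝ) : ℂ)
        + (-1) * (((Polynomial.C (K : ℝ) * Polynomial.X ^ (K - 1)).eval x /
            (1 + Polynomial.X ^ K : Polynomial ℝ).eval x : ℝ) : ℂ)) * cutoffPower f K e x) x := by
  have h1 : HasDerivAt (fun x => ((Real.log (f.eval x) : ℝ) : ℂ))
      ((f.derivative.eval x / f.eval x : ℝ) : ℂ) x :=
    ((f.hasDerivAt x).log hf.ne').ofReal_comp
  have h2 : HasDerivAt (fun x : ℝ => ((1 + x ^ K : ℝ) : ℂ)) ((K * x ^ (K - 1) : ℝ) : ℂ) x :=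
    ((hasDerivAt_pow K x).const_add 1).ofReal_comp
  have hne : ((1 + x ^ K : ℝ) : ℂ) ≠ 0 := by
    exact_mod_cast (one_add_pow_pos hK hx).ne'
  have h3 := (h1.const_mul (-e)).cexp.div h2 hne
  convert! h3 using 1
  rw [cutoffPower]
  simp only [Polynomial.eval_mul, Polynomial.eval_C, Polynomial.eval_pow, Polynomial.eval_X,
    Polynomial.eval_add, Polynomial.eval_one, Complex.ofReal_div]
  field_simp
  ring

namespace IsCutoffFamily

variable {δ : ℝ} {f : Polynomial ℝ} {K : ℕ} {χ : ℂ × ℂ → ℝ → ℂ}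

theorem base : IsCutoffFamily δ f K (fun p => cutoffPower f K p.2) :=
  ⟨_, .const 1, fun _ _ => (one_mul _).symm⟩

theorem add {χ' : ℂ × ℂ → ℝ → ℂ} (h : IsCutoffFamily δ f K χ) (h' : IsCutoffFamily δ f K χ') :
    IsCutoffFamily δ f K (fun p x => χ p x + χ' p x) := by
  obtain ⟨M, h1, h2⟩ := h
  obtain ⟨M', h1', h2'⟩ := h'
  exact ⟨_, h1.add h1', fun p x => by simp only [h2, h2', add_mul]⟩

theorem param_mul (h : IsCutoffFamily δ f K χ) {c : ℂ × ℂ → ℂ} (hc : Differentiable ℂ c) :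
    IsCutoffFamily δ f K (fun p x => c p * χ p x) := by
  obtain ⟨M, h1, h2⟩ := h
  exact ⟨_, (RationalSymbol.param c hc).mul h1, fun p x => by simp only [h2, mul_assoc]⟩

/-- Cut-off families are stable under `d/dx` and under `x d/dx`: the logarithmic derivative of
`f(x)^{-e} / (1 + x^K)` is a rational symbol. -/
theorem exists_hasDerivAt (hK : K ≠ 0) (hδ : δ ≤ 1) (hf : ∀ x, -δ < x → 0 < f.eval x)
    (h : IsCutoffFamily δ f K χ) :
    ∃ χ' : ℂ × ℂ → ℝ → ℂ, IsCutoffFamily δ f K χ' ∧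
      IsCutoffFamily δ f K (fun p x => (x : ℂ) * χ' p x) ∧
      ∀ p x, -δ < x → HasDerivAt (χ p) (χ' p x) x := by
  obtain ⟨M, hM, hχ⟩ := h
  obtain ⟨M', h1, h2, h3⟩ := hM.exists_hasDerivAt
  have he : RationalSymbol δ (fun p _ => -p.2) := .param _ differentiable_snd.neg
  have hE : ∀ x, -δ < x → 0 < (1 + Polynomial.X ^ K : Polynomial ℝ).eval x := fun x hx => by
    simpa using one_add_pow_pos hK (by linarith : -1 < x)
  have hEdeg : (1 + Polynomial.X ^ K : Polynomial ℝ).natDegree = K := by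
    rw [add_comm, ← Polynomial.C_1, Polynomial.natDegree_X_pow_add_C]
  have hfd : (Polynomial.X * f.derivative).natDegree ≤ f.natDegree := by
    by_cases h0 : f.derivative = 0
    · simp [h0]
    · rw [Polynomial.natDegree_X_mul h0]
      have hne : f.natDegree ≠ 0 := fun h => h0 (by
        rw [Polynomial.natDegree_eq_zero] at h
        obtain ⟨c, rfl⟩ := h
        simp)
      have := Polynomial.natDegree_derivative_le f
      omega
  have hXd : (Polynomial.X * (Polynomial.C (K : ℝ) * Polynomial.X ^ (K - 1))).natDegree ≤ K := by
    have : Polynomial.X * (Polynomial.C (K : ℝ) * Polynomial.X ^ (K - 1))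
        = Polynomial.C (K : ℝ) * Polynomial.X ^ K := by
      obtain ⟨k, rfl⟩ := Nat.exists_eq_succ_of_ne_zero hK
      simp only [Nat.succ_eq_add_one, Nat.add_sub_cancel, pow_succ]
      ring
    rw [this]
    exact Polynomial.natDegree_C_mul_X_pow_le _ _
  have L1 := (he.mul (.ratio f.derivative f hf
    ((Polynomial.natDegree_derivative_le f).trans (Nat.sub_le _ _)))).add
    ((RationalSymbol.const (δ := δ) (-1)).mul (.ratio
      (Polynomial.C (K : ℝ) * Polynomial.X ^ (K - 1)) (1 + Polynomial.X ^ K) hE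
      (by rw [hEdeg]; exact (Polynomial.natDegree_C_mul_X_pow_le _ _).trans (Nat.sub_le _ _))))
  have L2 := (he.mul (.ratio _ f hf hfd)).add
    ((RationalSymbol.const (δ := δ) (-1)).mul (.ratio
      (Polynomial.X * (Polynomial.C (K : ℝ) * Polynomial.X ^ (K - 1))) (1 + Polynomial.X ^ K) hE
      (by rw [hEdeg]; exact hXd)))
  refine ⟨_, ⟨_, h1.add (hM.mul L1), fun p x => rfl⟩, ⟨_, h2.add (hM.mul L2), ?_⟩, ?_⟩
  · intro p x
    simp only [Polynomial.eval_mul, Polynomial.eval_X, mul_div_assoc, Complex.ofReal_mul]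
    ring
  · intro p x hx
    have h4 := (h3 p x hx).mul (cutoffPower_hasDerivAt hK p.2 (by linarith : -1 < x) (hf x hx))
    rw [show χ p = M p * cutoffPower f K p.2 from funext fun y => hχ p y]
    convert! h4 using 1
    ring

theorem differentiable (h : IsCutoffFamily δ f K χ) (x : ℝ) :
    Differentiable ℂ (fun p => χ p x) := by
  obtain ⟨M, h1, h2⟩ := h
  simp only [h2, cutoffPower]
  have := h1.differentiable x
  fun_prop

end IsCutoffFamily

/-- A polynomial that is positive on `[0, ∞)` is bounded below there by a positive constant and
above by a constant multiple of `(1 + x)^d`. -/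
theorem exists_bounds_of_pos {f : Polynomial ℝ} (hf : ∀ x : ℝ, 0 ≤ x → 0 < f.eval x) :
    ∃ C : ℝ, 1 ≤ C ∧ ∀ x : ℝ, 0 ≤ x →
      C⁻¹ ≤ f.eval x ∧ f.eval x ≤ C * (1 + x) ^ f.natDegree := by
  have hne : f ≠ 0 := by rintro rfl; simpa using hf 0 le_rfl
  have hQ : ∀ x : ℝ, -1 < x → 0 < ((1 + Polynomial.X : Polynomial ℝ) ^ f.natDegree).eval x :=
    fun x hx => by
      rw [Polynomial.eval_pow]
      exact pow_pos (by simp; linarith) _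
  have hdeg : ((1 + Polynomial.X : Polynomial ℝ) ^ f.natDegree).natDegree = f.natDegree := by
    rw [Polynomial.natDegree_pow, add_comm, ← Polynomial.C_1, Polynomial.natDegree_X_add_C, mul_one]
  obtain ⟨C1, h10, h11⟩ := (RationalSymbol.ratio f _ hQ hdeg.ge).exists_bound one_pos 0
  have hO := Polynomial.isBigO_atTop_of_degree_le 1 f (by
    rw [Polynomial.degree_one, Polynomial.degree_eq_natDegree hne]; exact_mod_cast Nat.zero_le _)
  obtain ⟨C2, hC2⟩ := hO.bound
  obtain ⟨a, ha⟩ := Filter.eventually_atTop.1 hC2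
  obtain ⟨C3, hC3⟩ := (isCompact_Icc (a := (0 : ℝ)) (b := a)).exists_bound_of_continuousOn
    (f := fun x => (f.eval x)⁻¹) (f.continuous.continuousOn.inv₀ fun x hx => (hf x hx.1).ne')
  set C := max 1 (max C1 (max C2 C3)) with hC
  have hCpos : 0 < C := lt_of_lt_of_le one_pos (le_max_left _ _)
  refine ⟨C, le_max_left _ _, fun x hx => ⟨?_, ?_⟩⟩
  · have hfx := hf x hx
    rw [inv_le_comm₀ hCpos hfx]
    rcases le_total x a with h | h
    · have := hC3 x ⟨hx, h⟩
      rw [Real.norm_of_nonneg (by positivity)] at this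
      exact this.trans ((le_max_right _ _).trans ((le_max_right _ _).trans (le_max_right _ _)))
    · have := ha x h
      rw [Polynomial.eval_one, norm_one, Real.norm_of_nonneg hfx.le] at this
      rw [inv_le_iff_one_le_mul₀ hfx]
      have hC2C : C2 ≤ C :=
        (le_max_left _ _).trans ((le_max_right _ _).trans (le_max_right _ _))
      exact this.trans (mul_le_mul_of_nonneg_right hC2C hfx.le)
  · have hb := h11 0 (by simp) x hx
    rw [Complex.norm_real] at hb
    have hp : 0 < (1 + x) ^ f.natDegree := by positivity
    simp only [Polynomial.eval_pow, Polynomial.eval_add, Polynomial.eval_one,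
      Polynomial.eval_X] at hb
    have h2 := (le_abs_self _).trans hb
    rw [div_le_iff₀ hp] at h2
    exact h2.trans (by gcongr; exact (le_max_left _ _).trans (le_max_right _ _))

/-- For `e` bounded, `f(x)^{-e} / (1 + x^K)` decays like any prescribed power of `1 + x`, provided
`K` is large. -/
theorem exists_cutoffPower_bound {f : Polynomial ℝ} (hf : ∀ x : ℝ, 0 ≤ x → 0 < f.eval x)
    {R b K : ℕ} (hK : b + f.natDegree * R ≤ K) :
    ∃ C : ℝ, 0 ≤ C ∧ ∀ e : ℂ, |e.re| ≤ R → ∀ x : ℝ, 0 ≤ x →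
      ‖cutoffPower f K e x‖ ≤ C * ((1 + x) ^ b)⁻¹ := by
  obtain ⟨C, hC1, hC⟩ := exists_bounds_of_pos hf
  refine ⟨C ^ R * 2 ^ K, by positivity, fun e he x hx => ?_⟩
  rw [norm_cutoffPower f K e hx]
  obtain ⟨h1, h2⟩ := hC x hx
  have hfx := hf x hx
  set D := C * (1 + x) ^ f.natDegree with hD
  have hCD : C ≤ D := le_mul_of_one_le_right (by linarith)
    (one_le_pow₀ (by linarith))
  have hD1 : 1 ≤ D := hC1.trans hCD
  have hlog : |Real.log (f.eval x)| ≤ Real.log D := by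
    rw [abs_le]
    constructor
    · rw [← Real.log_inv]
      exact Real.log_le_log (by positivity) ((inv_anti₀ (by linarith) hCD).trans h1)
    · exact Real.log_le_log hfx h2
  have hnum : Real.exp (-e.re * Real.log (f.eval x)) ≤ D ^ R := by
    rw [← Real.exp_log (pow_pos (show (0 : ℝ) < D by linarith) R), Real.log_pow]
    refine Real.exp_le_exp.2 ((le_abs_self _).trans ?_)
    rw [abs_mul, abs_neg]
    exact mul_le_mul he hlog (abs_nonneg _) (by positivity)
  have hden : (1 + x) ^ K ≤ 2 ^ K * (1 + x ^ K) := by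
    have h := add_pow_le (zero_le_one) hx K
    rw [one_pow] at h
    refine h.trans ?_
    gcongr
    · norm_num
    · omega
  rw [div_le_iff₀ (by positivity)]
  have key : (1 + x) ^ (b + f.natDegree * R) ≤ 2 ^ K * (1 + x ^ K) :=
    (pow_le_pow_right₀ (by linarith) hK).trans hden
  rw [pow_add, pow_mul] at key
  calc _ ≤ D ^ R := hnum
    _ = C ^ R * ((1 + x) ^ b)⁻¹ * ((1 + x) ^ b * ((1 + x) ^ f.natDegree) ^ R) := by
        rw [hD, mul_pow]; field_simp
    _ ≤ C ^ R * ((1 + x) ^ b)⁻¹ * (2 ^ K * (1 + x ^ K)) := by gcongr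
    _ = _ := by ring

theorem IsCutoffFamily.exists_bound {δ : ℝ} {f : Polynomial ℝ} {K : ℕ} {χ : ℂ × ℂ → ℝ → ℂ}
    (h : IsCutoffFamily δ f K χ) (hδ0 : 0 < δ) (hf : ∀ x : ℝ, 0 ≤ x → 0 < f.eval x)
    {R b : ℕ} (hK : b + f.natDegree * R ≤ K) (R' : ℝ) :
    ∃ C : ℝ, 0 ≤ C ∧ ∀ p : ℂ × ℂ, ‖p‖ ≤ R' → |p.2.re| ≤ R → ∀ x : ℝ, 0 ≤ x →
      ‖χ p x‖ ≤ C * ((1 + x) ^ b)⁻¹ := by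
  obtain ⟨M, h1, h2⟩ := h
  obtain ⟨C1, h10, h11⟩ := h1.exists_bound hδ0 R'
  obtain ⟨C2, h20, h21⟩ := exists_cutoffPower_bound hf hK
  refine ⟨C1 * C2, by positivity, fun p hp hp2 x hx => ?_⟩
  rw [h2, norm_mul, mul_assoc]
  exact mul_le_mul (h11 p hp x hx) (h21 _ hp2 x hx) (norm_nonneg _) h10

/-! ### Holomorphic dependence of integrals on a parameter -/

/-- Differentiation under the integral sign for a holomorphic parameter: an integrable bound for the
integrand on a disc suffices, since Cauchy's estimate turns it into a bound for the derivative. -/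
theorem hasDerivAt_integral_of_holomorphic {α : Type*} [MeasurableSpace α]
    {μ : MeasureTheory.Measure α} {F : ℂ → α → ℂ} {s₀ : ℂ} {r : ℝ} (hr : 0 < r) {b : α → ℝ}
    (hmeas : ∀ s ∈ Metric.ball s₀ r, MeasureTheory.AEStronglyMeasurable (F s) μ)
    (hdiff : ∀ᵐ a ∂μ, DifferentiableOn ℂ (F · a) (Metric.ball s₀ r))
    (hb : ∀ᵐ a ∂μ, ∀ s ∈ Metric.ball s₀ r, ‖F s a‖ ≤ b a) (hbi : MeasureTheory.Integrable b μ) :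
    MeasureTheory.Integrable (fun a => deriv (F · a) s₀) μ ∧
      HasDerivAt (fun s => ∫ a, F s a ∂μ) (∫ a, deriv (F · a) s₀ ∂μ) s₀ := by
  have hs0 : s₀ ∈ Metric.ball s₀ r := Metric.mem_ball_self hr
  refine hasDerivAt_integral_of_dominated_loc_of_deriv_le (F' := fun s a => deriv (F · a) s)
    (bound := fun a => b a / (r / 4)) (Metric.ball_mem_nhds s₀ (half_pos hr)) ?_ ?_ ?_ ?_
    (hbi.div_const _) ?_
  · filter_upwards [Metric.ball_mem_nhds s₀ hr] with s hs using hmeas s hs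
  · exact hbi.mono' (hmeas _ hs0) (hb.mono fun a ha => ha _ hs0)
  · -- the derivative is a limit of measurable difference quotients
    set h : ℕ → ℂ := fun n => ((r / 2 / ((n : ℝ) + 1) : ℝ) : ℂ) with hh
    have hpos : ∀ n : ℕ, 0 < r / 2 / ((n : ℝ) + 1) := fun n => by positivity
    have hlt : ∀ n : ℕ, r / 2 / ((n : ℝ) + 1) < r := fun n =>
      lt_of_le_of_lt (div_le_self (by positivity) (by linarith [Nat.cast_nonneg (α := ℝ) n]))
        (by linarith)
    have hmem : ∀ n, s₀ + h n ∈ Metric.ball s₀ r := fun n => by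
      rw [Metric.mem_ball, dist_eq_norm, add_sub_cancel_left, hh, Complex.norm_real,
        Real.norm_of_nonneg (hpos n).le]
      exact hlt n
    have hlim : Filter.Tendsto h Filter.atTop (nhdsWithin 0 {0}ᶜ) := by
      refine tendsto_nhdsWithin_iff.2 ⟨?_, Filter.Eventually.of_forall fun n => ?_⟩
      · have : Filter.Tendsto (fun n : ℕ => r / 2 / ((n : ℝ) + 1)) Filter.atTop (nhds 0) :=
          tendsto_const_nhds.div_atTop
            (Filter.tendsto_atTop_add_const_right _ _ tendsto_natCast_atTop_atTop)
        have h2 := (Complex.continuous_ofReal.tendsto 0).comp this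
        rwa [Complex.ofReal_zero] at h2
      · simpa [hh] using ⟨hr.ne', by exact_mod_cast Nat.succ_ne_zero n⟩
    refine aestronglyMeasurable_of_tendsto_ae Filter.atTop
      (f := fun n a => (h n)⁻¹ • (F (s₀ + h n) a - F s₀ a)) (fun n => ?_) ?_
    · exact ((hmeas _ (hmem n)).sub (hmeas _ hs0)).const_smul ((h n)⁻¹)
    · filter_upwards [hdiff] with a ha
      have hd := (ha.differentiableAt (Metric.ball_mem_nhds s₀ hr)).hasDerivAt
      exact (hasDerivAt_iff_tendsto_slope_zero.1 hd).comp hlim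
  · filter_upwards [hb, hdiff] with a ha hda s hs
    rw [Metric.mem_ball] at hs
    have hsub : Metric.closedBall s (r / 4) ⊆ Metric.ball s₀ r := fun z hz => by
      rw [Metric.mem_closedBall] at hz
      rw [Metric.mem_ball]
      linarith [dist_triangle z s s₀]
    refine Complex.norm_deriv_le_of_forall_mem_sphere_norm_le (by positivity) ?_ fun z hz =>
      ha z (hsub (Metric.sphere_subset_closedBall hz))
    exact (hda.mono hsub).diffContOnCl_ball subset_rfl
  · filter_upwards [hdiff] with a hda s hs
    exact (hda.differentiableAt (Metric.isOpen_ball.mem_nhds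
      (Metric.ball_subset_ball (by linarith) hs))).hasDerivAt

/-! ### Euler–Maclaurin summation on the half-line -/

/-- The periodic Bernoulli kernel `B_j({t}) / j!`. -/
noncomputable def bernoulliKernel (j : ℕ) (t : ℝ) : ℝ :=
  bernoulliFun j (Int.fract t) / (j.factorial : ℝ)

theorem exists_bernoulliKernel_bound (j : ℕ) : ∃ C : ℝ, 0 ≤ C ∧ ∀ t, |bernoulliKernel j t| ≤ C := by
  obtain ⟨C, hC⟩ := (isCompact_Icc (a := (0 : ℝ)) (b := 1)).exists_bound_of_continuousOn
    (f := fun x => bernoulliFun j x / (j.factorial : ℝ))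
    ((continuous_bernoulliFun (k := j)).div_const _).continuousOn
  refine ⟨max C 0, le_max_right _ _, fun t => (hC _ ⟨Int.fract_nonneg t, (Int.fract_lt_one t).le⟩).trans
    (le_max_left _ _)⟩

theorem measurable_bernoulliKernel (j : ℕ) : Measurable (bernoulliKernel j) :=
  ((continuous_bernoulliFun (k := j)).measurable.comp measurable_fract).div_const _

theorem bernoulliKernel_intervalIntegrable_mul (j : ℕ) {u : ℝ → ℂ} (hu : Continuous u) (a b : ℝ) :
    IntervalIntegrable (fun t => (bernoulliKernel j t : ℂ) * u t) MeasureTheory.volume a b := by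
  obtain ⟨C, _, hC⟩ := exists_bernoulliKernel_bound j
  have h := hu.intervalIntegrable (μ := MeasureTheory.volume) a b
  rw [intervalIntegrable_iff] at h ⊢
  refine MeasureTheory.Integrable.bdd_mul (c := C) h ?_ ?_
  · exact (Complex.measurable_ofReal.comp (measurable_bernoulliKernel j)).aestronglyMeasurable
  · refine Filter.Eventually.of_forall fun t => ?_
    rw [Complex.norm_real]; exact hC t

/-- On `[m, m + 1)` the fractional part of `t` is `t - m`. -/
theorem integral_bernoulliKernel_cell (j m : ℕ) (u : ℝ → ℂ) :
    ∫ t in (m : ℝ)..(m + 1), (bernoulliKernel j t : ℂ) * u t =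
      ∫ t in (m : ℝ)..(m + 1), ((bernoulliFun j (t - m) / j.factorial : ℝ) : ℂ) * u t := by
  refine intervalIntegral.integral_congr_ae ?_
  have : ∀ᵐ t : ℝ, t ≠ m + 1 := by simp [MeasureTheory.ae_iff]
  filter_upwards [this] with t ht htm
  rw [Set.uIoc_of_le (by linarith)] at htm
  have hfl : ⌊t⌋ = (m : ℤ) := Int.floor_eq_iff.2 ⟨by exact_mod_cast htm.1.le, by
    push_cast; exact lt_of_le_of_ne htm.2 ht⟩
  rw [bernoulliKernel, Int.fract, hfl, Int.cast_natCast]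

theorem integral_bernoulliKernel_succ_cell (j m : ℕ) {u v : ℝ → ℂ}
    (hu : ∀ t, HasDerivAt u (v t) t) (hv : Continuous v) :
    ∫ t in (m : ℝ)..(m + 1), (bernoulliKernel (j + 1) t : ℂ) * v t =
      ((bernoulliFun (j + 1) 1 / (j + 1).factorial : ℝ) : ℂ) * u (m + 1)
        - ((bernoulliFun (j + 1) 0 / (j + 1).factorial : ℝ) : ℂ) * u m
        - ∫ t in (m : ℝ)..(m + 1), (bernoulliKernel j t : ℂ) * u t := by
  have hucont : Continuous u := continuous_iff_continuousAt.2 fun t => (hu t).continuousAt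
  rw [integral_bernoulliKernel_cell, integral_bernoulliKernel_cell]
  have hk : ∀ t : ℝ, HasDerivAt
      (fun t : ℝ => ((bernoulliFun (j + 1) (t - m) / (j + 1).factorial : ℝ) : ℂ))
      ((bernoulliFun j (t - m) / j.factorial : ℝ) : ℂ) t := fun t => by
    have h1 := (((hasDerivAt_bernoulliFun (j + 1) (t - m)).comp t
      ((hasDerivAt_id t).sub_const (m : ℝ))).div_const ((j + 1).factorial : ℝ)).ofReal_comp
    convert! h1 using 2
    rw [Nat.factorial_succ, Nat.add_sub_cancel]
    push_cast
    field_simp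
  have hc : Continuous (fun t : ℝ => ((bernoulliFun j (t - m) / j.factorial : ℝ) : ℂ)) :=
    Complex.continuous_ofReal.comp (((continuous_bernoulliFun (k := j)).comp
      (continuous_id.sub continuous_const)).div_const _)
  rw [intervalIntegral.integral_mul_deriv_eq_deriv_mul (fun t _ => hk t) (fun t _ => hu t)
    (hc.intervalIntegrable _ _) (hv.intervalIntegrable _ _)]
  simp

theorem integral_bernoulliKernel_succ (j M : ℕ) {u v : ℝ → ℂ}
    (hu : ∀ t, HasDerivAt u (v t) t) (hv : Continuous v) :
    ∫ t in (0 : ℝ)..M, (bernoulliKernel (j + 1) t : ℂ) * v t =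
      (∑ m ∈ Finset.range M, (((bernoulliFun (j + 1) 1 / (j + 1).factorial : ℝ) : ℂ) * u (m + 1)
        - ((bernoulliFun (j + 1) 0 / (j + 1).factorial : ℝ) : ℂ) * u m))
        - ∫ t in (0 : ℝ)..M, (bernoulliKernel j t : ℂ) * u t := by
  have hucont : Continuous u := continuous_iff_continuousAt.2 fun t => (hu t).continuousAt
  have h1 := intervalIntegral.sum_integral_adjacent_intervals (n := M) (a := fun m : ℕ => (m : ℝ))
    (fun m _ => bernoulliKernel_intervalIntegrable_mul (j + 1) hv _ _)
  have h2 := intervalIntegral.sum_integral_adjacent_intervals (n := M) (a := fun m : ℕ => (m : ℝ))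
    (fun m _ => bernoulliKernel_intervalIntegrable_mul j hucont _ _)
  rw [Nat.cast_zero] at h1 h2
  rw [← h1, ← h2, ← Finset.sum_sub_distrib]
  refine Finset.sum_congr rfl fun m _ => ?_
  rw [Nat.cast_succ]
  exact integral_bernoulliKernel_succ_cell j m hu hv

/-- Euler–Maclaurin summation over the positive integers for a function that is flat at `0` and
tends to `0` at infinity together with its derivatives, so that no boundary terms occur. -/
theorem hasSum_eq_integral_add_bernoulliKernel {u : ℕ → ℝ → ℂ} {J : ℕ}
    (hu : ∀ j, j ≤ J + 1 → ∀ t, HasDerivAt (u j) (u (j + 1) t) t)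
    (h0 : ∀ j, j ≤ J → u j 0 = 0)
    (hlim : ∀ j, j ≤ J → Filter.Tendsto (u j) Filter.atTop (nhds 0))
    (hint : MeasureTheory.IntegrableOn (u 0) (Set.Ioi 0))
    (hintJ : MeasureTheory.IntegrableOn (u (J + 1)) (Set.Ioi 0))
    {S : ℂ} (hS : HasSum (fun m : ℕ => u 0 (m + 1)) S) :
    S = (∫ t in Set.Ioi 0, u 0 t) +
      (-1) ^ J * ∫ t in Set.Ioi 0, (bernoulliKernel (J + 1) t : ℂ) * u (J + 1) t := by
  have hcont : ∀ j, j ≤ J + 1 → Continuous (u j) := fun j hj =>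
    continuous_iff_continuousAt.2 fun t => (hu j hj t).continuousAt
  have hlimN : ∀ j, j ≤ J → Filter.Tendsto (fun M : ℕ => u j M) Filter.atTop (nhds 0) :=
    fun j hj => (hlim j hj).comp tendsto_natCast_atTop_atTop
  set I := ∫ t in Set.Ioi 0, u 0 t with hI
  have key : ∀ j, j ≤ J → Filter.Tendsto
      (fun M : ℕ => ∫ t in (0 : ℝ)..M, (bernoulliKernel (j + 1) t : ℂ) * u (j + 1) t)
      Filter.atTop (nhds ((-1) ^ j * (S - I))) := by
    intro j
    induction j with
    | zero =>
      intro _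
      simp only [integral_bernoulliKernel_succ 0 _ (hu 0 (by omega)) (hcont 1 (by omega))]
      have hI' : Filter.Tendsto (fun M : ℕ => ∫ t in (0 : ℝ)..M, (bernoulliKernel 0 t : ℂ) * u 0 t)
          Filter.atTop (nhds I) := by
        have := MeasureTheory.intervalIntegral_tendsto_integral_Ioi 0 hint
          (tendsto_natCast_atTop_atTop (R := ℝ))
        simpa [bernoulliKernel, bernoulliFun_zero] using this
      have hsum : ∀ M : ℕ, ∑ m ∈ Finset.range M,
          (((bernoulliFun (0 + 1) 1 / (0 + 1).factorial : ℝ) : ℂ) * u 0 (m + 1)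
            - ((bernoulliFun (0 + 1) 0 / (0 + 1).factorial : ℝ) : ℂ) * u 0 m)
          = (∑ m ∈ Finset.range M, u 0 (m + 1)) - 1 / 2 * u 0 M := by
        intro M
        induction M with
        | zero => simp [h0 0 (by omega)]
        | succ M ih =>
          rw [Finset.sum_range_succ, ih, Finset.sum_range_succ]
          simp [bernoulliFun_one]
          ring
      simp only [hsum]
      have := ((hS.tendsto_sum_nat).sub ((hlimN 0 (by omega)).const_mul (1 / 2))).sub hI'
      simpa using this
    | succ j ih =>
      intro hj
      simp only [integral_bernoulliKernel_succ (j + 1) _ (hu (j + 1) (by omega))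
        (hcont (j + 2) (by omega))]
      have hsum : ∀ M : ℕ, ∑ m ∈ Finset.range M,
          (((bernoulliFun (j + 1 + 1) 1 / (j + 1 + 1).factorial : ℝ) : ℂ) * u (j + 1) (m + 1)
            - ((bernoulliFun (j + 1 + 1) 0 / (j + 1 + 1).factorial : ℝ) : ℂ) * u (j + 1) m)
          = ((bernoulliFun (j + 1 + 1) 0 / (j + 1 + 1).factorial : ℝ) : ℂ) * u (j + 1) M := by
        intro M
        induction M with
        | zero => simp [h0 (j + 1) (by omega)]
        | succ M ih =>
          rw [Finset.sum_range_succ, ih, bernoulliFun_endpoints_eq_of_ne_one (by omega)]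
          push_cast
          ring
      simp only [hsum]
      have := ((hlimN (j + 1) hj).const_mul
        (((bernoulliFun (j + 1 + 1) 0 / (j + 1 + 1).factorial : ℝ) : ℂ))).sub (ih (by omega))
      convert! this using 2
      ring
  have hint2 : MeasureTheory.IntegrableOn
      (fun t => (bernoulliKernel (J + 1) t : ℂ) * u (J + 1) t) (Set.Ioi 0) := by
    obtain ⟨C, _, hC⟩ := exists_bernoulliKernel_bound (J + 1)
    refine hintJ.bdd_mul (c := C) ?_ (Filter.Eventually.of_forall fun t => ?_)
    · exact (Complex.measurable_ofReal.comp (measurable_bernoulliKernel _)).aestronglyMeasurable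
    · rw [Complex.norm_real]; exact hC t
  have h2 := MeasureTheory.intervalIntegral_tendsto_integral_Ioi 0 hint2
    (tendsto_natCast_atTop_atTop (R := ℝ))
  have h3 := tendsto_nhds_unique h2 (key J le_rfl)
  rw [h3, ← mul_assoc, ← pow_add, ← two_mul, pow_mul]
  simp

/-! ### Mellin transforms of cut-off families -/

theorem integrableOn_rpow_mul_inv_one_add_pow {r : ℝ} {b : ℕ} (h0 : -1 < r) (h1 : r + 1 < b) :
    MeasureTheory.IntegrableOn (fun x : ℝ => x ^ r * ((1 + x) ^ b)⁻¹) (Set.Ioi 0) := by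
  have hc : ContinuousOn (fun x : ℝ => ((1 + x) ^ b)⁻¹) (Set.Ioi 0) := by
    refine ContinuousOn.inv₀ (by fun_prop) fun x hx => ?_
    have : (0 : ℝ) < x := hx
    positivity
  have := mellin_convergent_of_isBigO_scalar (a := b) (b := 0) (s := r + 1)
    (hc.locallyIntegrableOn measurableSet_Ioi) ?_ h1 ?_ (by linarith)
  · simpa using this
  · refine Asymptotics.IsBigO.of_bound 1 ?_
    filter_upwards [Filter.eventually_gt_atTop 0] with x hx
    rw [one_mul, Real.norm_of_nonneg (by positivity), Real.norm_of_nonneg (by positivity),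
      Real.rpow_neg hx.le, Real.rpow_natCast]
    gcongr
    linarith
  · refine Asymptotics.IsBigO.of_bound 1 ?_
    filter_upwards [self_mem_nhdsWithin] with x hx
    have hx : 0 < x := hx
    rw [one_mul, neg_zero, Real.rpow_zero, norm_one, Real.norm_of_nonneg (by positivity)]
    exact inv_le_one_of_one_le₀ (one_le_pow₀ (by linarith))

theorem rpow_le_rpow_add_rpow {x r r₁ r₂ : ℝ} (hx : 0 < x) (h1 : r₁ ≤ r) (h2 : r ≤ r₂) :
    x ^ r ≤ x ^ r₁ + x ^ r₂ := by
  rcases le_total x 1 with h | h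
  · exact (Real.rpow_le_rpow_of_exponent_ge hx h h1).trans (le_add_of_nonneg_right (by positivity))
  · exact (Real.rpow_le_rpow_of_exponent_le h h2).trans (le_add_of_nonneg_left (by positivity))

theorem norm_cpow_smul_le {χ : ℝ → ℂ} {C r₁ r₂ x : ℝ} {b : ℕ} {z : ℂ} (hx : 0 < x)
    (hχ : ‖χ x‖ ≤ C * ((1 + x) ^ b)⁻¹) (h1 : r₁ ≤ z.re) (h2 : z.re ≤ r₂) :
    ‖(x : ℂ) ^ z • χ x‖ ≤ C * (x ^ r₁ * ((1 + x) ^ b)⁻¹ + x ^ r₂ * ((1 + x) ^ b)⁻¹) := by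
  rw [norm_smul, Complex.norm_cpow_eq_rpow_re_of_pos hx]
  have := mul_le_mul (rpow_le_rpow_add_rpow hx h1 h2) hχ (norm_nonneg _) (by positivity)
  exact this.trans_eq (by ring)

theorem continuousOn_cpow_smul {χ : ℝ → ℂ} (z : ℂ) (hc : ContinuousOn χ (Set.Ioi 0)) :
    ContinuousOn (fun x : ℝ => (x : ℂ) ^ z • χ x) (Set.Ioi 0) := fun x hx => by
  have hx' : (0 : ℝ) < x := hx
  exact (Complex.continuousAt_ofReal_cpow_const x z (Or.inr hx'.ne')).continuousWithinAt.smul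
    (hc x hx)

theorem integrableOn_cpow_smul {χ : ℝ → ℂ} {C : ℝ} {b : ℕ} {z : ℂ}
    (hc : ContinuousOn χ (Set.Ioi 0)) (hχ : ∀ x, 0 ≤ x → ‖χ x‖ ≤ C * ((1 + x) ^ b)⁻¹)
    (h1 : -1 < z.re) (h2 : z.re + 1 < b) :
    MeasureTheory.IntegrableOn (fun x : ℝ => (x : ℂ) ^ z • χ x) (Set.Ioi 0) := by
  have hi := integrableOn_rpow_mul_inv_one_add_pow h1 h2
  refine MeasureTheory.Integrable.mono' ((hi.add hi).const_mul C) ?_ ?_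
  · exact (continuousOn_cpow_smul z hc).aestronglyMeasurable measurableSet_Ioi
  · filter_upwards [MeasureTheory.ae_restrict_mem measurableSet_Ioi] with x hx
    exact norm_cpow_smul_le hx (hχ x (le_of_lt hx)) le_rfl le_rfl

/-- Integration by parts for the Mellin transform. -/
theorem mellin_eq_neg_inv_mul_mellin_deriv {χ χ' : ℝ → ℂ} {C : ℝ} {b : ℕ} {z : ℂ}
    (hd : ∀ x, 0 ≤ x → HasDerivAt χ (χ' x) x) (hc' : ContinuousOn χ' (Set.Ioi 0))
    (hχ : ∀ x, 0 ≤ x → ‖χ x‖ ≤ C * ((1 + x) ^ b)⁻¹)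
    (hχ' : ∀ x, 0 ≤ x → ‖χ' x‖ ≤ C * ((1 + x) ^ b)⁻¹) (h0 : 0 < z.re) (h1 : z.re + 1 < b) :
    mellin χ z = -z⁻¹ * mellin χ' (z + 1) := by
  have hz : z ≠ 0 := by rintro rfl; simp at h0
  have hC : 0 ≤ C := by
    have := (norm_nonneg _).trans (hχ 0 le_rfl)
    simpa using this
  have hc : ContinuousOn χ (Set.Ioi 0) := fun x hx =>
    (hd x (le_of_lt hx)).continuousAt.continuousWithinAt
  have hlow : Filter.Tendsto (fun x : ℝ => C * x ^ z.re) (nhdsWithin 0 (Set.Ioi 0)) (nhds 0) := by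
    have := ((Real.continuousAt_rpow_const 0 z.re (Or.inr h0.le)).tendsto.const_mul C)
    rw [Real.zero_rpow h0.ne', mul_zero] at this
    exact this.mono_left nhdsWithin_le_nhds
  have hnorm : ∀ x : ℝ, 0 < x → ‖(x : ℂ) ^ z * χ x‖ ≤ x ^ z.re * (C * ((1 + x) ^ b)⁻¹) :=
    fun x hx => by
      rw [norm_mul, Complex.norm_cpow_eq_rpow_re_of_pos hx]
      exact mul_le_mul_of_nonneg_left (hχ x hx.le) (by positivity)
  have hF0 : Filter.Tendsto (fun x : ℝ => (x : ℂ) ^ z * χ x) (nhdsWithin 0 (Set.Ioi 0)) (nhds 0) := by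
    refine squeeze_zero_norm' ?_ hlow
    filter_upwards [self_mem_nhdsWithin] with x hx
    have hx : 0 < x := hx
    refine (hnorm x hx).trans ?_
    rw [mul_comm C (x ^ z.re)]
    refine mul_le_mul_of_nonneg_left (mul_le_of_le_one_right hC ?_) (by positivity)
    exact inv_le_one_of_one_le₀ (one_le_pow₀ (by linarith))
  have hFtop : Filter.Tendsto (fun x : ℝ => (x : ℂ) ^ z * χ x) Filter.atTop (nhds 0) := by
    have hlim : Filter.Tendsto (fun x : ℝ => C * x ^ (-((b : ℝ) - z.re))) Filter.atTop (nhds 0) := by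
      have := (tendsto_rpow_neg_atTop (y := (b : ℝ) - z.re) (by linarith)).const_mul C
      simpa using this
    refine squeeze_zero_norm' ?_ hlim
    filter_upwards [Filter.eventually_gt_atTop 0] with x hx
    refine (hnorm x hx).trans ?_
    rw [neg_sub, Real.rpow_sub hx, Real.rpow_natCast]
    have : ((1 + x) ^ b)⁻¹ ≤ (x ^ b)⁻¹ := by gcongr; linarith
    calc _ ≤ x ^ z.re * (C * (x ^ b)⁻¹) := by gcongr
      _ = _ := by ring
  have hi1 := integrableOn_cpow_smul (z := z - 1) hc hχ (by simp; linarith) (by simp; linarith)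
  have hi2 := integrableOn_cpow_smul (z := z) hc' hχ' (by linarith) h1
  have hder : ∀ x ∈ Set.Ioi (0 : ℝ), HasDerivAt (fun x : ℝ => (x : ℂ) ^ z * χ x)
      (z * ((x : ℂ) ^ (z - 1) • χ x) + (x : ℂ) ^ z • χ' x) x := fun x hx => by
    have hx : 0 < x := hx
    have h3 := (hasDerivAt_ofReal_cpow_const' hx.ne' (r := z - 1) (by
      intro h; apply hz; linear_combination h)).const_mul z
    rw [sub_add_cancel] at h3
    have h4 : HasDerivAt (fun x : ℝ => (x : ℂ) ^ z) (z * (x : ℂ) ^ (z - 1)) x := by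
      refine h3.congr_of_eventuallyEq (Filter.Eventually.of_forall fun y => ?_)
      simp only
      field_simp
    convert! h4.mul (hd x hx.le) using 1
    simp only [smul_eq_mul]
    ring
  have key := MeasureTheory.integral_Ioi_of_hasDerivAt_of_tendsto (a := 0)
    (f := fun x : ℝ => (x : ℂ) ^ z * χ x) (m := 0) ?_ hder
    ((hi1.const_mul z).add hi2) hFtop
  · rw [Complex.ofReal_zero, Complex.zero_cpow hz, zero_mul, sub_zero,
      MeasureTheory.integral_add (hi1.const_mul z) hi2, MeasureTheory.integral_const_mul] at key
    rw [mellin, mellin, add_sub_cancel_right]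
    field_simp
    linear_combination key
  · rw [← continuousWithinAt_Ioi_iff_Ici, ContinuousWithinAt, Complex.ofReal_zero,
      Complex.zero_cpow hz, zero_mul]
    exact hF0

/-- The iterated `x`-derivatives of `f(x)^{-e} / (1 + x^K)` are cut-off families. -/
theorem IsCutoffFamily.exists_deriv_chain {δ : ℝ} {f : Polynomial ℝ} {K : ℕ} (hK : K ≠ 0)
    (hδ : δ ≤ 1) (hf : ∀ x, -δ < x → 0 < f.eval x) :
    ∃ D : ℕ → ℂ × ℂ → ℝ → ℂ, (D 0 = fun p => cutoffPower f K p.2) ∧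
      (∀ j, IsCutoffFamily δ f K (D j)) ∧
      ∀ j p x, -δ < x → HasDerivAt (D j p) (D (j + 1) p x) x := by
  choose! next h1 _ h3 using fun (χ : ℂ × ℂ → ℝ → ℂ) (h : IsCutoffFamily δ f K χ) =>
    h.exists_hasDerivAt hK hδ hf
  refine ⟨fun j => next^[j] (fun p => cutoffPower f K p.2), rfl, ?_⟩
  have hfam : ∀ j, IsCutoffFamily δ f K (next^[j] (fun p => cutoffPower f K p.2)) := by
    intro j
    induction j with
    | zero => exact .base
    | succ j ih => rw [Function.iterate_succ_apply']; exact h1 _ ih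
  refine ⟨hfam, fun j p x hx => ?_⟩
  simp only
  rw [Function.iterate_succ_apply']
  exact h3 _ (hfam j) p x hx

theorem IsCutoffFamily.continuousOn {δ : ℝ} {f : Polynomial ℝ} {K : ℕ} {χ : ℂ × ℂ → ℝ → ℂ}
    (h : IsCutoffFamily δ f K χ) (hK : K ≠ 0)
    (hδ : δ ≤ 1) (hf : ∀ x, -δ < x → 0 < f.eval x) (p : ℂ × ℂ) : ContinuousOn (χ p) (Set.Ioi (-δ)) := by
  obtain ⟨χ', _, _, h3⟩ := h.exists_hasDerivAt hK hδ hf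
  exact fun x hx => (h3 p x hx).continuousAt.continuousWithinAt

/-- Holomorphy of the Mellin transform of a cut-off family along a holomorphic curve of
parameters, with the derivative taken under the integral sign. -/
theorem IsCutoffFamily.hasDerivAt_mellin {δ : ℝ} {f : Polynomial ℝ} {K : ℕ} {χ : ℂ × ℂ → ℝ → ℂ}
    (h : IsCutoffFamily δ f K χ) (hK : K ≠ 0) (hδ0 : 0 < δ) (hδ : δ ≤ 1)
    (hf : ∀ x, -δ < x → 0 < f.eval x) {R b : ℕ} (hKb : b + f.natDegree * R ≤ K)
    {p : ℂ → ℂ × ℂ} {z : ℂ → ℂ} (hp : Differentiable ℂ p) (hz : Differentiable ℂ z) {s₀ : ℂ}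
    (h0 : 0 < (z s₀).re) (h1 : (z s₀).re < b) (hR : |(p s₀).2.re| < R) :
    MeasureTheory.IntegrableOn (fun x : ℝ => deriv (fun s => (x : ℂ) ^ (z s - 1) • χ (p s) x) s₀)
        (Set.Ioi 0) ∧
      HasDerivAt (fun s => mellin (χ (p s)) (z s))
        (∫ x : ℝ in Set.Ioi 0, deriv (fun s => (x : ℂ) ^ (z s - 1) • χ (p s) x) s₀) s₀ := by
  obtain ⟨C, hC0, hC⟩ := h.exists_bound hδ0 (fun x hx => hf x (by linarith)) hKb (‖p s₀‖ + 1)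
  obtain ⟨r₁, hr1, hr1'⟩ := exists_between h0
  obtain ⟨r₂, hr2, hr2'⟩ := exists_between h1
  have hzc : ContinuousAt (fun s => (z s).re) s₀ :=
    (Complex.continuous_re.comp hz.continuous).continuousAt
  have hpc : ContinuousAt (fun s => ‖p s‖) s₀ := hp.continuous.norm.continuousAt
  have hRc : ContinuousAt (fun s => |(p s).2.re|) s₀ :=
    (Complex.continuous_re.comp hp.continuous.snd).abs.continuousAt
  have hev : ∀ᶠ s in nhds s₀, r₁ < (z s).re ∧ (z s).re < r₂ ∧ ‖p s‖ < ‖p s₀‖ + 1 ∧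
      |(p s).2.re| < R :=
    (hzc.eventually_const_lt hr1').and ((hzc.eventually_lt_const hr2).and
      ((hpc.eventually_lt_const (lt_add_one _)).and (hRc.eventually_lt_const hR)))
  obtain ⟨r, hr, hball⟩ := Metric.eventually_nhds_iff_ball.1 hev
  have hi1 := integrableOn_rpow_mul_inv_one_add_pow (r := r₁ - 1) (b := b) (by linarith)
    (by linarith)
  have hi2 := integrableOn_rpow_mul_inv_one_add_pow (r := r₂ - 1) (b := b) (by linarith)
    (by linarith)
  refine hasDerivAt_integral_of_holomorphic hr (F := fun s (x : ℝ) => (x : ℂ) ^ (z s - 1) • χ (p s) x)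
    (b := fun x => C * (x ^ (r₁ - 1) * ((1 + x) ^ b)⁻¹ + x ^ (r₂ - 1) * ((1 + x) ^ b)⁻¹))
    ?_ ?_ ?_ ((hi1.add hi2).const_mul C)
  · intro s _
    exact (continuousOn_cpow_smul _ ((h.continuousOn hK hδ hf (p s)).mono
      (Set.Ioi_subset_Ioi (by linarith)))).aestronglyMeasurable measurableSet_Ioi
  · filter_upwards [MeasureTheory.ae_restrict_mem measurableSet_Ioi] with x hx
    have hx : (0 : ℝ) < x := hx
    have h2 : Differentiable ℂ (fun s => χ (p s) x) := (h.differentiable x).comp hp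
    have h3 : Differentiable ℂ (fun s => (x : ℂ) ^ (z s - 1)) :=
      (hz.sub_const 1).const_cpow (Or.inl (by exact_mod_cast hx.ne'))
    exact (h3.smul h2).differentiableOn
  · filter_upwards [MeasureTheory.ae_restrict_mem measurableSet_Ioi] with x hx s hs
    obtain ⟨k1, k2, k3, k4⟩ := hball s hs
    exact norm_cpow_smul_le hx (hC (p s) k3.le k4.le x (le_of_lt hx)) (by simp; linarith)
      (by simp; linarith)

/-- Repeated integration by parts, which continues the Mellin transform to the left. -/
theorem mellin_cutoffPower_eq {δ : ℝ} {f : Polynomial ℝ} {K : ℕ} (hK : K ≠ 0) (hδ0 : 0 < δ)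
    (hδ : δ ≤ 1) (hf : ∀ x, -δ < x → 0 < f.eval x) {D : ℕ → ℂ × ℂ → ℝ → ℂ}
    (hD0 : D 0 = fun p => cutoffPower f K p.2) (hD : ∀ j, IsCutoffFamily δ f K (D j))
    (hDd : ∀ j p x, -δ < x → HasDerivAt (D j p) (D (j + 1) p x) x)
    {R b : ℕ} (hKb : b + f.natDegree * R ≤ K) (k : ℕ) (p : ℂ × ℂ) (z : ℂ) (h0 : 0 < z.re)
    (h1 : z.re + k < b) (hR : |p.2.re| ≤ R) :
    mellin (cutoffPower f K p.2) z =
      (-1) ^ k * (∏ i ∈ Finset.range k, (z + i))⁻¹ * mellin (D k p) (z + k) := by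
  induction k with
  | zero => simp [hD0]
  | succ k ih =>
    push_cast at h1
    rw [ih (by linarith)]
    have hf0 : ∀ x : ℝ, 0 ≤ x → 0 < f.eval x := fun x hx => hf x (by linarith)
    obtain ⟨C1, h10, h11⟩ := (hD k).exists_bound hδ0 hf0 hKb ‖p‖
    obtain ⟨C2, h20, h21⟩ := (hD (k + 1)).exists_bound hδ0 hf0 hKb ‖p‖
    rw [mellin_eq_neg_inv_mul_mellin_deriv (χ := D k p) (χ' := D (k + 1) p) (C := max C1 C2)
      (b := b) (fun x hx => hDd k p x (by linarith))
      (((hD (k + 1)).continuousOn hK hδ hf p).mono (Set.Ioi_subset_Ioi (by linarith)))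
      (fun x hx => (h11 p le_rfl hR x hx).trans (by gcongr; exact le_max_left _ _))
      (fun x hx => (h21 p le_rfl hR x hx).trans (by gcongr; exact le_max_right _ _))
      (by simp; positivity) (by simp; linarith)]
    rw [Finset.prod_range_succ, mul_inv, pow_succ]
    push_cast
    rw [add_assoc z]
    ring

/-- At the argument `1` the Mellin transform of a derivative is a boundary value at `0`, that is, a
Taylor coefficient up to a factorial. -/
theorem mellin_one_deriv_chain {δ : ℝ} {f : Polynomial ℝ} {K : ℕ} (hK : K ≠ 0) (hδ0 : 0 < δ)
    (hδ : δ ≤ 1) (hf : ∀ x, -δ < x → 0 < f.eval x) {D : ℕ → ℂ × ℂ → ℝ → ℂ}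
    (hD : ∀ j, IsCutoffFamily δ f K (D j))
    (hDd : ∀ j p x, -δ < x → HasDerivAt (D j p) (D (j + 1) p x) x)
    {R : ℕ} (hKb : 2 + f.natDegree * R ≤ K) (k : ℕ) (p : ℂ × ℂ) (hR : |p.2.re| ≤ R) :
    mellin (D (k + 1) p) 1 = -D k p 0 := by
  have hf0 : ∀ x : ℝ, 0 ≤ x → 0 < f.eval x := fun x hx => hf x (by linarith)
  obtain ⟨C1, h10, h11⟩ := (hD k).exists_bound hδ0 hf0 hKb ‖p‖
  obtain ⟨C2, h20, h21⟩ := (hD (k + 1)).exists_bound hδ0 hf0 hKb ‖p‖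
  have hi := integrableOn_cpow_smul (z := 0)
    (((hD (k + 1)).continuousOn hK hδ hf p).mono (Set.Ioi_subset_Ioi (by linarith)))
    (h21 p le_rfl hR) (by simp) (by norm_num)
  have hlim : Filter.Tendsto (D k p) Filter.atTop (nhds 0) := by
    have h2 : Filter.Tendsto (fun x : ℝ => C1 * ((1 + x) ^ 2)⁻¹) Filter.atTop (nhds 0) := by
      have : Filter.Tendsto (fun x : ℝ => (1 + x) ^ 2) Filter.atTop Filter.atTop :=
        (Filter.tendsto_pow_atTop two_ne_zero).comp (Filter.tendsto_atTop_add_const_left _ _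
          Filter.tendsto_id)
      simpa using this.inv_tendsto_atTop.const_mul C1
    refine squeeze_zero_norm' ?_ h2
    filter_upwards [Filter.eventually_ge_atTop 0] with x hx using h11 p le_rfl hR x hx
  have := MeasureTheory.integral_Ioi_of_hasDerivAt_of_tendsto' (a := 0)
    (fun x hx => hDd k p x (by have : (0 : ℝ) ≤ x := hx; linarith)) (by simpa using hi) hlim
  rw [mellin, sub_self]
  simpa using this

/-! ### Euler–Maclaurin summation of the cut-off terms -/

/-- The families `T_j` for which `t^{-w-j} T_j(a / t)` is the `j`-th derivative in `t` of
`t^{-w} T_0(a / t)`; the recursion is `T_{j+1}(x) = -(w + j) T_j(x) - x T_j'(x)`. -/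
theorem IsCutoffFamily.exists_scaled_chain {δ : ℝ} {f : Polynomial ℝ} {K : ℕ} (hK : K ≠ 0)
    (hδ : δ ≤ 1) (hf : ∀ x, -δ < x → 0 < f.eval x) :
    ∃ T : ℕ → ℂ × ℂ → ℝ → ℂ, (T 0 = fun p => cutoffPower f K p.2) ∧
      (∀ j, IsCutoffFamily δ f K (T j)) ∧
      ∀ j p x, -δ < x → ∃ d, HasDerivAt (T j p) d x ∧
        T (j + 1) p x = -(p.1 + j) * T j p x - x * d := by
  choose! der _ h2 h3 using fun (χ : ℂ × ℂ → ℝ → ℂ) (h : IsCutoffFamily δ f K χ) =>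
    h.exists_hasDerivAt hK hδ hf
  let T : ℕ → ℂ × ℂ → ℝ → ℂ := fun j => Nat.rec (fun p => cutoffPower f K p.2)
    (fun j χ p x => -(p.1 + j) * χ p x + (-1) * (x * der χ p x)) j
  have hfam : ∀ j, IsCutoffFamily δ f K (T j) := by
    intro j
    induction j with
    | zero => exact .base
    | succ j ih =>
      exact (ih.param_mul (c := fun p => -(p.1 + j)) (by fun_prop)).add
        ((h2 _ ih).param_mul (differentiable_const (-1)))
  refine ⟨T, rfl, hfam, fun j p x hx => ⟨_, h3 _ (hfam j) p x hx, ?_⟩⟩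
  change -(p.1 + j) * T j p x + (-1) * (x * der (T j) p x) = _
  ring

/-- The function `t ↦ t^{-w-j} T_j(a / t)`, where `p = (w, e)`, extended by `0` to `t ≤ 0`. For the
chains `T` used here it is the `j`-th derivative of `t ↦ t^{-w} T_0(a / t)`. -/
noncomputable def scaledTerm (T : ℕ → ℂ × ℂ → ℝ → ℂ) (a : ℝ) (j : ℕ) (p : ℂ × ℂ) (t : ℝ) : ℂ :=
  if 0 < t then (t : ℂ) ^ (-p.1 - j) * T j p (a / t) else 0

theorem inv_one_add_pow_le_rpow {y q : ℝ} {b : ℕ} (hy : 0 < y) (h0 : 0 ≤ q) (hq : q ≤ b) :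
    ((1 + y) ^ b)⁻¹ ≤ y ^ (-q) := by
  rw [Real.rpow_neg hy.le, ← Real.rpow_natCast (1 + y) b]
  refine inv_anti₀ (by positivity) ?_
  exact (Real.rpow_le_rpow hy.le (by linarith) h0).trans
    (Real.rpow_le_rpow_of_exponent_le (by linarith) hq)

theorem norm_scaledTerm_le {T : ℕ → ℂ × ℂ → ℝ → ℂ} {a C q t : ℝ} {b j : ℕ} {p : ℂ × ℂ} (ha : 0 < a)
    (hT : ∀ x, 0 ≤ x → ‖T j p x‖ ≤ C * ((1 + x) ^ b)⁻¹) (h0 : 0 ≤ q) (hq : q ≤ b) (ht : 0 < t) :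
    ‖scaledTerm T a j p t‖ ≤ C * a ^ (-q) * t ^ (q - p.1.re - j) := by
  have hC : 0 ≤ C := by simpa using (norm_nonneg _).trans (hT 0 le_rfl)
  rw [scaledTerm, if_pos ht, norm_mul, Complex.norm_cpow_eq_rpow_re_of_pos ht]
  have h1 := (hT (a / t) (by positivity)).trans
    (mul_le_mul_of_nonneg_left (inv_one_add_pow_le_rpow (div_pos ha ht) h0 hq) hC)
  refine (mul_le_mul_of_nonneg_left h1 (by positivity)).trans_eq ?_
  rw [Real.div_rpow ha.le ht.le, Real.rpow_neg ht.le q, div_inv_eq_mul,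
    show q - p.1.re - j = (-p.1 - (j : ℂ)).re + q by simp; ring, Real.rpow_add ht]
  ring

/-- An integrable bound in `t`, gaining a power of `a`: flatness at `0` handles `t ≤ 1`, decay at
infinity handles `t ≥ 1`. -/
theorem norm_scaledTerm_le_inv_one_add_sq {T : ℕ → ℂ × ℂ → ℝ → ℂ} {a C t : ℝ} {b j : ℕ} {p : ℂ × ℂ}
    (ha : 1 ≤ a) (hT : ∀ x, 0 ≤ x → ‖T j p x‖ ≤ C * ((1 + x) ^ b)⁻¹) (h2 : 2 ≤ p.1.re + j)
    (hb : p.1.re + j ≤ b) (ht : 0 < t) :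
    ‖scaledTerm T a j p t‖ ≤ 2 * C * a ^ (-(p.1.re + j - 2)) * (1 + t ^ 2)⁻¹ := by
  have hC : 0 ≤ C := by simpa using (norm_nonneg _).trans (hT 0 le_rfl)
  have ha0 : 0 < a := by linarith
  rcases le_total t 1 with h | h
  · have := norm_scaledTerm_le ha0 hT (q := p.1.re + j) (by linarith) hb ht
    rw [show p.1.re + j - p.1.re - j = 0 by ring, Real.rpow_zero, mul_one] at this
    refine this.trans ?_
    have h3 : a ^ (-(p.1.re + j)) ≤ a ^ (-(p.1.re + j - 2)) :=
      Real.rpow_le_rpow_of_exponent_le ha (by linarith)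
    have h4 : (1 : ℝ) ≤ 2 * (1 + t ^ 2)⁻¹ := by
      rw [← div_eq_mul_inv, one_le_div (by positivity)]
      nlinarith
    calc _ ≤ C * a ^ (-(p.1.re + j - 2)) * 1 := by rw [mul_one]; gcongr
      _ ≤ C * a ^ (-(p.1.re + j - 2)) * (2 * (1 + t ^ 2)⁻¹) := by gcongr
      _ = _ := by ring
  · have := norm_scaledTerm_le ha0 hT (q := p.1.re + j - 2) (by linarith) (by linarith) ht
    rw [show p.1.re + j - 2 - p.1.re - j = -(2 : ℕ) by push_cast; ring, Real.rpow_neg ht.le,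
      Real.rpow_natCast] at this
    refine this.trans ?_
    have h4 : (t ^ 2)⁻¹ ≤ 2 * (1 + t ^ 2)⁻¹ := by
      rw [← div_eq_mul_inv, inv_eq_one_div, div_le_div_iff₀ (by positivity) (by positivity)]
      nlinarith
    calc _ ≤ C * a ^ (-(p.1.re + j - 2)) * (2 * (1 + t ^ 2)⁻¹) := by gcongr
      _ = _ := by ring

section ScaledTerm

variable {δ : ℝ} {f : Polynomial ℝ} {K : ℕ} {T : ℕ → ℂ × ℂ → ℝ → ℂ}

theorem hasDerivAt_scaledTerm (hδ0 : 0 < δ)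
    (hTd : ∀ j p x, -δ < x → ∃ d, HasDerivAt (T j p) d x ∧
        T (j + 1) p x = -(p.1 + j) * T j p x - x * d)
    {a C : ℝ} {b j : ℕ} {p : ℂ × ℂ} (ha : 0 < a)
    (hT : ∀ x, 0 ≤ x → ‖T j p x‖ ≤ C * ((1 + x) ^ b)⁻¹) (h2 : 0 ≤ p.1.re + j + 2)
    (hb : p.1.re + j + 2 ≤ b) (t : ℝ) :
    HasDerivAt (scaledTerm T a j p) (scaledTerm T a (j + 1) p t) t := by
  rcases lt_trichotomy t 0 with h | h | h
  · rw [scaledTerm, if_neg (not_lt.2 h.le)]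
    refine (hasDerivAt_const t (0 : ℂ)).congr_of_eventuallyEq ?_
    filter_upwards [eventually_lt_nhds h] with y hy
    rw [scaledTerm, if_neg (not_lt.2 hy.le)]
  · -- at `t = 0` the decay of `T_j` at infinity makes the function flat
    subst h
    rw [scaledTerm, if_neg (lt_irrefl _)]
    have hO : (scaledTerm T a j p) =O[nhds 0] fun x => ‖x - 0‖ ^ 2 := by
      refine Asymptotics.IsBigO.of_bound (C * a ^ (-(p.1.re + j + 2)))
        (Filter.Eventually.of_forall fun x => ?_)
      have hC : 0 ≤ C := by simpa using (norm_nonneg _).trans (hT 0 le_rfl)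
      rcases le_or_gt x 0 with hx | hx
      · rw [scaledTerm, if_neg (not_lt.2 hx), norm_zero]
        positivity
      · have := norm_scaledTerm_le ha hT h2 hb hx
        rw [show p.1.re + j + 2 - p.1.re - j = (2 : ℕ) by push_cast; ring,
          Real.rpow_natCast] at this
        refine this.trans_eq ?_
        rw [sub_zero, norm_pow, norm_norm, Real.norm_of_nonneg hx.le]
    have := hO.hasFDerivAt (𝕜 := ℝ) one_lt_two
    rw [hasDerivAt_iff_hasFDerivAt]
    convert! this using 1
    ext
    simp
  · obtain ⟨d, hd, hT1⟩ := hTd j p (a / t) (by have := div_pos ha h; linarith)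
    rw [scaledTerm, if_pos h, hT1]
    have hinv : HasDerivAt (fun t : ℝ => a / t) (-a / t ^ 2) t := by
      have := (hasDerivAt_inv h.ne').const_mul a
      convert! this using 1
      ring
    have hcomp : HasDerivAt (fun t : ℝ => T j p (a / t)) (((-a / t ^ 2 : ℝ) : ℂ) * d) t := by
      rw [← Complex.real_smul]
      exact hd.scomp t hinv
    have hpow : HasDerivAt (fun t : ℝ => (t : ℂ) ^ (-p.1 - j))
        ((-p.1 - j) * (t : ℂ) ^ (-p.1 - j - 1)) t := by
      have hslit : (t : ℂ) ∈ Complex.slitPlane := Complex.ofReal_mem_slitPlane.2 h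
      have := ((hasDerivAt_id (t : ℂ)).cpow_const (c := -p.1 - j) hslit).comp_ofReal
      simpa using this
    have h5 := hpow.mul hcomp
    have h6 : HasDerivAt (scaledTerm T a j p)
        ((-p.1 - j) * (t : ℂ) ^ (-p.1 - j - 1) * T j p (a / t) +
          (t : ℂ) ^ (-p.1 - j) * (((-a / t ^ 2 : ℝ) : ℂ) * d)) t := by
      refine h5.congr_of_eventuallyEq ?_
      filter_upwards [eventually_gt_nhds h] with y hy
      rw [scaledTerm, if_pos hy]
      rfl
    convert! h6 using 1
    have ht : (t : ℂ) ≠ 0 := by exact_mod_cast h.ne'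
    rw [show (-p.1 - ((j + 1 : ℕ) : ℂ)) = -p.1 - j - 1 by push_cast; ring,
      Complex.cpow_sub _ _ ht, Complex.cpow_one]
    push_cast
    field_simp
    ring

/-- The Euler–Maclaurin remainder for the sum over `m` of `m^{-w} T_0(a / m)`. -/
noncomputable def remainderTerm (T : ℕ → ℂ × ℂ → ℝ → ℂ) (J : ℕ) (a : ℝ) (p : ℂ × ℂ) : ℂ :=
  (-1) ^ J * ∫ t in Set.Ioi (0 : ℝ), (bernoulliKernel (J + 1) t : ℂ) * scaledTerm T a (J + 1) p t

theorem exists_remainderTerm_bound (J : ℕ) : ∃ C₀ : ℝ, 0 ≤ C₀ ∧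
    ∀ (T : ℕ → ℂ × ℂ → ℝ → ℂ) (a C : ℝ) (b : ℕ) (p : ℂ × ℂ), 1 ≤ a →
      (∀ x, 0 ≤ x → ‖T (J + 1) p x‖ ≤ C * ((1 + x) ^ b)⁻¹) → 2 ≤ p.1.re + (J + 1 : ℕ) →
      p.1.re + (J + 1 : ℕ) ≤ b →
      (∀ t, 0 < t → ‖(bernoulliKernel (J + 1) t : ℂ) * scaledTerm T a (J + 1) p t‖
        ≤ C₀ * C * a ^ (-(p.1.re + (J + 1 : ℕ) - 2)) * (1 + t ^ 2)⁻¹) ∧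
      ‖remainderTerm T J a p‖ ≤ C₀ * C * a ^ (-(p.1.re + (J + 1 : ℕ) - 2)) * Real.pi := by
  obtain ⟨B, hB0, hB⟩ := exists_bernoulliKernel_bound (J + 1)
  refine ⟨2 * B, by positivity, fun T a C b p ha hT h2 hb => ?_⟩
  have hC : 0 ≤ C := by simpa using (norm_nonneg _).trans (hT 0 le_rfl)
  have hpt : ∀ t, 0 < t → ‖(bernoulliKernel (J + 1) t : ℂ) * scaledTerm T a (J + 1) p t‖
        ≤ 2 * B * C * a ^ (-(p.1.re + (J + 1 : ℕ) - 2)) * (1 + t ^ 2)⁻¹ := fun t ht => by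
    rw [norm_mul, Complex.norm_real]
    refine (mul_le_mul (hB t) (norm_scaledTerm_le_inv_one_add_sq ha hT h2 hb ht) (norm_nonneg _)
      hB0).trans_eq ?_
    ring
  refine ⟨hpt, ?_⟩
  rw [remainderTerm, norm_mul, norm_pow, norm_neg, norm_one, one_pow, one_mul]
  have hi := (integrable_inv_one_add_sq.const_mul
    (2 * B * C * a ^ (-(p.1.re + (J + 1 : ℕ) - 2))))
  refine (MeasureTheory.norm_integral_le_of_norm_le hi.integrableOn ?_).trans ?_
  · filter_upwards [MeasureTheory.ae_restrict_mem measurableSet_Ioi] with t ht using hpt t ht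
  · refine (MeasureTheory.setIntegral_le_integral hi (Filter.Eventually.of_forall fun t => by
      positivity)).trans_eq ?_
    rw [MeasureTheory.integral_const_mul, integral_univ_inv_one_add_sq]

theorem continuousOn_scaledTerm (hδ0 : 0 < δ)
    (hTd : ∀ j p x, -δ < x → ∃ d, HasDerivAt (T j p) d x ∧
        T (j + 1) p x = -(p.1 + j) * T j p x - x * d)
    {a : ℝ} (ha : 0 < a) (j : ℕ) (p : ℂ × ℂ) : ContinuousOn (scaledTerm T a j p) (Set.Ioi 0) := by
  have h : ContinuousOn (fun t : ℝ => (t : ℂ) ^ (-p.1 - j) • T j p (a / t)) (Set.Ioi 0) := by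
    refine continuousOn_cpow_smul _ fun t ht => ?_
    have ht : (0 : ℝ) < t := ht
    obtain ⟨d, hd, _⟩ := hTd j p (a / t) (by have := div_pos ha ht; linarith)
    exact (hd.continuousAt.comp (f := fun t : ℝ => a / t)
      (continuousAt_const.div continuousAt_id ht.ne')).continuousWithinAt
  exact h.congr fun t ht => by
    simp only [scaledTerm, if_pos (Set.mem_Ioi.1 ht), smul_eq_mul]

theorem differentiableAt_remainderTerm (hδ0 : 0 < δ) (hT : ∀ j, IsCutoffFamily δ f K (T j))
    (hf : ∀ x, -δ < x → 0 < f.eval x)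
    (hTd : ∀ j p x, -δ < x → ∃ d, HasDerivAt (T j p) d x ∧
        T (j + 1) p x = -(p.1 + j) * T j p x - x * d)
    {R b : ℕ} (hKb : b + f.natDegree * R ≤ K) {p : ℂ → ℂ × ℂ} (hp : Differentiable ℂ p) {s₀ : ℂ}
    {J : ℕ} (h2 : 2 < (p s₀).1.re + (J + 1 : ℕ)) (hb : (p s₀).1.re + (J + 1 : ℕ) < b)
    (hR : |(p s₀).2.re| < R) {a : ℝ} (ha : 1 ≤ a) :
    DifferentiableAt ℂ (fun s => remainderTerm T J a (p s)) s₀ := by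
  obtain ⟨C, hC0, hC⟩ := (hT (J + 1)).exists_bound hδ0 (fun x hx => hf x (by linarith)) hKb
    (‖p s₀‖ + 1)
  obtain ⟨C₀, hC₀, hrem⟩ := exists_remainderTerm_bound J
  have hzc : ContinuousAt (fun s => (p s).1.re + (J + 1 : ℕ)) s₀ :=
    ((Complex.continuous_re.comp hp.continuous.fst).add continuous_const).continuousAt
  have hpc : ContinuousAt (fun s => ‖p s‖) s₀ := hp.continuous.norm.continuousAt
  have hRc : ContinuousAt (fun s => |(p s).2.re|) s₀ :=
    (Complex.continuous_re.comp hp.continuous.snd).abs.continuousAt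
  have hev : ∀ᶠ s in nhds s₀, 2 < (p s).1.re + (J + 1 : ℕ) ∧ (p s).1.re + (J + 1 : ℕ) < b ∧
      ‖p s‖ < ‖p s₀‖ + 1 ∧ |(p s).2.re| < R :=
    (hzc.eventually_const_lt h2).and ((hzc.eventually_lt_const hb).and
      ((hpc.eventually_lt_const (lt_add_one _)).and (hRc.eventually_lt_const hR)))
  obtain ⟨r, hr, hball⟩ := Metric.eventually_nhds_iff_ball.1 hev
  have hi := (integrable_inv_one_add_sq.const_mul (C₀ * C)).integrableOn (s := Set.Ioi 0)
  refine DifferentiableAt.const_mul ?_ _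
  refine (hasDerivAt_integral_of_holomorphic hr
    (F := fun s (t : ℝ) => (bernoulliKernel (J + 1) t : ℂ) * scaledTerm T a (J + 1) (p s) t)
    (b := fun t => C₀ * C * (1 + t ^ 2)⁻¹) ?_ ?_ ?_ hi).2.differentiableAt
  · intro s _
    exact (Complex.measurable_ofReal.comp (measurable_bernoulliKernel _)).aestronglyMeasurable.mul
      ((continuousOn_scaledTerm hδ0 hTd (by linarith) (J + 1) (p s)).aestronglyMeasurable
        measurableSet_Ioi)
  · filter_upwards [MeasureTheory.ae_restrict_mem measurableSet_Ioi] with t ht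
    have ht : (0 : ℝ) < t := ht
    have h3 : Differentiable ℂ (fun s => T (J + 1) (p s) (a / t)) :=
      ((hT (J + 1)).differentiable (a / t)).comp hp
    have h4 : Differentiable ℂ (fun s => (t : ℂ) ^ (-(p s).1 - (J + 1 : ℕ))) :=
      (hp.fst.neg.sub_const _).const_cpow (Or.inl (by exact_mod_cast ht.ne'))
    simp only [scaledTerm, if_pos ht]
    exact ((h4.mul h3).const_mul _).differentiableOn
  · filter_upwards [MeasureTheory.ae_restrict_mem measurableSet_Ioi] with t ht s hs
    obtain ⟨k1, k2, k3, k4⟩ := hball s hs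
    refine ((hrem T a C b (p s) ha (hC _ k3.le k4.le) k1.le k2.le).1 t ht).trans ?_
    refine mul_le_mul_of_nonneg_right ?_ (by positivity)
    refine mul_le_of_le_one_right (by positivity) ?_
    exact Real.rpow_le_one_of_one_le_of_nonpos ha (by linarith)

/-- The sum over `n` of `n^{-s}` times the Euler–Maclaurin remainders. -/
noncomputable def remainderSum (T : ℕ → ℂ × ℂ → ℝ → ℂ) (J : ℕ) (s : ℂ) (p : ℂ × ℂ) : ℂ :=
  ∑' n : ℕ+, ((n : ℕ) : ℂ) ^ (-s) * remainderTerm T J (n : ℕ) p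

theorem summable_pnat_inv_sq : Summable (fun n : ℕ+ => (((n : ℕ) : ℝ) ^ 2)⁻¹) :=
  (Real.summable_nat_pow_inv.2 one_lt_two).comp_injective PNat.coe_injective

/-- The remainders decay in `n` as fast as the order `J` prescribes, so their sum is holomorphic in a
half-plane that grows with `J`. -/
theorem differentiableAt_remainderSum (hδ0 : 0 < δ) (hT : ∀ j, IsCutoffFamily δ f K (T j))
    (hf : ∀ x, -δ < x → 0 < f.eval x)
    (hTd : ∀ j p x, -δ < x → ∃ d, HasDerivAt (T j p) d x ∧
        T (j + 1) p x = -(p.1 + j) * T j p x - x * d)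
    {R b : ℕ} (hKb : b + f.natDegree * R ≤ K) {p : ℂ → ℂ × ℂ} (hp : Differentiable ℂ p) {s₀ : ℂ}
    {J : ℕ} (h2 : 2 < (p s₀).1.re + (J + 1 : ℕ)) (hb : (p s₀).1.re + (J + 1 : ℕ) < b)
    (hR : |(p s₀).2.re| < R) (h4 : 4 < s₀.re + (p s₀).1.re + (J + 1 : ℕ)) :
    DifferentiableAt ℂ (fun s => remainderSum T J s (p s)) s₀ := by
  obtain ⟨C, hC0, hC⟩ := (hT (J + 1)).exists_bound hδ0 (fun x hx => hf x (by linarith)) hKb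
    (‖p s₀‖ + 1)
  obtain ⟨C₀, hC₀, hrem⟩ := exists_remainderTerm_bound J
  have hzc : ContinuousAt (fun s => (p s).1.re + (J + 1 : ℕ)) s₀ :=
    ((Complex.continuous_re.comp hp.continuous.fst).add continuous_const).continuousAt
  have hsc : ContinuousAt (fun s => s.re + (p s).1.re + (J + 1 : ℕ)) s₀ :=
    ((Complex.continuous_re.add (Complex.continuous_re.comp hp.continuous.fst)).add
      continuous_const).continuousAt
  have hpc : ContinuousAt (fun s => ‖p s‖) s₀ := hp.continuous.norm.continuousAt
  have hRc : ContinuousAt (fun s => |(p s).2.re|) s₀ :=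
    (Complex.continuous_re.comp hp.continuous.snd).abs.continuousAt
  have hev : ∀ᶠ s in nhds s₀, 2 < (p s).1.re + (J + 1 : ℕ) ∧ (p s).1.re + (J + 1 : ℕ) < b ∧
      ‖p s‖ < ‖p s₀‖ + 1 ∧ |(p s).2.re| < R ∧ 4 < s.re + (p s).1.re + (J + 1 : ℕ) :=
    (hzc.eventually_const_lt h2).and ((hzc.eventually_lt_const hb).and
      ((hpc.eventually_lt_const (lt_add_one _)).and ((hRc.eventually_lt_const hR).and
        (hsc.eventually_const_lt h4))))
  obtain ⟨r, hr, hball⟩ := Metric.eventually_nhds_iff_ball.1 hev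
  refine (DifferentiableOn.differentiableAt (s := Metric.ball s₀ r) ?_ (Metric.ball_mem_nhds s₀ hr))
  refine Complex.differentiableOn_tsum_of_summable_norm
    (u := fun n : ℕ+ => C₀ * C * Real.pi * (((n : ℕ) : ℝ) ^ 2)⁻¹)
    (summable_pnat_inv_sq.mul_left _) (fun n s hs => ?_) Metric.isOpen_ball fun n s hs => ?_
  · obtain ⟨k1, k2, k3, k4, k5⟩ := hball s hs
    have hn : (1 : ℝ) ≤ (n : ℕ) := by exact_mod_cast n.2
    have hn0 : ((n : ℕ) : ℂ) ≠ 0 := by exact_mod_cast n.ne_zero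
    refine DifferentiableAt.differentiableWithinAt ?_
    exact (DifferentiableAt.const_cpow differentiableAt_id.neg (Or.inl hn0)).mul
      (differentiableAt_remainderTerm hδ0 hT hf hTd hKb hp k1 k2 k4 hn)
  · obtain ⟨k1, k2, k3, k4, k5⟩ := hball s hs
    have hn : (1 : ℝ) ≤ (n : ℕ) := by exact_mod_cast n.2
    have hn0 : (0 : ℝ) < (n : ℕ) := by linarith
    have h5 := (hrem T (n : ℕ) C b (p s) hn (hC _ k3.le k4.le) k1.le k2.le).2
    rw [norm_mul, Complex.norm_natCast_cpow_of_pos n.pos]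
    refine (mul_le_mul_of_nonneg_left h5 (by positivity)).trans ?_
    have h6 : ((n : ℕ) : ℝ) ^ (-s).re * ((n : ℕ) : ℝ) ^ (-((p s).1.re + (J + 1 : ℕ) - 2))
        ≤ (((n : ℕ) : ℝ) ^ 2)⁻¹ := by
      rw [← Real.rpow_add hn0, ← Real.rpow_natCast, ← Real.rpow_neg hn0.le]
      refine Real.rpow_le_rpow_of_exponent_le hn ?_
      rw [Complex.neg_re]
      push_cast at k5 ⊢
      linarith
    calc _ = C₀ * C * Real.pi * (((n : ℕ) : ℝ) ^ (-s).re *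
          ((n : ℕ) : ℝ) ^ (-((p s).1.re + (J + 1 : ℕ) - 2))) := by ring
      _ ≤ _ := by gcongr

end ScaledTerm

theorem hasSum_pnat_cpow {s : ℂ} (hs : 1 < s.re) :
    HasSum (fun n : ℕ+ => ((n : ℕ) : ℂ) ^ (-s)) (riemannZeta s) := by
  have h1 : Summable (fun n : ℕ => ((n + 1 : ℕ) : ℂ) ^ (-s)) := by
    have := (Complex.summable_one_div_nat_cpow.2 hs).comp_injective (add_left_injective 1)
    refine this.congr fun n => ?_
    simp [Complex.cpow_neg]
  have h2 := h1.hasSum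
  have h3 : ∑' n : ℕ, ((n + 1 : ℕ) : ℂ) ^ (-s) = riemannZeta s := by
    rw [zeta_eq_tsum_one_div_nat_add_one_cpow hs]
    refine tsum_congr fun n => ?_
    rw [Complex.cpow_neg, one_div]
    push_cast
    rfl
  rw [h3] at h2
  exact (Equiv.pnatEquivNat.symm.hasSum_iff (f := fun n : ℕ+ => ((n : ℕ) : ℂ) ^ (-s))).1 h2

theorem summable_norm_pnat_cpow {s : ℂ} (hs : 1 < s.re) :
    Summable (fun n : ℕ+ => ‖((n : ℕ) : ℂ) ^ (-s)‖) := (hasSum_pnat_cpow hs).summable.norm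

section HalfSum

variable {δ : ℝ} {f : Polynomial ℝ} {K : ℕ} {T : ℕ → ℂ × ℂ → ℝ → ℂ}

theorem setIntegral_scaledTerm_zero (hT0 : T 0 = fun p => cutoffPower f K p.2) {a : ℝ} (ha : 0 < a)
    (p : ℂ × ℂ) : ∫ t in Set.Ioi (0 : ℝ), scaledTerm T a 0 p t =
      (a : ℂ) ^ (1 - p.1) * mellin (cutoffPower f K p.2) (p.1 - 1) := by
  have h1 := mellin_comp_inv (fun t => cutoffPower f K p.2 (a * t)) (1 - p.1)
  rw [neg_sub, mellin_comp_mul_left _ _ ha, neg_sub, smul_eq_mul] at h1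
  rw [← h1, mellin]
  refine MeasureTheory.setIntegral_congr_fun measurableSet_Ioi fun t ht => ?_
  simp only [scaledTerm, if_pos (Set.mem_Ioi.1 ht), hT0, smul_eq_mul, div_eq_mul_inv]
  congr 2
  push_cast
  ring

/-- The Euler–Maclaurin formula for the sum over `m` of `m^{-w} f(a/m)^{-e} / (1 + (a/m)^K)`. -/
theorem eq_mellin_add_remainderTerm (hδ0 : 0 < δ)
    (hT0 : T 0 = fun p => cutoffPower f K p.2) (hT : ∀ j, IsCutoffFamily δ f K (T j))
    (hf : ∀ x, -δ < x → 0 < f.eval x)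
    (hTd : ∀ j p x, -δ < x → ∃ d, HasDerivAt (T j p) d x ∧
        T (j + 1) p x = -(p.1 + j) * T j p x - x * d)
    {R b J : ℕ} (hKb : b + f.natDegree * R ≤ K) {p : ℂ × ℂ} (h1 : 1 < p.1.re)
    (hb : p.1.re + J + 3 ≤ b) (hJ : 1 ≤ J) (hR : |p.2.re| ≤ R) {a : ℝ} (ha : 1 ≤ a) {S : ℂ}
    (hS : HasSum (fun m : ℕ+ => ((m : ℕ) : ℂ) ^ (-p.1) * cutoffPower f K p.2 (a / (m : ℕ))) S) :
    S = (a : ℂ) ^ (1 - p.1) * mellin (cutoffPower f K p.2) (p.1 - 1) + remainderTerm T J a p := by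
  have ha0 : 0 < a := by linarith
  have hb3 : (3 : ℝ) ≤ b := by
    have : (0 : ℝ) ≤ J := Nat.cast_nonneg J
    linarith
  have hbd : ∀ j, ∃ C : ℝ, ∀ x, 0 ≤ x → ‖T j p x‖ ≤ C * ((1 + x) ^ b)⁻¹ := fun j => by
    obtain ⟨C, _, hC⟩ := (hT j).exists_bound hδ0 (fun x hx => hf x (by linarith)) hKb ‖p‖
    exact ⟨C, hC p le_rfl hR⟩
  choose C hC using hbd
  have hderiv : ∀ j, j ≤ J + 1 → ∀ t,
      HasDerivAt (scaledTerm T a j p) (scaledTerm T a (j + 1) p t) t := fun j hj t =>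
    hasDerivAt_scaledTerm hδ0 hTd ha0 (hC j) (by have : (0 : ℝ) ≤ j := Nat.cast_nonneg j; linarith)
      (by have : (j : ℝ) ≤ J + 1 := by exact_mod_cast hj
          linarith) t
  have hcont : ∀ j, j ≤ J + 1 → Continuous (scaledTerm T a j p) := fun j hj =>
    continuous_iff_continuousAt.2 fun t => (hderiv j hj t).continuousAt
  have hC0 : ∀ j, 0 ≤ C j := fun j => by simpa using (norm_nonneg _).trans (hC j 0 le_rfl)
  have hpow : ∀ j, ∀ t, 0 < t → ‖scaledTerm T a j p t‖ ≤ C j * t ^ (-(p.1.re + j)) := by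
    intro j t ht
    have := norm_scaledTerm_le ha0 (hC j) (q := 0) le_rfl (by linarith) ht
    rw [neg_zero, Real.rpow_zero, mul_one, show 0 - p.1.re - (j : ℝ) = -(p.1.re + j) by ring] at this
    exact this
  have hlim : ∀ j, Filter.Tendsto (scaledTerm T a j p) Filter.atTop (nhds 0) := by
    intro j
    have h2 : Filter.Tendsto (fun t : ℝ => C j * t ^ (-(p.1.re + j))) Filter.atTop (nhds 0) := by
      have := (tendsto_rpow_neg_atTop (y := p.1.re + j)
        (by have : (0 : ℝ) ≤ j := Nat.cast_nonneg j; linarith)).const_mul (C j)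
      simpa using this
    refine squeeze_zero_norm' ?_ h2
    filter_upwards [Filter.eventually_gt_atTop 0] with t ht using hpow j t ht
  have hint : ∀ j, j ≤ J + 1 → MeasureTheory.IntegrableOn (scaledTerm T a j p) (Set.Ioi 0) := by
    intro j hj
    rw [← Set.Ioc_union_Ioi_eq_Ioi zero_le_one]
    refine MeasureTheory.IntegrableOn.union ?_ ?_
    · exact ((hcont j hj).integrableOn_Icc (a := 0) (b := 1)).mono_set Set.Ioc_subset_Icc_self
    · have h3 := (integrableOn_Ioi_rpow_of_lt (a := -(p.1.re + j))
        (by have : (0 : ℝ) ≤ j := Nat.cast_nonneg j; linarith) one_pos).const_mul (C j)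
      refine MeasureTheory.Integrable.mono' h3 (hcont j hj).aestronglyMeasurable ?_
      filter_upwards [MeasureTheory.ae_restrict_mem measurableSet_Ioi] with t ht
      exact hpow j t (lt_trans one_pos ht)
  have hS' : HasSum (fun m : ℕ => scaledTerm T a 0 p (m + 1)) S := by
    have := (Equiv.pnatEquivNat.symm.hasSum_iff).2 hS
    refine this.congr_fun fun m => ?_
    have hm : (0 : ℝ) < (m : ℝ) + 1 := by positivity
    simp [scaledTerm, hm, hT0]
  have := hasSum_eq_integral_add_bernoulliKernel (J := J) (u := fun j => scaledTerm T a j p) hderiv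
    (fun j _ => by simp [scaledTerm]) (fun j _ => hlim j) (hint 0 (by omega)) (hint (J + 1) le_rfl) hS'
  rw [this, setIntegral_scaledTerm_zero hT0 ha0, remainderTerm]

/-- The half of the double series in which the first index is cut off: in the half-plane of
convergence it is a zeta value times a Mellin transform, plus a remainder that is holomorphic in
a larger region. -/
theorem hasSum_half (hδ0 : 0 < δ)
    (hT0 : T 0 = fun p => cutoffPower f K p.2) (hT : ∀ j, IsCutoffFamily δ f K (T j))
    (hf : ∀ x, -δ < x → 0 < f.eval x)
    (hTd : ∀ j p x, -δ < x → ∃ d, HasDerivAt (T j p) d x ∧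
        T (j + 1) p x = -(p.1 + j) * T j p x - x * d)
    {R b J : ℕ} (hKb : b + f.natDegree * R ≤ K) {p : ℂ × ℂ} {s : ℂ} (hs : 1 < s.re)
    (h1 : 1 < p.1.re) (hb : p.1.re + J + 3 ≤ b) (hJ : 1 ≤ J) (hR : |p.2.re| ≤ R) :
    HasSum (fun q : ℕ+ × ℕ+ => ((q.1 : ℕ) : ℂ) ^ (-s) *
      (((q.2 : ℕ) : ℂ) ^ (-p.1) * cutoffPower f K p.2 ((q.1 : ℕ) / (q.2 : ℕ))))
      (riemannZeta (s + p.1 - 1) * mellin (cutoffPower f K p.2) (p.1 - 1) + remainderSum T J s p) := by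
  obtain ⟨C, hC0, hC⟩ := exists_cutoffPower_bound (fun x hx => hf x (by linarith)) hKb
  have hsum : Summable (fun q : ℕ+ × ℕ+ => ((q.1 : ℕ) : ℂ) ^ (-s) *
      (((q.2 : ℕ) : ℂ) ^ (-p.1) * cutoffPower f K p.2 ((q.1 : ℕ) / (q.2 : ℕ)))) := by
    have h2 := ((summable_norm_pnat_cpow hs).mul_of_nonneg (summable_norm_pnat_cpow h1)
      (fun _ => norm_nonneg _) (fun _ => norm_nonneg _)).mul_left C
    refine Summable.of_norm_bounded h2 fun q => ?_
    have hx : (0 : ℝ) ≤ (q.1 : ℕ) / (q.2 : ℕ) := by positivity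
    have h3 : ‖cutoffPower f K p.2 ((q.1 : ℕ) / (q.2 : ℕ))‖ ≤ C :=
      (hC _ hR _ hx).trans (mul_le_of_le_one_right hC0
        (inv_le_one_of_one_le₀ (one_le_pow₀ (by linarith))))
    rw [norm_mul, norm_mul]
    calc _ ≤ ‖((q.1 : ℕ) : ℂ) ^ (-s)‖ * (‖((q.2 : ℕ) : ℂ) ^ (-p.1)‖ * C) := by gcongr
      _ = _ := by ring
  have hfib : ∀ n : ℕ+, HasSum (fun m : ℕ+ => ((n : ℕ) : ℂ) ^ (-s) *
      (((m : ℕ) : ℂ) ^ (-p.1) * cutoffPower f K p.2 ((n : ℕ) / (m : ℕ))))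
      (((n : ℕ) : ℂ) ^ (-(s + p.1 - 1)) * mellin (cutoffPower f K p.2) (p.1 - 1)
        + ((n : ℕ) : ℂ) ^ (-s) * remainderTerm T J (n : ℕ) p) := by
    intro n
    have hn : (1 : ℝ) ≤ (n : ℕ) := by exact_mod_cast n.pos
    have hn0 : ((n : ℕ) : ℂ) ≠ 0 := by exact_mod_cast n.ne_zero
    have h2 := hsum.prod_factor n
    have hne : ((n : ℕ) : ℂ) ^ (-s) ≠ 0 := by simp [Complex.cpow_eq_zero_iff, hn0]
    have h3 := ((summable_mul_left_iff hne).1 h2).hasSum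
    have h4 := eq_mellin_add_remainderTerm hδ0 hT0 hT hf hTd hKb h1 hb hJ hR hn h3
    rw [h4] at h3
    have h5 := h3.mul_left (((n : ℕ) : ℂ) ^ (-s))
    convert! h5 using 1
    rw [mul_add, ← mul_assoc, Complex.ofReal_natCast, ← Complex.cpow_add _ _ hn0]
    congr 3
    ring
  have htot := hsum.hasSum.prod_fiberwise hfib
  have hW : 1 < (s + p.1 - 1).re := by simp; linarith
  have h6 := (hasSum_pnat_cpow hW).mul_right (mellin (cutoffPower f K p.2) (p.1 - 1))
  have h7 := htot.sub h6
  simp only [add_sub_cancel_left] at h7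
  have h8 : remainderSum T J s p = _ := h7.tsum_eq
  rw [h8, add_sub_cancel]
  exact hsum.hasSum

end HalfSum

/-! ### Taylor coefficients at zero and their dependence on the exponent -/

/-- A sequence of functions, each the derivative of its predecessor, consists of iterated
derivatives. -/
theorem iteratedDeriv_eq_of_chain {F : Type*} [NormedAddCommGroup F] [NormedSpace ℝ F] {U : Set ℝ}
    (hU : IsOpen U) {g : ℕ → ℝ → F} (hg : ∀ j, ∀ x ∈ U, HasDerivAt (g j) (g (j + 1) x) x) (j : ℕ) :
    ∀ x ∈ U, iteratedDeriv j (g 0) x = g j x := by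
  induction j with
  | zero => intro x _; simp
  | succ j ih =>
    intro x hx
    rw [iteratedDeriv_succ]
    have h : iteratedDeriv j (g 0) =ᶠ[nhds x] g j := by
      filter_upwards [hU.mem_nhds hx] with y hy using ih y hy
    rw [h.deriv_eq]
    exact (hg j x hx).deriv

theorem iteratedDeriv_pow_mul_zero {k K : ℕ} (hk : k < K) {g : ℝ → ℂ}
    (hg : ∀ᶠ x in nhds (0 : ℝ), ContDiffAt ℝ (⊤ : ℕ∞) g x) :
    iteratedDeriv k (fun x : ℝ => (x : ℂ) ^ K * g x) 0 = 0 := by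
  induction k generalizing K g with
  | zero => simp [(Nat.ne_of_gt hk)]
  | succ k ih =>
    rw [iteratedDeriv_succ']
    obtain ⟨K, rfl⟩ := Nat.exists_eq_succ_of_ne_zero (Nat.ne_zero_of_lt hk)
    have h : deriv (fun x : ℝ => (x : ℂ) ^ (K + 1) * g x) =ᶠ[nhds 0]
        fun x : ℝ => (x : ℂ) ^ K * ((K + 1) * g x + (x : ℂ) * deriv g x) := by
      filter_upwards [hg] with x hx
      have h1 : HasDerivAt (fun x : ℝ => (x : ℂ) ^ (K + 1)) ((K + 1) * (x : ℂ) ^ K) x := by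
        have := (hasDerivAt_pow (K + 1) (x : ℂ)).comp_ofReal
        simpa using this
      have h2 := (hx.differentiableAt (by simp)).hasDerivAt
      refine ((h1.mul h2).deriv).trans ?_
      ring
    rw [h.iteratedDeriv_eq]
    refine ih (by omega) ?_
    filter_upwards [hg] with x hx
    have h3 : ContDiffAt ℝ (⊤ : ℕ∞) (deriv g) x :=
      (hx.fderiv_right (m := (⊤ : ℕ∞)) (by simp)).clm_apply contDiffAt_const
    exact (contDiffAt_const.mul hx).add (Complex.ofRealCLM.contDiff.contDiffAt.mul h3)

theorem contDiffAt_ofReal_one_add_pow {E : Type*} [NormedAddCommGroup E] [NormedSpace ℝ E] (K : ℕ)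
    {u : E → ℝ} {q : E} (hu : ContDiffAt ℝ (⊤ : ℕ∞) u q) :
    ContDiffAt ℝ (⊤ : ℕ∞) (fun q => ((1 + u q ^ K : ℝ) : ℂ)) q :=
  Complex.ofRealCLM.contDiff.contDiffAt.comp (f := fun q => 1 + u q ^ K) q
    (contDiffAt_const.add (hu.pow K))

theorem contDiff_eval (f : Polynomial ℝ) {n : WithTop ℕ∞} : ContDiff ℝ n (fun x => f.eval x) := by
  simpa using f.contDiff_aeval (𝕜 := ℝ) n

/-- The cutoff `1 / (1 + x^K)` does not change Taylor coefficients of order below `K`. -/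
theorem iteratedDeriv_div_one_add_pow {k K : ℕ} (hk : k < K) {g : ℝ → ℂ}
    (hg : ∀ᶠ x in nhds (0 : ℝ), ContDiffAt ℝ (⊤ : ℕ∞) g x) :
    iteratedDeriv k (fun x : ℝ => g x / ((1 + x ^ K : ℝ) : ℂ)) 0 = iteratedDeriv k g 0 := by
  have hne : ∀ᶠ x in nhds (0 : ℝ), ((1 + x ^ K : ℝ) : ℂ) ≠ 0 := by
    filter_upwards [eventually_gt_nhds (show (-1 : ℝ) < 0 by norm_num)] with x hx
    exact_mod_cast (one_add_pow_pos (Nat.ne_zero_of_lt hk) hx).ne'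
  have hq : ∀ᶠ x in nhds (0 : ℝ),
      ContDiffAt ℝ (⊤ : ℕ∞) (fun x : ℝ => g x / ((1 + x ^ K : ℝ) : ℂ)) x := by
    filter_upwards [hg, hne] with x h1 h2
    simp only [div_eq_mul_inv]
    exact h1.mul ((contDiffAt_ofReal_one_add_pow K contDiffAt_id).inv h2)
  have h : (fun x : ℝ => g x / ((1 + x ^ K : ℝ) : ℂ)) =ᶠ[nhds 0]
      fun x => g x - (x : ℂ) ^ K * (g x / ((1 + x ^ K : ℝ) : ℂ)) := by
    filter_upwards [hne] with x hx
    field_simp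
    push_cast
    ring
  rw [h.iteratedDeriv_eq, iteratedDeriv_fun_sub, iteratedDeriv_pow_mul_zero hk hq, sub_zero]
  · exact hg.self_of_nhds.of_le (by exact_mod_cast le_top)
  · refine ContDiffAt.mul ?_ (hq.self_of_nhds.of_le (by exact_mod_cast le_top))
    exact (Complex.ofRealCLM.contDiff.contDiffAt).pow K

theorem iteratedDeriv_ofReal_comp {g : ℝ → ℝ} {x : ℝ} {k : ℕ} (hg : ContDiffAt ℝ k g x) :
    iteratedDeriv k (fun x => ((g x : ℝ) : ℂ)) x = ((iteratedDeriv k g x : ℝ) : ℂ) := by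
  have := Complex.ofRealCLM.iteratedFDeriv_comp_left (f := g) (x := x) (n := k) hg (i := k) le_rfl
  rw [iteratedDeriv_eq_iteratedFDeriv, iteratedDeriv_eq_iteratedFDeriv]
  have h2 := congrArg (fun m => m fun _ => (1 : ℝ)) this
  exact h2

/-- Differentiation in a parameter commutes with the iterated derivative in the variable. -/
theorem hasDerivAt_iteratedDeriv_param {U : Set ℝ} (hU : IsOpen U) (k : ℕ) {Φ : ℝ × ℝ → ℂ}
    (hΦ : ContDiffOn ℝ (⊤ : ℕ∞) Φ (Set.univ ×ˢ U)) (e₀ : ℝ) {x : ℝ} (hx : x ∈ U) :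
    HasDerivAt (fun e => iteratedDeriv k (fun x => Φ (e, x)) x)
      (iteratedDeriv k (fun x => deriv (fun e => Φ (e, x)) e₀) x) e₀ := by
  have hV : IsOpen (Set.univ ×ˢ U : Set (ℝ × ℝ)) := isOpen_univ.prod hU
  induction k generalizing Φ x with
  | zero =>
    simp only [iteratedDeriv_zero]
    have hd : DifferentiableAt ℝ Φ (e₀, x) :=
      (hΦ.contDiffAt (hV.mem_nhds ⟨trivial, hx⟩)).differentiableAt (by simp)
    exact (DifferentiableAt.comp (g := Φ) (f := fun e : ℝ => (e, x)) e₀ hd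
      (by fun_prop)).hasDerivAt
  | succ k ih =>
    have hline₂ : ∀ q : ℝ × ℝ, HasDerivAt (fun x : ℝ => (q.1, x)) ((0 : ℝ), (1 : ℝ)) q.2 := fun q =>
      (hasDerivAt_const _ _).prodMk (hasDerivAt_id _)
    have hline₁ : ∀ q : ℝ × ℝ, HasDerivAt (fun e : ℝ => (e, q.2)) ((1 : ℝ), (0 : ℝ)) q.1 := fun q =>
      (hasDerivAt_id _).prodMk (hasDerivAt_const _ _)
    have hat : ∀ q ∈ (Set.univ ×ˢ U : Set (ℝ × ℝ)), ContDiffAt ℝ (⊤ : ℕ∞) Φ q := fun q hq =>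
      hΦ.contDiffAt (hV.mem_nhds hq)
    have hd2 : ∀ q ∈ (Set.univ ×ˢ U : Set (ℝ × ℝ)),
        deriv (fun x => Φ (q.1, x)) q.2 = fderiv ℝ Φ q (0, 1) := fun q hq =>
      (((hat q hq).differentiableAt (by simp)).hasFDerivAt.comp_hasDerivAt q.2 (hline₂ q)).deriv
    have hd1 : ∀ q ∈ (Set.univ ×ˢ U : Set (ℝ × ℝ)),
        deriv (fun e => Φ (e, q.2)) q.1 = fderiv ℝ Φ q (1, 0) := fun q hq =>
      (((hat q hq).differentiableAt (by simp)).hasFDerivAt.comp_hasDerivAt q.1 (hline₁ q)).deriv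
    have hF : ContDiffOn ℝ (⊤ : ℕ∞) (fderiv ℝ Φ) (Set.univ ×ˢ U) :=
      hΦ.fderiv_of_isOpen (m := (⊤ : ℕ∞)) hV (by simp)
    have hFd : ∀ q ∈ (Set.univ ×ˢ U : Set (ℝ × ℝ)),
        HasFDerivAt (fderiv ℝ Φ) (fderiv ℝ (fderiv ℝ Φ) q) q := fun q hq =>
      ((hF.contDiffAt (hV.mem_nhds hq)).differentiableAt (by simp)).hasFDerivAt
    have hΦ2 : ContDiffOn ℝ (⊤ : ℕ∞) (fun q : ℝ × ℝ => deriv (fun x => Φ (q.1, x)) q.2)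
        (Set.univ ×ˢ U) :=
      (hF.clm_apply contDiffOn_const).congr hd2
    have := ih hΦ2 hx
    simp only [iteratedDeriv_succ']
    refine this.congr_deriv (Filter.EventuallyEq.iteratedDeriv_eq _ ?_)
    filter_upwards [hU.mem_nhds hx] with y hy
    -- symmetry of the second derivative
    have hq : ((e₀, y) : ℝ × ℝ) ∈ (Set.univ ×ˢ U : Set (ℝ × ℝ)) := ⟨trivial, hy⟩
    have e1 : (fun e => deriv (fun x => Φ (e, x)) y) = fun e => fderiv ℝ Φ (e, y) (0, 1) :=
      funext fun e => hd2 (e, y) ⟨trivial, hy⟩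
    have e2 : (fun y => deriv (fun e => Φ (e, y)) e₀) =ᶠ[nhds y]
        fun y => fderiv ℝ Φ (e₀, y) (1, 0) := by
      filter_upwards [hU.mem_nhds hy] with z hz using hd1 (e₀, z) ⟨trivial, hz⟩
    rw [e1, e2.deriv_eq]
    have hv : ∀ v : ℝ × ℝ, HasFDerivAt (fun q => fderiv ℝ Φ q v)
        ((fderiv ℝ (fderiv ℝ Φ) (e₀, y)).flip v) (e₀, y) := fun v => by
      simpa using (hFd _ hq).clm_apply (hasFDerivAt_const v (e₀, y))
    have h1 : HasDerivAt (fun e => fderiv ℝ Φ (e, y) (0, 1))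
        (fderiv ℝ (fderiv ℝ Φ) (e₀, y) (1, 0) (0, 1)) e₀ :=
      HasFDerivAt.comp_hasDerivAt (f := fun e => (e, y)) e₀ (hv (0, 1)) (hline₁ (e₀, y))
    have h2 : HasDerivAt (fun y => fderiv ℝ Φ (e₀, y) (1, 0))
        (fderiv ℝ (fderiv ℝ Φ) (e₀, y) (0, 1) (1, 0)) y :=
      HasFDerivAt.comp_hasDerivAt (f := fun y => (e₀, y)) y (hv (1, 0)) (hline₂ (e₀, y))
    have hsymm : IsSymmSndFDerivAt ℝ Φ (e₀, y) := (hat _ hq).isSymmSndFDerivAt (by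
      simp only [minSmoothness_of_isRCLikeNormedField]
      exact WithTop.coe_le_coe.mpr (le_top : ((2 : ℕ) : ℕ∞) ≤ ⊤))
    rw [h1.deriv, h2.deriv]
    exact hsymm (1, 0) (0, 1)

section TaylorCoeff

variable {δ : ℝ} {f : Polynomial ℝ} {K : ℕ} {D : ℕ → ℂ × ℂ → ℝ → ℂ}

theorem eventually_contDiffAt_log (hδ0 : 0 < δ) (hf : ∀ x, -δ < x → 0 < f.eval x) :
    ∀ᶠ x in nhds (0 : ℝ), ContDiffAt ℝ (⊤ : ℕ∞) (fun x => Real.log (f.eval x)) x := by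
  filter_upwards [eventually_gt_nhds (show -δ < 0 by linarith)] with x hx
  exact ((contDiff_eval f).contDiffAt).log (hf x hx).ne'

theorem exp_natCast_mul_log {y : ℝ} (hy : 0 < y) (n : ℕ) :
    Complex.exp (-(-(n : ℂ)) * (Real.log y : ℂ)) = ((y ^ n : ℝ) : ℂ) := by
  rw [neg_neg, Complex.exp_nat_mul, ← Complex.ofReal_exp, Real.exp_log hy]
  push_cast
  rfl

/-- At `e = -n` the Taylor coefficients beyond the degree of `f^n` vanish. -/
theorem deriv_chain_zero_eq_zero (hδ0 : 0 < δ)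
    (hf : ∀ x, -δ < x → 0 < f.eval x)
    (hD0 : D 0 = fun p => cutoffPower f K p.2)
    (hDd : ∀ j p x, -δ < x → HasDerivAt (D j p) (D (j + 1) p x) x)
    {k n : ℕ} (hkK : k < K) (hk : n * f.natDegree < k) (w : ℂ) : D k (w, -(n : ℂ)) 0 = 0 := by
  have h0 : (0 : ℝ) ∈ Set.Ioi (-δ) := by simpa using hδ0
  have h1 := iteratedDeriv_eq_of_chain isOpen_Ioi (g := fun j => D j (w, -(n : ℂ)))
    (fun j x hx => hDd j _ x hx) k 0 h0
  rw [← h1]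
  have h2 : D 0 (w, -(n : ℂ)) =ᶠ[nhds 0]
      fun x => (((f ^ n).eval x : ℝ) : ℂ) / ((1 + x ^ K : ℝ) : ℂ) := by
    filter_upwards [isOpen_Ioi.mem_nhds h0] with x hx
    simp only [hD0, cutoffPower]
    rw [exp_natCast_mul_log (hf x hx), Polynomial.eval_pow]
  rw [h2.iteratedDeriv_eq, iteratedDeriv_div_one_add_pow hkK, iteratedDeriv_ofReal_comp]
  · have h3 : iteratedDeriv k (fun x => (f ^ n).eval x) 0 = (Polynomial.derivative^[k] (f ^ n)).eval 0 :=
      iteratedDeriv_eq_of_chain isOpen_univ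
        (g := fun j x => (Polynomial.derivative^[j] (f ^ n)).eval x) (fun j x _ => by
          rw [Function.iterate_succ_apply']; exact Polynomial.hasDerivAt _ _) k 0 trivial
    rw [h3, Polynomial.iterate_derivative_eq_zero ((Polynomial.natDegree_pow_le).trans_lt hk)]
    simp
  · exact (contDiff_eval (f ^ n)).contDiffAt
  · exact Filter.Eventually.of_forall fun x =>
      Complex.ofRealCLM.contDiff.contDiffAt.comp x (contDiff_eval (f ^ n)).contDiffAt

/-- The derivative in the exponent of a Taylor coefficient of `f^{-e}` at `e = -n` is the
coefficient of `-f^n log f`. -/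
theorem hasDerivAt_deriv_chain_zero (hδ0 : 0 < δ) (hδ : δ ≤ 1) (hK : K ≠ 0)
    (hf : ∀ x, -δ < x → 0 < f.eval x)
    (hD0 : D 0 = fun p => cutoffPower f K p.2) (hD : ∀ j, IsCutoffFamily δ f K (D j))
    (hDd : ∀ j p x, -δ < x → HasDerivAt (D j p) (D (j + 1) p x) x)
    {k : ℕ} (hkK : k < K) (n : ℕ) (w : ℂ) :
    HasDerivAt (fun s => D k (w, s) 0)
      ((iteratedDeriv k (fun x => -(f.eval x) ^ n * Real.log (f.eval x)) 0 : ℝ) : ℂ) (-(n : ℂ)) := by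
  have h0 : (0 : ℝ) ∈ Set.Ioi (-δ) := by simpa using hδ0
  have hdiff : Differentiable ℂ (fun s => D k (w, s) 0) :=
    ((hD k).differentiable 0).comp (by fun_prop : Differentiable ℂ fun s : ℂ => (w, s))
  set Φ : ℝ × ℝ → ℂ := fun q => cutoffPower f K (q.1 : ℂ) q.2 with hΦdef
  have hΦ : ContDiffOn ℝ (⊤ : ℕ∞) Φ (Set.univ ×ˢ Set.Ioi (-δ)) := by
    intro q hq
    have hq2 : -δ < q.2 := hq.2
    refine ContDiffAt.contDiffWithinAt ?_
    have hlog : ContDiffAt ℝ (⊤ : ℕ∞) (fun q : ℝ × ℝ => Real.log (f.eval q.2)) q :=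
      (((contDiff_eval f).contDiffAt).comp q contDiffAt_snd).log (hf _ hq2).ne'
    have hlogc : ContDiffAt ℝ (⊤ : ℕ∞) (fun q : ℝ × ℝ => (Real.log (f.eval q.2) : ℂ)) q :=
      Complex.ofRealCLM.contDiff.contDiffAt.comp q hlog
    have hfst : ContDiffAt ℝ (⊤ : ℕ∞) (fun q : ℝ × ℝ => (q.1 : ℂ)) q :=
      Complex.ofRealCLM.contDiff.contDiffAt.comp q contDiffAt_fst
    have hden : ContDiffAt ℝ (⊤ : ℕ∞) (fun q : ℝ × ℝ => ((1 + q.2 ^ K : ℝ) : ℂ)) q :=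
      contDiffAt_ofReal_one_add_pow K contDiffAt_snd
    simp only [hΦdef, cutoffPower, div_eq_mul_inv]
    exact ((hfst.neg.mul hlogc).cexp).mul (hden.inv
      (by exact_mod_cast (one_add_pow_pos hK (by linarith : -1 < q.2)).ne'))
  have h1 := hasDerivAt_iteratedDeriv_param isOpen_Ioi k hΦ (-(n : ℝ)) h0
  have h2 : (fun e : ℝ => iteratedDeriv k (fun x => Φ (e, x)) 0) = fun e : ℝ => D k (w, (e : ℂ)) 0 := by
    funext e
    have := iteratedDeriv_eq_of_chain isOpen_Ioi (g := fun j => D j (w, (e : ℂ)))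
      (fun j x hx => hDd j _ x hx) k 0 h0
    rw [← this, hD0]
  rw [h2] at h1
  have h3 := (hdiff ((-(n : ℝ) : ℝ) : ℂ)).hasDerivAt.comp_ofReal
  have h4 := h3.unique h1
  have h5 : (fun x => deriv (fun e => Φ (e, x)) (-(n : ℝ))) =ᶠ[nhds 0] fun x =>
      ((-(f.eval x) ^ n * Real.log (f.eval x) : ℝ) : ℂ) / ((1 + x ^ K : ℝ) : ℂ) := by
    filter_upwards [isOpen_Ioi.mem_nhds h0] with x hx
    have h6 : HasDerivAt (fun e : ℝ => -(e : ℂ) * (Real.log (f.eval x) : ℂ))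
        (-1 * (Real.log (f.eval x) : ℂ)) (-(n : ℝ)) :=
      ((hasDerivAt_id (-(n : ℝ))).ofReal_comp.neg).mul_const _
    have h7 := (h6.cexp.div_const ((1 + x ^ K : ℝ) : ℂ)).deriv
    refine h7.trans ?_
    have h8 := exp_natCast_mul_log (hf x hx) n
    push_cast at h8 ⊢
    rw [h8]
    ring
  rw [h5.iteratedDeriv_eq, iteratedDeriv_div_one_add_pow hkK, iteratedDeriv_ofReal_comp] at h4
  · have h9 := (hdiff ((-(n : ℝ) : ℝ) : ℂ)).hasDerivAt
    rw [h4] at h9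
    simpa using h9
  · have hl := (eventually_contDiffAt_log hδ0 hf).self_of_nhds.of_le
      (show ((k : ℕ) : WithTop ℕ∞) ≤ ((⊤ : ℕ∞) : WithTop ℕ∞) by exact_mod_cast le_top)
    exact (((contDiff_eval f).contDiffAt.pow n).neg).mul hl
  · filter_upwards [eventually_contDiffAt_log hδ0 hf] with x hx
    exact Complex.ofRealCLM.contDiff.contDiffAt.comp x ((((contDiff_eval f).contDiffAt.pow n).neg).mul hx)

end TaylorCoeff

/-! ### Continuation of one half of the double series -/

/-- At the pole `s = 1` this follows from the entire completed zeta function. -/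
theorem meromorphicAt_riemannZeta (s : ℂ) : MeromorphicAt riemannZeta s := by
  by_cases hs : s = 1
  · subst hs
    have h0 : AnalyticAt ℂ completedRiemannZeta₀ 1 := differentiable_completedZeta₀.analyticAt 1
    have h1 : AnalyticAt ℂ (fun s => (Complex.Gammaℝ s)⁻¹) 1 :=
      Complex.differentiable_Gammaℝ_inv.analyticAt 1
    have h2 : AnalyticAt ℂ (fun s : ℂ => s) 1 := analyticAt_id
    have h3 : AnalyticAt ℂ (fun s : ℂ => 1 - s) 1 := analyticAt_const.sub analyticAt_id
    have h4 := ((h0.meromorphicAt.sub h2.meromorphicAt.inv).sub h3.meromorphicAt.inv).mul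
      h1.meromorphicAt
    refine h4.congr ?_
    have : ∀ᶠ s : ℂ in nhdsWithin 1 {1}ᶜ, s ≠ 0 :=
      nhdsWithin_le_nhds (isOpen_ne.mem_nhds one_ne_zero)
    filter_upwards [this] with s hs
    rw [riemannZeta_def_of_ne_zero hs, completedRiemannZeta_eq]
    simp [div_eq_mul_inv]
  · refine AnalyticAt.meromorphicAt ?_
    rw [Complex.analyticAt_iff_eventually_differentiableAt]
    filter_upwards [isOpen_ne.mem_nhds hs] with z hz using differentiableAt_riemannZeta hz

/-- The derivative of the Mellin transform of a cutoff family along curves through a point `q` of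
the parameter space is linear in the velocity of the curve. -/
theorem IsCutoffFamily.exists_linearMap_hasDerivAt_mellin {δ : ℝ} {f : Polynomial ℝ} {K : ℕ}
    {χ : ℂ × ℂ → ℝ → ℂ} (hχ : IsCutoffFamily δ f K χ) (hK : K ≠ 0) (hδ0 : 0 < δ) (hδ : δ ≤ 1)
    (hf : ∀ x, -δ < x → 0 < f.eval x) {R b : ℕ} (hKb : b + f.natDegree * R ≤ K) {q : ℂ × ℂ} {c : ℂ}
    (h0 : 0 < (q.1 + c).re) (h1 : (q.1 + c).re < b) (hR : |q.2.re| < R) :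
    ∃ L : ℂ × ℂ →ₗ[ℂ] ℂ, ∀ (p : ℂ → ℂ × ℂ) (s₀ : ℂ) (v : ℂ × ℂ), Differentiable ℂ p → p s₀ = q →
      HasDerivAt p v s₀ → HasDerivAt (fun s => mellin (χ (p s)) ((p s).1 + c)) (L v) s₀ := by
  set Ψ : ℝ → ℂ × ℂ → ℂ := fun x q => (x : ℂ) ^ (q.1 + c - 1) • χ q x with hΨ
  have hΨd : ∀ x : ℝ, 0 < x → Differentiable ℂ (Ψ x) := by
    intro x hx
    have hx' : (x : ℂ) ≠ 0 := by exact_mod_cast hx.ne'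
    refine Differentiable.fun_mul (?_ : Differentiable ℂ fun q : ℂ × ℂ => (x : ℂ) ^ (q.1 + c - 1))
      (hχ.differentiable x)
    refine Differentiable.const_cpow ?_ (Or.inl hx')
    exact (differentiable_fst.add_const c).sub_const 1
  have key : ∀ (p : ℂ → ℂ × ℂ) (s₀ : ℂ) (v : ℂ × ℂ), Differentiable ℂ p → p s₀ = q →
      HasDerivAt p v s₀ →
      MeasureTheory.IntegrableOn (fun x => fderiv ℂ (Ψ x) q v) (Set.Ioi 0) ∧
      HasDerivAt (fun s => mellin (χ (p s)) ((p s).1 + c))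
        (∫ x in Set.Ioi (0 : ℝ), fderiv ℂ (Ψ x) q v) s₀ := by
    intro p s₀ v hp hpq hv
    have h := hχ.hasDerivAt_mellin hK hδ0 hδ hf hKb hp (z := fun s => (p s).1 + c)
      (hp.fst.add_const c) (s₀ := s₀) (by rw [hpq]; exact h0) (by rw [hpq]; exact h1)
      (by rw [hpq]; exact hR)
    have hd : Set.EqOn (fun x : ℝ => deriv (fun s => (x : ℂ) ^ ((p s).1 + c - 1) • χ (p s) x) s₀)
        (fun x => fderiv ℂ (Ψ x) q v) (Set.Ioi 0) := by
      intro x hx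
      have h2 := (hΨd x hx (p s₀)).hasFDerivAt.comp_hasDerivAt s₀ hv
      rw [hpq] at h2
      exact h2.deriv
    rw [MeasureTheory.setIntegral_congr_fun measurableSet_Ioi hd] at h
    exact ⟨h.1.congr_fun hd measurableSet_Ioi, h.2⟩
  have hint : ∀ v : ℂ × ℂ, MeasureTheory.IntegrableOn (fun x => fderiv ℂ (Ψ x) q v) (Set.Ioi 0) := by
    intro v
    have h2 : HasDerivAt (fun s : ℂ => q + s • v) v 0 := by
      simpa using ((hasDerivAt_id (0 : ℂ)).smul_const v).const_add q
    exact (key (fun s => q + s • v) 0 v (by fun_prop) (by simp) h2).1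
  refine ⟨{ toFun := fun v => ∫ x in Set.Ioi (0 : ℝ), fderiv ℂ (Ψ x) q v
            map_add' := fun v u => ?_
            map_smul' := fun a v => ?_ }, fun p s₀ v hp hpq hv => (key p s₀ v hp hpq hv).2⟩
  · simp only [map_add]
    exact MeasureTheory.integral_add (hint v) (hint u)
  · simp only [map_smul, RingHom.id_apply]
    exact MeasureTheory.integral_smul a _

/-- The continuation of the half sum: the Mellin transform has been replaced by the expression
obtained after `k + 1` integrations by parts. -/
noncomputable def halfContinuation (T D : ℕ → ℂ × ℂ → ℝ → ℂ) (J k : ℕ) (s : ℂ) (p : ℂ × ℂ) : ℂ :=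
  riemannZeta (s + p.1 - 1) * ((-1) ^ (k + 1) * (∏ i ∈ Finset.range (k + 1), (p.1 - 1 + i))⁻¹ *
    mellin (D (k + 1) p) (p.1 + k)) + remainderSum T J s p

section HalfContinuation

variable {δ : ℝ} {f : Polynomial ℝ} {K : ℕ} {T D : ℕ → ℂ × ℂ → ℝ → ℂ}

theorem hasSum_halfContinuation (hδ0 : 0 < δ) (hδ : δ ≤ 1) (hf : ∀ x, -δ < x → 0 < f.eval x)
    (hK : K ≠ 0)
    (hT0 : T 0 = fun p => cutoffPower f K p.2) (hT : ∀ j, IsCutoffFamily δ f K (T j))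
    (hTd : ∀ j p x, -δ < x → ∃ d, HasDerivAt (T j p) d x ∧
      T (j + 1) p x = -(p.1 + j) * T j p x - x * d)
    (hD0 : D 0 = fun p => cutoffPower f K p.2) (hD : ∀ j, IsCutoffFamily δ f K (D j))
    (hDd : ∀ j p x, -δ < x → HasDerivAt (D j p) (D (j + 1) p x) x)
    {R b J k : ℕ} (hKb : b + f.natDegree * R ≤ K) {p : ℂ × ℂ} {s : ℂ} (hs : 1 < s.re)
    (h1 : 1 < p.1.re) (hb : p.1.re + J + 3 ≤ b) (hbk : p.1.re + k < b) (hJ : 1 ≤ J)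
    (hR : |p.2.re| ≤ R) :
    HasSum (fun q : ℕ+ × ℕ+ => ((q.1 : ℕ) : ℂ) ^ (-s) *
      (((q.2 : ℕ) : ℂ) ^ (-p.1) * cutoffPower f K p.2 ((q.1 : ℕ) / (q.2 : ℕ))))
      (halfContinuation T D J k s p) := by
  have h := hasSum_half hδ0 hT0 hT hf hTd hKb hs h1 hb hJ hR
  rw [mellin_cutoffPower_eq hK hδ0 hδ hf hD0 hD hDd hKb (k + 1) p (p.1 - 1) (by simpa using h1)
    (by push_cast; simp only [Complex.sub_re, Complex.one_re]; linarith) hR] at h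
  have e : p.1 - 1 + ((k + 1 : ℕ) : ℂ) = p.1 + k := by push_cast; ring
  rw [e] at h
  exact h

theorem analyticAt_remainderSum (hδ0 : 0 < δ) (hf : ∀ x, -δ < x → 0 < f.eval x)
    (hT : ∀ j, IsCutoffFamily δ f K (T j))
    (hTd : ∀ j p x, -δ < x → ∃ d, HasDerivAt (T j p) d x ∧
      T (j + 1) p x = -(p.1 + j) * T j p x - x * d)
    {R b J : ℕ} (hKb : b + f.natDegree * R ≤ K) {p : ℂ → ℂ × ℂ} (hp : Differentiable ℂ p) {s₀ : ℂ}
    (h2 : 2 < (p s₀).1.re + (J + 1 : ℕ)) (hb : (p s₀).1.re + (J + 1 : ℕ) < b)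
    (hR : |(p s₀).2.re| < R) (h4 : 4 < s₀.re + (p s₀).1.re + (J + 1 : ℕ)) :
    AnalyticAt ℂ (fun s => remainderSum T J s (p s)) s₀ := by
  rw [Complex.analyticAt_iff_eventually_differentiableAt]
  have c1 : Continuous fun s => (p s).1.re := Complex.continuous_re.comp hp.continuous.fst
  have c2 : Continuous fun s => |(p s).2.re| := (Complex.continuous_re.comp hp.continuous.snd).abs
  have c3 : Continuous fun s : ℂ => s.re := Complex.continuous_re
  filter_upwards [(continuousAt_const (y := (2 : ℝ))).eventually_lt
      (c1.add continuous_const).continuousAt h2,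
    (c1.add continuous_const).continuousAt.eventually_lt continuousAt_const hb,
    c2.continuousAt.eventually_lt continuousAt_const hR,
    (continuousAt_const (y := (4 : ℝ))).eventually_lt
      ((c3.add c1).add continuous_const).continuousAt h4] with s a1 a2 a3 a4
  exact differentiableAt_remainderSum hδ0 hT hf hTd hKb hp a1 a2 a3 a4

theorem IsCutoffFamily.analyticAt_mellin {χ : ℂ × ℂ → ℝ → ℂ} (hχ : IsCutoffFamily δ f K χ)
    (hK : K ≠ 0) (hδ0 : 0 < δ) (hδ : δ ≤ 1)
    (hf : ∀ x, -δ < x → 0 < f.eval x) {R b : ℕ} (hKb : b + f.natDegree * R ≤ K)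
    {p : ℂ → ℂ × ℂ} (hp : Differentiable ℂ p) {c : ℂ} {s₀ : ℂ}
    (h0 : 0 < ((p s₀).1 + c).re) (h1 : ((p s₀).1 + c).re < b) (hR : |(p s₀).2.re| < R) :
    AnalyticAt ℂ (fun s => mellin (χ (p s)) ((p s).1 + c)) s₀ := by
  rw [Complex.analyticAt_iff_eventually_differentiableAt]
  have c1 : Continuous fun s => ((p s).1 + c).re :=
    Complex.continuous_re.comp (hp.continuous.fst.add continuous_const)
  have c2 : Continuous fun s => |(p s).2.re| := (Complex.continuous_re.comp hp.continuous.snd).abs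
  filter_upwards [(continuousAt_const (y := (0 : ℝ))).eventually_lt c1.continuousAt h0,
    c1.continuousAt.eventually_lt continuousAt_const h1,
    c2.continuousAt.eventually_lt continuousAt_const hR] with s a1 a2 a3
  exact (hχ.hasDerivAt_mellin hK hδ0 hδ hf hKb hp (hp.fst.add_const c) a1 a2 a3).2.differentiableAt

theorem meromorphicAt_halfContinuation (hδ0 : 0 < δ) (hδ : δ ≤ 1)
    (hf : ∀ x, -δ < x → 0 < f.eval x) (hK : K ≠ 0)
    (hT : ∀ j, IsCutoffFamily δ f K (T j))
    (hTd : ∀ j p x, -δ < x → ∃ d, HasDerivAt (T j p) d x ∧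
      T (j + 1) p x = -(p.1 + j) * T j p x - x * d)
    (hD : ∀ j, IsCutoffFamily δ f K (D j))
    {R b J k : ℕ} (hKb : b + f.natDegree * R ≤ K) {p : ℂ → ℂ × ℂ} (hp : Differentiable ℂ p) {s₀ : ℂ}
    (h0 : 0 < (p s₀).1.re + k) (h0b : (p s₀).1.re + k < b)
    (h2 : 2 < (p s₀).1.re + (J + 1 : ℕ)) (hb : (p s₀).1.re + (J + 1 : ℕ) < b)
    (hR : |(p s₀).2.re| < R) (h4 : 4 < s₀.re + (p s₀).1.re + (J + 1 : ℕ)) :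
    MeromorphicAt (fun s => halfContinuation T D J k s (p s)) s₀ := by
  have hp1 : Differentiable ℂ fun s => (p s).1 := hp.fst
  refine MeromorphicAt.fun_add (MeromorphicAt.fun_mul ?_ (MeromorphicAt.fun_mul ?_ ?_)) ?_
  · exact (meromorphicAt_riemannZeta _).comp_analyticAt
      (g := fun s => s + (p s).1 - 1) (((differentiable_id.add hp1).sub_const 1).analyticAt _)
  · refine (MeromorphicAt.const _ _).fun_mul (MeromorphicAt.fun_inv (AnalyticAt.meromorphicAt ?_))
    exact Finset.analyticAt_fun_prod _ fun i _ => ((hp1.sub_const 1).add_const _).analyticAt _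
  · exact ((hD (k + 1)).analyticAt_mellin hK hδ0 hδ hf hKb hp (by simpa using h0)
      (by simpa using h0b) hR).meromorphicAt
  · exact (analyticAt_remainderSum hδ0 hf hT hTd hKb hp h2 hb hR h4).meromorphicAt

end HalfContinuation

/-! ### The half sums at the non-positive integers -/

section HalfContinuationValue

variable {δ : ℝ} {f : Polynomial ℝ} {K : ℕ} {T D : ℕ → ℂ × ℂ → ℝ → ℂ}

theorem prod_range_sub_add_eq (k : ℕ) :
    ∏ i ∈ Finset.range k, ((1 - (k : ℂ)) - 1 + i) = (-1) ^ k * (k.factorial : ℂ) := by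
  have h : ∀ i ∈ Finset.range k, ((1 - (k : ℂ)) - 1 + i) = -1 * (((k - 1 - i + 1 : ℕ)) : ℂ) := by
    intro i hi
    have hi' := Finset.mem_range.mp hi
    have : k - 1 - i + 1 = k - i := by omega
    rw [this, Nat.cast_sub hi'.le]
    ring
  rw [Finset.prod_congr rfl h, Finset.prod_mul_distrib, Finset.prod_const, Finset.card_range,
    Finset.prod_range_reflect (fun i => ((i + 1 : ℕ) : ℂ)) k, ← Finset.prod_range_add_one_eq_factorial]
  push_cast
  rfl

/-- Where the first parameter passes through `1 - k` the continuation of the half sum has a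
removable singularity, provided that the Mellin transform vanishes there. -/
theorem tendsto_halfContinuation {J k : ℕ} {p : ℂ → ℂ × ℂ} (hp : Differentiable ℂ p) {s₀ a m : ℂ}
    (ha : a ≠ 0) (hpa : ∀ s, (p s).1 = 1 - k + a * (s - s₀)) (hζ : s₀ - k ≠ 1)
    (hG0 : mellin (D (k + 1) (p s₀)) 1 = 0)
    (hG : HasDerivAt (fun s => mellin (D (k + 1) (p s)) ((p s).1 + k)) m s₀)
    (hrem : ContinuousAt (fun s => remainderSum T J s (p s)) s₀) :
    Filter.Tendsto (fun s => halfContinuation T D J k s (p s)) (nhdsWithin s₀ {s₀}ᶜ)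
      (nhds (riemannZeta (s₀ - k) * (-(m / (a * k.factorial))) + remainderSum T J s₀ (p s₀))) := by
  have hw0 : (p s₀).1 = 1 - k := by rw [hpa]; ring
  have hp1 : Differentiable ℂ fun s => (p s).1 := hp.fst
  have t1 : Filter.Tendsto (fun s => riemannZeta (s + (p s).1 - 1)) (nhdsWithin s₀ {s₀}ᶜ)
      (nhds (riemannZeta (s₀ - k))) := by
    have e : s₀ + (p s₀).1 - 1 = s₀ - k := by rw [hw0]; ring
    have c : ContinuousAt (fun s => s + (p s).1 - 1) s₀ :=
      ((differentiable_id.add hp1).sub_const 1).continuous.continuousAt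
    have hz : ContinuousAt riemannZeta (s₀ + (p s₀).1 - 1) := by
      rw [e]; exact (differentiableAt_riemannZeta hζ).continuousAt
    have := ContinuousAt.comp (f := fun s => s + (p s).1 - 1) hz c
    rw [ContinuousAt] at this
    simp only [Function.comp_apply, e] at this
    exact this.mono_left nhdsWithin_le_nhds
  have t2 : Filter.Tendsto (fun s => (∏ i ∈ Finset.range k, ((p s).1 - 1 + i))⁻¹)
      (nhdsWithin s₀ {s₀}ᶜ) (nhds ((-1) ^ k * (k.factorial : ℂ))⁻¹) := by
    have hc : ContinuousAt (fun s => ∏ i ∈ Finset.range k, ((p s).1 - 1 + (i : ℂ))) s₀ :=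
      tendsto_finsetProd _ fun i _ =>
        ((hp1.continuous.sub continuous_const).add continuous_const).continuousAt
    have e : ∏ i ∈ Finset.range k, ((p s₀).1 - 1 + (i : ℂ)) = (-1) ^ k * (k.factorial : ℂ) := by
      rw [hw0, prod_range_sub_add_eq]
    rw [ContinuousAt, e] at hc
    exact (hc.mono_left nhdsWithin_le_nhds).inv₀ (by
      simp [Nat.factorial_ne_zero])
  have t3 := hasDerivAt_iff_tendsto_slope.mp hG
  have t4 : Filter.Tendsto (fun s => remainderSum T J s (p s)) (nhdsWithin s₀ {s₀}ᶜ)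
      (nhds (remainderSum T J s₀ (p s₀))) := hrem.tendsto.mono_left nhdsWithin_le_nhds
  have t5 := (t1.mul (((t2.const_mul ((-1 : ℂ) ^ (k + 1))).mul (t3.const_mul a⁻¹)))).add t4
  refine (t5.congr' ?_).trans (le_of_eq ?_)
  · filter_upwards [self_mem_nhdsWithin] with s hs
    have hs' : s - s₀ ≠ 0 := sub_ne_zero.mpr hs
    have e : (p s).1 - 1 + k = a * (s - s₀) := by rw [hpa]; ring
    have hG0' : mellin (D (k + 1) (p s₀)) ((p s₀).1 + k) = 0 := by
      rw [hw0, sub_add_cancel, hG0]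
    rw [halfContinuation, Finset.prod_range_succ, e, slope_def_field, hG0', sub_zero, mul_inv,
      mul_inv]
    ring
  · congr 2
    rw [mul_inv, ← inv_pow, inv_neg_one, pow_succ]
    have : ((-1 : ℂ) ^ k) * (-1) ^ k = 1 := by rw [← mul_pow]; simp
    have hk : (k.factorial : ℂ) ≠ 0 := by exact_mod_cast k.factorial_ne_zero
    field_simp
    linear_combination (-m * riemannZeta (s₀ - k)) * this

/-- At `s = -n` the continuations along the curve of the zeta function and along the curve of the
polynomial comparison series differ by a Taylor coefficient of `-f^n log f`: the first velocity is
`d + 1` times the second plus a vector in the direction of the exponent. -/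
theorem exists_tendsto_halfContinuation (hδ0 : 0 < δ) (hδ : δ ≤ 1)
    (hf : ∀ x, -δ < x → 0 < f.eval x) (hK : K ≠ 0)
    (hT : ∀ j, IsCutoffFamily δ f K (T j))
    (hTd : ∀ j p x, -δ < x → ∃ d, HasDerivAt (T j p) d x ∧
      T (j + 1) p x = -(p.1 + j) * T j p x - x * d)
    (hD0 : D 0 = fun p => cutoffPower f K p.2) (hD : ∀ j, IsCutoffFamily δ f K (D j))
    (hDd : ∀ j p x, -δ < x → HasDerivAt (D j p) (D (j + 1) p x) x)
    {R b J d n k : ℕ} (hd : f.natDegree = d) (hk : k = 1 + (1 + d) * n)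
    (hKb : b + d * R ≤ K) (hb2 : 2 ≤ b) (hb : J + 2 < k + b) (hkK : k < K)
    (hJ : k + n + 2 < J) (hR : n < R) :
    ∃ l₁ l₂ : ℂ,
      Filter.Tendsto (fun s => halfContinuation T D J k s ((d + 1) * s, s))
        (nhdsWithin (-(n : ℂ)) {-(n : ℂ)}ᶜ) (nhds l₁) ∧
      Filter.Tendsto (fun s => halfContinuation T D J k s (s - d * n, -(n : ℂ)))
        (nhdsWithin (-(n : ℂ)) {-(n : ℂ)}ᶜ) (nhds l₂) ∧
      l₁ - l₂ = riemannZeta (-((d + 2) * (n : ℂ)) - 1) / (d + 1) * (negPowLogCoeff f n k : ℂ) := by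
  subst hd
  have hRr : (n : ℝ) < R := by exact_mod_cast hR
  have hkc : (k : ℂ) = 1 + (1 + f.natDegree) * n := by rw [hk]; push_cast; ring
  -- the common point of the three curves at `s = -n`
  set q : ℂ × ℂ := (1 - k, -(n : ℂ)) with hq
  have hq1 : q.1 + k = 1 := by simp [hq]
  obtain ⟨L, hL⟩ := (hD (k + 1)).exists_linearMap_hasDerivAt_mellin hK hδ0 hδ hf hKb (q := q)
    (c := (k : ℂ)) (by rw [hq1]; simp) (by rw [hq1]; simp; omega) (by simpa [hq] using hRr)
  have hM : ∀ w e : ℂ, |e.re| ≤ R → mellin (D (k + 1) (w, e)) 1 = -D k (w, e) 0 := fun w e he =>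
    mellin_one_deriv_chain hK hδ0 hδ hf hD hDd (R := R) (by omega) k (w, e) he
  have hG0 : mellin (D (k + 1) q) 1 = 0 := by
    rw [hM _ _ (by simpa using hRr.le), deriv_chain_zero_eq_zero hδ0 hf hD0 hDd hkK ?_, neg_zero]
    rw [hk]; nlinarith
  set p₁ : ℂ → ℂ × ℂ := fun s => ((f.natDegree + 1) * s, s) with hp₁
  set p₂ : ℂ → ℂ × ℂ := fun s => (s - f.natDegree * n, -(n : ℂ)) with hp₂
  set p₃ : ℂ → ℂ × ℂ := fun s => (1 - k, s) with hp₃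
  have d₁ : Differentiable ℂ p₁ := by fun_prop
  have d₂ : Differentiable ℂ p₂ := by fun_prop
  have d₃ : Differentiable ℂ p₃ := by fun_prop
  have q₁ : p₁ (-(n : ℂ)) = q :=
    Prod.ext (by simp only [hp₁, hq, hkc]; ring) rfl
  have q₂ : p₂ (-(n : ℂ)) = q :=
    Prod.ext (by simp only [hp₂, hq, hkc]; ring) rfl
  have v₁ : HasDerivAt p₁ ((f.natDegree + 1 : ℂ), (1 : ℂ)) (-(n : ℂ)) := by
    simpa using ((hasDerivAt_id (-(n : ℂ))).const_mul (f.natDegree + 1 : ℂ)).prodMk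
      (hasDerivAt_id (-(n : ℂ)))
  have v₂ : HasDerivAt p₂ ((1 : ℂ), (0 : ℂ)) (-(n : ℂ)) :=
    ((hasDerivAt_id (-(n : ℂ))).sub_const _).prodMk (hasDerivAt_const _ _)
  have v₃ : HasDerivAt p₃ ((0 : ℂ), (1 : ℂ)) (-(n : ℂ)) :=
    (hasDerivAt_const _ _).prodMk (hasDerivAt_id _)
  -- in the direction of the exponent the Mellin transform at `1` is a Taylor coefficient
  have L₃ : L (0, 1) = -((iteratedDeriv k
      (fun x => -(f.eval x) ^ n * Real.log (f.eval x)) 0 : ℝ) : ℂ) := by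
    refine (hL p₃ _ _ d₃ rfl v₃).unique ?_
    refine ((hasDerivAt_deriv_chain_zero hδ0 hδ hK hf hD0 hD hDd hkK n
      (1 - k)).neg).congr_of_eventuallyEq ?_
    have hc : ContinuousAt (fun s : ℂ => |s.re|) (-(n : ℂ)) :=
      (Complex.continuous_re.abs).continuousAt
    filter_upwards [hc.eventually_lt (continuousAt_const (y := (R : ℝ))) (by simpa using hRr)]
      with s hs
    simp only [hp₃, sub_add_cancel, Pi.neg_apply]
    exact hM _ _ hs.le
  have hLv : L ((f.natDegree + 1 : ℂ), (1 : ℂ)) = (f.natDegree + 1) * L (1, 0) + L (0, 1) := by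
    rw [← smul_eq_mul, ← map_smul, ← map_add]
    simp
  have hζ : -(n : ℂ) - k ≠ 1 := by
    intro h
    have := congrArg Complex.re h
    simp only [Complex.sub_re, Complex.neg_re, Complex.natCast_re, Complex.one_re] at this
    have h1 : (0 : ℝ) ≤ n := n.cast_nonneg
    have h2 : (0 : ℝ) ≤ k := k.cast_nonneg
    linarith
  have hJr : (k : ℝ) + n + 2 < J := by exact_mod_cast hJ
  have hbr : (J : ℝ) + 2 < k + b := by exact_mod_cast hb
  have hn0 : (0 : ℝ) ≤ n := n.cast_nonneg
  have hre : q.1.re = 1 - k := by simp [hq]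
  have hrem : ∀ p : ℂ → ℂ × ℂ, Differentiable ℂ p → p (-(n : ℂ)) = q →
      ContinuousAt (fun s => remainderSum T J s (p s)) (-(n : ℂ)) := fun p hp hpq =>
    (analyticAt_remainderSum hδ0 hf hT hTd hKb hp (by rw [hpq, hre]; push_cast; linarith)
      (by rw [hpq, hre]; push_cast; linarith) (by rw [hpq]; simpa [hq] using hRr)
      (by rw [hpq, hre]; push_cast; simp only [Complex.neg_re, Complex.natCast_re]; linarith)
      ).continuousAt
  have hd0 : (f.natDegree + 1 : ℂ) ≠ 0 := by exact_mod_cast Nat.succ_ne_zero f.natDegree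
  refine ⟨_, _, tendsto_halfContinuation d₁ hd0 (fun s => ?_) hζ (by rw [q₁, hG0])
    (hL p₁ _ _ d₁ q₁ v₁) (hrem p₁ d₁ q₁), tendsto_halfContinuation d₂ one_ne_zero (fun s => ?_) hζ
    (by rw [q₂, hG0]) (hL p₂ _ _ d₂ q₂ v₂) (hrem p₂ d₂ q₂), ?_⟩
  · simp only [hp₁, hkc]; ring
  · simp only [hp₂, hkc]; ring
  · have e : -(n : ℂ) - k = -((f.natDegree + 2) * (n : ℂ)) - 1 := by rw [hkc]; ring
    have hkf : (k.factorial : ℂ) ≠ 0 := by exact_mod_cast k.factorial_ne_zero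
    rw [q₁, q₂, hLv, L₃, e, negPowLogCoeff, taylorCoeffZero]
    push_cast
    field_simp
    ring

end HalfContinuationValue

/-! ### The reversed polynomial and the splitting of the double series -/

theorem eval_reverse_zero (f : Polynomial ℝ) : f.reverse.eval 0 = f.leadingCoeff := by
  rw [← Polynomial.coeff_zero_eq_eval_zero, Polynomial.coeff_zero_reverse]

theorem eval_reverse_pos {f : Polynomial ℝ} (hf : ∀ x : ℝ, 0 ≤ x → 0 < f.eval x) :
    ∀ x : ℝ, 0 ≤ x → 0 < f.reverse.eval x := by
  have hpos : ∀ x : ℝ, 0 < x → 0 < f.reverse.eval x := fun x hx => by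
    rw [eval_reverse_eq f x hx.ne']
    exact mul_pos (pow_pos hx _) (hf _ (by positivity))
  intro x hx
  rcases hx.eq_or_lt with rfl | hx
  · have h0 : (0 : ℝ) ≤ f.reverse.eval 0 := by
      have hc : Filter.Tendsto (fun x => f.reverse.eval x) (nhdsWithin 0 (Set.Ioi 0))
          (nhds (f.reverse.eval 0)) :=
        f.reverse.continuous.continuousAt.tendsto.mono_left nhdsWithin_le_nhds
      refine ge_of_tendsto hc ?_
      filter_upwards [self_mem_nhdsWithin] with x hx using (hpos x hx).le
    refine lt_of_le_of_ne h0 (Ne.symm ?_)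
    rw [eval_reverse_zero, Ne, Polynomial.leadingCoeff_eq_zero]
    rintro rfl
    simpa using hf 0 le_rfl
  · exact hpos x hx

theorem natDegree_reverse_of_pos {f : Polynomial ℝ} (hf : ∀ x : ℝ, 0 ≤ x → 0 < f.eval x) :
    f.reverse.natDegree = f.natDegree := by
  have h : f.natTrailingDegree = 0 := by
    refine Polynomial.natTrailingDegree_eq_zero.mpr (Or.inr ?_)
    rw [Polynomial.coeff_zero_eq_eval_zero]
    exact (hf 0 le_rfl).ne'
  rw [Polynomial.reverse_natDegree, h, Nat.sub_zero]

theorem exists_pos_on_Ioi {f : Polynomial ℝ} (hf : ∀ x : ℝ, 0 ≤ x → 0 < f.eval x) :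
    ∃ δ : ℝ, 0 < δ ∧ δ ≤ 1 ∧ ∀ x : ℝ, -δ < x → 0 < f.eval x := by
  have h : ∀ᶠ x in nhds (0 : ℝ), 0 < f.eval x :=
    (f.continuous.continuousAt (x := 0)).eventually (lt_mem_nhds (hf 0 le_rfl))
  obtain ⟨ε, hε, hb⟩ := Metric.eventually_nhds_iff.mp h
  refine ⟨min ε 1, lt_min hε one_pos, min_le_right _ _, fun x hx => ?_⟩
  rcases le_or_gt 0 x with h0 | h0
  · exact hf x h0
  · refine hb ?_
    rw [Real.dist_eq, sub_zero, abs_of_neg h0]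
    have := min_le_left ε 1
    linarith

theorem ofReal_cpow_eq_exp {x : ℝ} (hx : 0 < x) (s : ℂ) :
    (x : ℂ) ^ s = Complex.exp ((Real.log x : ℂ) * s) := by
  rw [Complex.cpow_def_of_ne_zero (by exact_mod_cast hx.ne'), Complex.ofReal_log hx.le]

/-- The two cutoffs `y^K / (x^K + y^K)` and `x^K / (x^K + y^K)` add up to one; the second one is the
cutoff of the reversed polynomial with the variables exchanged. -/
theorem cutoffPower_add_reverse {f : Polynomial ℝ} (hf : ∀ x : ℝ, 0 ≤ x → 0 < f.eval x) (K : ℕ)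
    {x y : ℝ} (hx : 0 < x) (hy : 0 < y) (s e : ℂ) :
    (x : ℂ) ^ (-s) * ((y : ℂ) ^ (-(s + f.natDegree * e)) * cutoffPower f K e (x / y)) +
      (y : ℂ) ^ (-s) * ((x : ℂ) ^ (-(s + f.natDegree * e)) * cutoffPower f.reverse K e (y / x)) =
    (x : ℂ) ^ (-s) * (y : ℂ) ^ (-(s + f.natDegree * e)) *
      Complex.exp (-e * (Real.log (f.eval (x / y)) : ℂ)) := by
  have hF : 0 < f.eval (x / y) := hf _ (by positivity)
  have hlog : Real.log (f.reverse.eval (y / x)) =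
      f.natDegree * (Real.log y - Real.log x) + Real.log (f.eval (x / y)) := by
    rw [eval_reverse_eq f _ (by positivity), one_div_div, Real.log_mul (by positivity) hF.ne',
      Real.log_pow, Real.log_div hy.ne' hx.ne']
  have hxK : (x : ℂ) ^ K ≠ 0 := pow_ne_zero _ (by exact_mod_cast hx.ne')
  have hyK : (y : ℂ) ^ K ≠ 0 := pow_ne_zero _ (by exact_mod_cast hy.ne')
  have hsum : (x : ℂ) ^ K + (y : ℂ) ^ K ≠ 0 := by
    have : 0 < x ^ K + y ^ K := by positivity
    exact_mod_cast this.ne'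
  have e1 : (((1 + (x / y) ^ K : ℝ) : ℂ))⁻¹ = (y : ℂ) ^ K / (x ^ K + y ^ K) := by
    push_cast; rw [div_pow]; field_simp
    rw [add_comm, div_self (by rwa [add_comm])]
  have e2 : (((1 + (y / x) ^ K : ℝ) : ℂ))⁻¹ = (x : ℂ) ^ K / (x ^ K + y ^ K) := by
    push_cast; rw [div_pow]; field_simp
  have e3 : (y : ℂ) ^ K / ((x : ℂ) ^ K + y ^ K) + (x : ℂ) ^ K / (x ^ K + y ^ K) = 1 := by
    rw [← add_div, add_comm, div_self hsum]
  rw [cutoffPower, cutoffPower, hlog, ofReal_cpow_eq_exp hx, ofReal_cpow_eq_exp hy,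
    ofReal_cpow_eq_exp hx, ofReal_cpow_eq_exp hy, div_eq_mul_inv (Complex.exp _),
    div_eq_mul_inv (Complex.exp _), e1, e2]
  push_cast
  set a := (Real.log x : ℂ)
  set b := (Real.log y : ℂ)
  set l := (Real.log (f.eval (x / y)) : ℂ)
  have e4 : Complex.exp (b * -s) * (Complex.exp (a * -(s + f.natDegree * e)) *
      Complex.exp (-e * (f.natDegree * (b - a) + l))) =
      Complex.exp (a * -s) * (Complex.exp (b * -(s + f.natDegree * e)) * Complex.exp (-e * l)) := by
    simp only [← Complex.exp_add]
    congr 1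
    ring
  linear_combination (Complex.exp (a * -s) * (Complex.exp (b * -(s + f.natDegree * e)) *
    Complex.exp (-e * l))) * e3 + ((x : ℂ) ^ K / (x ^ K + y ^ K)) * e4

theorem zetaTerm_eq {f : Polynomial ℝ} (hf : ∀ x : ℝ, 0 ≤ x → 0 < f.eval x) (s : ℂ) (q : ℕ+ × ℕ+) :
    zetaTerm f s q = ((q.1 : ℕ) : ℂ) ^ (-s) * ((q.2 : ℕ) : ℂ) ^ (-(s + f.natDegree * s)) *
      Complex.exp (-s * (Real.log (f.eval ((q.1 : ℕ) / (q.2 : ℕ))) : ℂ)) := by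
  have h1 : (0 : ℝ) < (q.1 : ℕ) := by exact_mod_cast q.1.pos
  have h2 : (0 : ℝ) < (q.2 : ℕ) := by exact_mod_cast q.2.pos
  have hF : 0 < f.eval (((q.1 : ℕ) : ℝ) / (q.2 : ℕ)) := hf _ (by positivity)
  rw [zetaTerm, ofReal_cpow_eq_exp (by positivity), Real.log_mul (by positivity) hF.ne',
    Real.log_mul h1.ne' (by positivity), Real.log_pow, ← Complex.ofReal_natCast,
    ← Complex.ofReal_natCast, ofReal_cpow_eq_exp h1, ofReal_cpow_eq_exp h2, ← Complex.exp_add,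
    ← Complex.exp_add]
  congr 1
  push_cast
  ring

/-- The sum of `n^{-s} m^{-w} f(n / m)^{-e}`, `w = s + d e`, splits into two half sums, for `f` and
for its reversal. For `e = s` this is the zeta series. -/
theorem hasSum_of_hasSum_half {f : Polynomial ℝ} (hf : ∀ x : ℝ, 0 ≤ x → 0 < f.eval x) (K : ℕ)
    {s e w a b : ℂ} (hw : w = s + f.natDegree * e)
    (ha : HasSum (fun q : ℕ+ × ℕ+ => ((q.1 : ℕ) : ℂ) ^ (-s) *
      (((q.2 : ℕ) : ℂ) ^ (-w) * cutoffPower f K e ((q.1 : ℕ) / (q.2 : ℕ)))) a)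
    (hb : HasSum (fun q : ℕ+ × ℕ+ => ((q.1 : ℕ) : ℂ) ^ (-s) *
      (((q.2 : ℕ) : ℂ) ^ (-w) * cutoffPower f.reverse K e ((q.1 : ℕ) / (q.2 : ℕ)))) b) :
    HasSum (fun q : ℕ+ × ℕ+ => ((q.1 : ℕ) : ℂ) ^ (-s) * ((q.2 : ℕ) : ℂ) ^ (-w) *
      Complex.exp (-e * (Real.log (f.eval ((q.1 : ℕ) / (q.2 : ℕ))) : ℂ))) (a + b) := by
  subst hw
  have hb' := (Equiv.prodComm ℕ+ ℕ+).hasSum_iff.mpr hb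
  refine (ha.add hb').congr_fun ?_
  intro q
  have h1 : (0 : ℝ) < (q.1 : ℕ) := by exact_mod_cast q.1.pos
  have h2 : (0 : ℝ) < (q.2 : ℕ) := by exact_mod_cast q.2.pos
  have := cutoffPower_add_reverse hf K h1 h2 s e
  simpa using this.symm

theorem hasSum_pnat_cpow_mul {s t : ℂ} (hs : 1 < s.re) (ht : 1 < t.re) :
    HasSum (fun q : ℕ+ × ℕ+ => ((q.1 : ℕ) : ℂ) ^ (-s) * ((q.2 : ℕ) : ℂ) ^ (-t))
      (riemannZeta s * riemannZeta t) :=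
  HasSum.mul (f := fun n : ℕ+ => ((n : ℕ) : ℂ) ^ (-s)) (g := fun n : ℕ+ => ((n : ℕ) : ℂ) ^ (-t))
    (hasSum_pnat_cpow hs) (hasSum_pnat_cpow ht)
    (summable_mul_of_summable_norm (f := fun n : ℕ+ => ((n : ℕ) : ℂ) ^ (-s))
      (g := fun n : ℕ+ => ((n : ℕ) : ℂ) ^ (-t)) (summable_norm_pnat_cpow hs)
      (summable_norm_pnat_cpow ht))

/-- For the exponent `-n` the double series is a finite sum of products of zeta values. -/
theorem hasSum_comparison {f : Polynomial ℝ} (hf : ∀ x : ℝ, 0 ≤ x → 0 < f.eval x) {n d : ℕ}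
    (hd : f.natDegree = d) {s : ℂ} (hs : n * d + 1 < s.re) :
    HasSum (fun q : ℕ+ × ℕ+ => ((q.1 : ℕ) : ℂ) ^ (-s) * ((q.2 : ℕ) : ℂ) ^ (-(s - d * n)) *
      Complex.exp (-(-(n : ℂ)) * (Real.log (f.eval ((q.1 : ℕ) / (q.2 : ℕ))) : ℂ)))
      (∑ i ∈ Finset.range (n * d + 1), (((f ^ n).coeff i : ℝ) : ℂ) * riemannZeta (s - i) *
        riemannZeta (s - d * n + i)) := by
  have hterm : ∀ i ∈ Finset.range (n * d + 1), HasSum (fun q : ℕ+ × ℕ+ =>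
      (((f ^ n).coeff i : ℝ) : ℂ) * (((q.1 : ℕ) : ℂ) ^ (-(s - i)) *
        ((q.2 : ℕ) : ℂ) ^ (-(s - d * n + i))))
      ((((f ^ n).coeff i : ℝ) : ℂ) * riemannZeta (s - i) * riemannZeta (s - d * n + i)) := by
    intro i hi
    have hi' : (i : ℝ) ≤ n * d := by exact_mod_cast Nat.lt_succ_iff.mp (Finset.mem_range.mp hi)
    rw [mul_assoc]
    refine (hasSum_pnat_cpow_mul ?_ ?_).mul_left _
    · simp only [Complex.sub_re, Complex.natCast_re]; linarith
    · have : (0 : ℝ) ≤ i := i.cast_nonneg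
      simp only [Complex.add_re, Complex.sub_re, Complex.mul_re, Complex.natCast_re,
        Complex.natCast_im]
      linarith
  refine (hasSum_sum hterm).congr_fun ?_
  intro q
  have h1 : (0 : ℝ) < (q.1 : ℕ) := by exact_mod_cast q.1.pos
  have h2 : (0 : ℝ) < (q.2 : ℕ) := by exact_mod_cast q.2.pos
  have h1c : ((q.1 : ℕ) : ℂ) ≠ 0 := by exact_mod_cast h1.ne'
  have h2c : ((q.2 : ℕ) : ℂ) ≠ 0 := by exact_mod_cast h2.ne'
  have hdeg : (f ^ n).natDegree < n * d + 1 :=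
    Nat.lt_succ_of_le (hd ▸ Polynomial.natDegree_pow_le)
  rw [exp_natCast_mul_log (hf _ (by positivity)), ← Polynomial.eval_pow,
    Polynomial.eval_eq_sum_range' hdeg, Complex.ofReal_sum, Finset.mul_sum]
  refine Finset.sum_congr rfl fun i _ => ?_
  have e1 : -(s - (i : ℂ)) = -s + i := by ring
  have e2 : -(s - d * n + (i : ℂ)) = -(s - d * n) - i := by ring
  rw [e1, e2, Complex.cpow_add _ _ h1c, Complex.cpow_sub _ _ h2c, Complex.cpow_natCast,
    Complex.cpow_natCast]
  push_cast
  rw [div_pow]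
  ring

/-! ### Absolute convergence of the double series -/

/-- The base of the general term of the double series. -/
noncomputable def zetaBase (f : Polynomial ℝ) (q : ℕ+ × ℕ+) : ℝ :=
  (q.1 : ℝ) * (q.2 : ℝ) ^ (f.natDegree + 1) * f.eval ((q.1 : ℝ) / (q.2 : ℝ))

theorem zetaBase_pos {f : Polynomial ℝ} (hf : ∀ x : ℝ, 0 ≤ x → 0 < f.eval x) (q : ℕ+ × ℕ+) :
    0 < zetaBase f q := by
  have h1 : (0 : ℝ) < (q.1 : ℕ) := by exact_mod_cast q.1.pos
  have h2 : (0 : ℝ) < (q.2 : ℕ) := by exact_mod_cast q.2.pos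
  have hF := hf _ (div_pos h1 h2).le
  unfold zetaBase
  positivity

theorem norm_zetaTerm {f : Polynomial ℝ} (hf : ∀ x : ℝ, 0 ≤ x → 0 < f.eval x) (s : ℂ)
    (q : ℕ+ × ℕ+) : ‖zetaTerm f s q‖ = zetaBase f q ^ (-s.re) := by
  change ‖((zetaBase f q : ℝ) : ℂ) ^ (-s)‖ = _
  rw [Complex.norm_cpow_eq_rpow_re_of_pos (zetaBase_pos hf q), Complex.neg_re]

/-- Multiplying the lower bounds `f(x) ≥ c` and `f(x) ≥ c x^d` gives a bound symmetric in the two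
summation variables. -/
theorem exists_le_zetaBase {f : Polynomial ℝ} (hf : ∀ x : ℝ, 0 ≤ x → 0 < f.eval x) :
    ∃ c : ℝ, 0 < c ∧ ∀ q : ℕ+ × ℕ+,
      c * (((q.1 : ℝ) * (q.2 : ℝ)) ^ (((f.natDegree : ℝ) + 2) / 2)) ≤ zetaBase f q := by
  obtain ⟨C₁, hC₁, h₁⟩ := exists_bounds_of_pos hf
  obtain ⟨C₂, hC₂, h₂⟩ := exists_bounds_of_pos (eval_reverse_pos hf)
  set C := max C₁ C₂ with hC
  have hC0 : 0 < C := lt_of_lt_of_le (by linarith) (le_max_left C₁ C₂)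
  refine ⟨C⁻¹, by positivity, fun q => ?_⟩
  have hx : (0 : ℝ) < (q.1 : ℕ) := by exact_mod_cast q.1.pos
  have hy : (0 : ℝ) < (q.2 : ℕ) := by exact_mod_cast q.2.pos
  set x : ℝ := ((q.1 : ℕ) : ℝ)
  set y : ℝ := ((q.2 : ℕ) : ℝ)
  set d := f.natDegree
  have b1 : C⁻¹ ≤ f.eval (x / y) :=
    (inv_anti₀ (by linarith) (le_max_left C₁ C₂)).trans (h₁ _ (by positivity)).1
  have b2 : C⁻¹ * (x / y) ^ d ≤ f.eval (x / y) := by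
    have h := (inv_anti₀ (by linarith) (le_max_right C₁ C₂)).trans (h₂ (y / x) (by positivity)).1
    rw [eval_reverse_eq f _ (by positivity), one_div_div] at h
    calc C⁻¹ * (x / y) ^ d ≤ ((y / x) ^ d * f.eval (x / y)) * (x / y) ^ d := by gcongr
      _ = f.eval (x / y) := by
        rw [mul_right_comm, ← mul_pow, div_mul_div_comm, mul_comm y x, div_self (by positivity),
          one_pow, one_mul]
  have hF : 0 ≤ f.eval (x / y) := (hf _ (by positivity)).le
  have hB : 0 < zetaBase f q := zetaBase_pos hf q
  refine (pow_le_pow_iff_left₀ (by positivity) hB.le two_ne_zero).mp ?_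
  have e1 : (C⁻¹ * (x * y) ^ (((d : ℝ) + 2) / 2)) ^ 2 = C⁻¹ ^ 2 * (x * y) ^ (d + 2) := by
    rw [mul_pow, ← Real.rpow_natCast ((x * y) ^ (((d : ℝ) + 2) / 2)), ← Real.rpow_mul (by positivity),
      ← Real.rpow_natCast (x * y)]
    congr 2
    push_cast
    ring
  rw [e1]
  calc C⁻¹ ^ 2 * (x * y) ^ (d + 2)
      = (x * y ^ (d + 1)) ^ 2 * (C⁻¹ * (C⁻¹ * (x / y) ^ d)) := by
        rw [div_pow]; field_simp; ring
    _ ≤ (x * y ^ (d + 1)) ^ 2 * (f.eval (x / y) * f.eval (x / y)) := by gcongr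
    _ = zetaBase f q ^ 2 := by
        change _ = (x * y ^ (d + 1) * f.eval (x / y)) ^ 2
        ring

theorem summable_zetaBase_rpow {f : Polynomial ℝ} (hf : ∀ x : ℝ, 0 ≤ x → 0 < f.eval x) {σ : ℝ}
    (hσ : 2 / ((f.natDegree : ℝ) + 2) < σ) : Summable fun q => zetaBase f q ^ (-σ) := by
  obtain ⟨c, hc, hB⟩ := exists_le_zetaBase hf
  have hd : (0 : ℝ) < (f.natDegree : ℝ) + 2 := by positivity
  have hσ0 : 0 < σ := lt_trans (by positivity) hσ
  set h : ℝ := ((f.natDegree : ℝ) + 2) / 2 with hh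
  have h1 : 1 < ((h * σ : ℝ) : ℂ).re := by
    rw [div_lt_iff₀ hd] at hσ
    rw [Complex.ofReal_re, hh]
    linarith
  have hs := ((summable_norm_pnat_cpow h1).mul_of_nonneg (summable_norm_pnat_cpow h1)
    (fun _ => norm_nonneg _) (fun _ => norm_nonneg _)).mul_left (c ^ (-σ))
  refine Summable.of_nonneg_of_le (fun q => Real.rpow_nonneg (zetaBase_pos hf q).le _) (fun q => ?_) hs
  have hx : (0 : ℝ) < (q.1 : ℕ) := by exact_mod_cast q.1.pos
  have hy : (0 : ℝ) < (q.2 : ℕ) := by exact_mod_cast q.2.pos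
  refine (Real.rpow_le_rpow_of_nonpos (by positivity) (hB q) (by linarith)).trans (le_of_eq ?_)
  rw [Complex.norm_natCast_cpow_of_pos q.1.pos, Complex.norm_natCast_cpow_of_pos q.2.pos,
    Real.mul_rpow hc.le (by positivity), ← Real.rpow_mul (by positivity),
    Real.mul_rpow hx.le hy.le, Complex.neg_re, Complex.ofReal_re, mul_neg]

theorem summable_zetaTerm {f : Polynomial ℝ} (hf : ∀ x : ℝ, 0 ≤ x → 0 < f.eval x) {s : ℂ}
    (hs : 2 / ((f.natDegree : ℝ) + 2) < s.re) : Summable (zetaTerm f s) := by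
  refine Summable.of_norm ?_
  simpa only [norm_zetaTerm hf] using summable_zetaBase_rpow hf hs

theorem analyticAt_tsum_zetaTerm {f : Polynomial ℝ} (hf : ∀ x : ℝ, 0 ≤ x → 0 < f.eval x) {s : ℂ}
    (hs : 2 / ((f.natDegree : ℝ) + 2) < s.re) : AnalyticAt ℂ (fun s => ∑' q, zetaTerm f s q) s := by
  obtain ⟨a, ha, has⟩ := exists_between hs
  obtain ⟨b, hb⟩ := exists_gt s.re
  set U : Set ℂ := {z | a < z.re ∧ z.re < b} with hU
  have hUo : IsOpen U :=
    (isOpen_lt continuous_const Complex.continuous_re).inter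
      (isOpen_lt Complex.continuous_re continuous_const)
  have hdiff : DifferentiableOn ℂ (fun s => ∑' q, zetaTerm f s q) U := by
    refine Complex.differentiableOn_tsum_of_summable_norm
      ((summable_zetaBase_rpow hf ha).add (summable_zetaBase_rpow hf (hs.trans hb))) (fun q => ?_) hUo
      (fun q z hz => ?_)
    · have : ((zetaBase f q : ℝ) : ℂ) ≠ 0 := by exact_mod_cast (zetaBase_pos hf q).ne'
      exact (Differentiable.const_cpow differentiable_id.neg (Or.inl this)).differentiableOn
    · have hB := zetaBase_pos hf q
      rw [norm_zetaTerm hf]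
      -- the base may be smaller or larger than one
      rcases le_total 1 (zetaBase f q) with h1 | h1
      · have := Real.rpow_le_rpow_of_exponent_le h1 (neg_le_neg hz.1.le)
        have := Real.rpow_nonneg hB.le (-b)
        linarith
      · have := Real.rpow_le_rpow_of_exponent_ge hB h1 (neg_le_neg hz.2.le)
        have := Real.rpow_nonneg hB.le (-a)
        linarith
  exact hdiff.analyticAt (hUo.mem_nhds ⟨has, hb⟩)

/-! ### Continuation to strips -/

/-- A cutoff exponent `K`, depending only on the degree, for which the half sums of every positive
polynomial of degree `d` continue to the half-plane `Re w > -k`, `k = 1 + (1 + d) n`. -/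
theorem exists_halfContinuation (d n A : ℕ) (hA : n < A) :
    ∃ K : ℕ, ∀ f : Polynomial ℝ, f.natDegree = d → (∀ x : ℝ, 0 ≤ x → 0 < f.eval x) →
      ∃ H : ℂ → ℂ × ℂ → ℂ,
        (∀ (s : ℂ) (p : ℂ × ℂ), 1 < s.re → 1 < p.1.re → p.1.re < (d + 1) * A → |p.2.re| ≤ A →
          HasSum (fun q : ℕ+ × ℕ+ => ((q.1 : ℕ) : ℂ) ^ (-s) *
            (((q.2 : ℕ) : ℂ) ^ (-p.1) * cutoffPower f K p.2 ((q.1 : ℕ) / (q.2 : ℕ)))) (H s p)) ∧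
        (∀ (p : ℂ → ℂ × ℂ) (s₀ : ℂ), Differentiable ℂ p → 0 < (p s₀).1.re + (1 + (1 + d) * n) →
          (p s₀).1.re < (d + 1) * A → |(p s₀).2.re| < A → -(n + 1) < s₀.re →
          MeromorphicAt (fun s => H s (p s)) s₀) ∧
        ∃ l₁ l₂ : ℂ,
          Filter.Tendsto (fun s => H s ((d + 1) * s, s))
            (nhdsWithin (-(n : ℂ)) {-(n : ℂ)}ᶜ) (nhds l₁) ∧
          Filter.Tendsto (fun s => H s (s - d * n, -(n : ℂ)))
            (nhdsWithin (-(n : ℂ)) {-(n : ℂ)}ᶜ) (nhds l₂) ∧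
          l₁ - l₂ = riemannZeta (-((d + 2) * (n : ℂ)) - 1) / (d + 1) *
            (negPowLogCoeff f n (1 + (1 + d) * n) : ℂ) := by
  obtain ⟨k, hk⟩ : ∃ k, k = 1 + (1 + d) * n := ⟨_, rfl⟩
  -- `J` makes the remainder converge for `Re w > -k` and `Re s > -(n + 1)`; `b` is a decay exponent
  -- that suffices for `Re w < (d + 1) A`
  obtain ⟨J, hJ⟩ : ∃ J, J = k + n + 4 := ⟨_, rfl⟩
  obtain ⟨b, hb⟩ : ∃ b, b = (d + 1) * A + J + 3 := ⟨_, rfl⟩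
  refine ⟨b + d * A, fun f hd hf => ?_⟩
  obtain ⟨δ, hδ0, hδ, hfδ⟩ := exists_pos_on_Ioi hf
  have hK : b + d * A ≠ 0 := by omega
  have hKb : b + f.natDegree * A ≤ b + d * A := by rw [hd]
  obtain ⟨T, hT0, hT, hTd⟩ := IsCutoffFamily.exists_scaled_chain hK hδ hfδ
  obtain ⟨D, hD0, hD, hDd⟩ := IsCutoffFamily.exists_deriv_chain hK hδ hfδ
  have hkr : (k : ℝ) = 1 + (1 + d) * n := by rw [hk]; push_cast; ring
  have hJr : (J : ℝ) = k + n + 4 := by rw [hJ]; push_cast; ring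
  have hbr : (b : ℝ) = (d + 1) * A + J + 3 := by rw [hb]; push_cast; ring
  have hn0 : (0 : ℝ) ≤ n := n.cast_nonneg
  refine ⟨halfContinuation T D J k, fun s p hs h1 h2 h3 => ?_, fun p s₀ hp h1 h2 h3 h4 => ?_, ?_⟩
  · exact hasSum_halfContinuation hδ0 hδ hfδ hK hT0 hT hTd hD0 hD hDd hKb hs h1 (by linarith)
      (by linarith) (by omega) h3
  · exact meromorphicAt_halfContinuation hδ0 hδ hfδ hK hT hTd hD hKb hp (by linarith) (by linarith)
      (by push_cast; linarith) (by push_cast; linarith) h3 (by push_cast; linarith)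
  · rw [← hk]
    exact exists_tendsto_halfContinuation hδ0 hδ hfδ hK hT hTd hD0 hD hDd hd hk le_rfl (by omega)
      (by omega) (by rw [hb]; have := Nat.zero_le ((d + 1) * A); have := Nat.zero_le (d * A); omega)
      (by omega) hA

/-- Identity theorem for meromorphic functions. -/
theorem MeromorphicOn.eventuallyEq_of_isPreconnected {U : Set ℂ} {f g : ℂ → ℂ}
    (hf : MeromorphicOn f U) (hg : MeromorphicOn g U) (hU : IsPreconnected U) {x y : ℂ} (hx : x ∈ U)
    (hy : y ∈ U) (h : f =ᶠ[nhdsWithin x {x}ᶜ] g) : f =ᶠ[nhdsWithin y {y}ᶜ] g := by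
  have hsub : MeromorphicOn (f - g) U := hf.sub hg
  have hx' : meromorphicOrderAt (f - g) x = ⊤ := by
    rw [meromorphicOrderAt_eq_top_iff]
    filter_upwards [h] with z hz
    simp [hz]
  have hy' : meromorphicOrderAt (f - g) y = ⊤ := by
    by_contra hne
    exact hsub.meromorphicOrderAt_ne_top_of_isPreconnected hU hy hx hne hx'
  rw [meromorphicOrderAt_eq_top_iff] at hy'
  filter_upwards [hy'] with z hz
  exact sub_eq_zero.mp hz

theorem isOpen_reStrip (a b : ℝ) : IsOpen {s : ℂ | a < s.re ∧ s.re < b} :=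
  (isOpen_lt continuous_const Complex.continuous_re).inter
    (isOpen_lt Complex.continuous_re continuous_const)

theorem isPreconnected_reStrip (a b : ℝ) : IsPreconnected {s : ℂ | a < s.re ∧ s.re < b} :=
  ((convex_halfSpace_re_gt a).inter (convex_halfSpace_re_lt b)).isPreconnected

/-- The value of the continued zeta function at `-n`. -/
noncomputable def specialValue (f : Polynomial ℝ) (d n : ℕ) : ℂ :=
  riemannZeta (-(((d : ℂ) + 2) * (n : ℂ)) - 1) / ((d : ℂ) + 1) *
      ((negPowLogCoeff f n (1 + (1 + d) * n) : ℂ) +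
        (negPowLogCoeff f.reverse n (1 + (1 + d) * n) : ℂ)) +
    ∑ i ∈ Finset.range (n * d + 1),
      (((f ^ n).coeff i : ℝ) : ℂ) * riemannZeta (-(n : ℂ) - (i : ℂ)) *
        riemannZeta (-(((d : ℂ) + 1) * (n : ℂ)) + (i : ℂ))

/-- The strip contains `-n` and the lines just to the right of `Re s = n d + 1`, where the comparison
series converges. -/
theorem exists_strip_continuation {f : Polynomial ℝ} (hf : ∀ x : ℝ, 0 ≤ x → 0 < f.eval x) {d : ℕ}
    (hd : f.natDegree = d) (n A : ℕ) (hA : n * d + n + 2 < A) :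
    ∃ M : ℂ → ℂ, MeromorphicOn M {s | -(n + 1 / ((d : ℝ) + 1)) < s.re ∧ s.re < A} ∧
      (∀ s : ℂ, 1 < s.re → s.re < A → HasSum (zetaTerm f s) (M s)) ∧
      Filter.Tendsto M (nhdsWithin (-(n : ℂ)) {-(n : ℂ)}ᶜ) (nhds (specialValue f d n)) := by
  have hnd : 0 ≤ n * d := Nat.zero_le _
  have hAr : (n : ℝ) * d + n + 2 < A := by exact_mod_cast hA
  have hn0 : (0 : ℝ) ≤ n := n.cast_nonneg
  have hd0 : (0 : ℝ) ≤ d := d.cast_nonneg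
  have hnd0 : (0 : ℝ) ≤ n * d := by positivity
  have hd1 : (0 : ℝ) < (d : ℝ) + 1 := by positivity
  obtain ⟨K, hK⟩ := exists_halfContinuation d n A (by omega)
  obtain ⟨H, H1, H2, l₁, l₂, hl₁, hl₂, hl⟩ := hK f hd hf
  obtain ⟨G, G1, G2, m₁, m₂, hm₁, hm₂, hm⟩ :=
    hK f.reverse ((natDegree_reverse_of_pos hf).trans hd) (eval_reverse_pos hf)
  set U : Set ℂ := {s | -(n + 1 / ((d : ℝ) + 1)) < s.re ∧ s.re < A} with hU
  have hUre : ∀ s ∈ U, -1 < (d + 1) * (s.re + n) ∧ -(n + 1) < s.re ∧ s.re < A := by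
    intro s hs
    have h1 := hs.1
    have h2 : 1 / ((d : ℝ) + 1) ≤ 1 := by rw [div_le_one hd1]; linarith
    refine ⟨?_, by linarith, hs.2⟩
    have h3 : -(1 / ((d : ℝ) + 1)) < s.re + n := by linarith
    have h4 := mul_lt_mul_of_pos_left h3 hd1
    have h5 : ((d : ℝ) + 1) * -(1 / ((d : ℝ) + 1)) = -1 := by field_simp
    linarith
  have habs : ∀ s ∈ U, |s.re| < A := fun s hs => by
    obtain ⟨-, h1, h2⟩ := hUre s hs
    rw [abs_lt]
    constructor <;> linarith
  set p₁ : ℂ → ℂ × ℂ := fun s => ((d + 1) * s, s) with hp₁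
  set p₂ : ℂ → ℂ × ℂ := fun s => (s - d * n, -(n : ℂ)) with hp₂
  have d₁ : Differentiable ℂ p₁ := by fun_prop
  have d₂ : Differentiable ℂ p₂ := by fun_prop
  have re₁ : ∀ s, (p₁ s).1.re = (d + 1) * s.re := fun s => by simp [hp₁]
  have re₂ : ∀ s, (p₂ s).1.re = s.re - d * n := fun s => by simp [hp₂]
  have m1 : MeromorphicOn (fun s => H s (p₁ s) + G s (p₁ s)) U := fun s hs => by
    obtain ⟨h1, h2, h3⟩ := hUre s hs
    have a1 : 0 < (p₁ s).1.re + (1 + (1 + d) * n) := by rw [re₁]; linarith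
    have a2 : (p₁ s).1.re < (d + 1) * A := by rw [re₁]; gcongr
    exact (H2 p₁ s d₁ a1 a2 (habs s hs) h2).fun_add (G2 p₁ s d₁ a1 a2 (habs s hs) h2)
  have m2 : MeromorphicOn (fun s => H s (p₂ s) + G s (p₂ s)) U := fun s hs => by
    obtain ⟨h1, h2, h3⟩ := hUre s hs
    have a1 : 0 < (p₂ s).1.re + (1 + (1 + d) * n) := by rw [re₂]; linarith
    have a2 : (p₂ s).1.re < (d + 1) * A := by
      rw [re₂]
      have : 0 ≤ (d : ℝ) * A := by positivity
      linarith
    have a3 : |(p₂ s).2.re| < A := by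
      simp only [hp₂, Complex.neg_re, Complex.natCast_re, abs_neg, Nat.abs_cast]
      linarith
    exact (H2 p₂ s d₂ a1 a2 a3 h2).fun_add (G2 p₂ s d₂ a1 a2 a3 h2)
  refine ⟨fun s => H s (p₁ s) + G s (p₁ s), m1, fun s hs1 hs2 => ?_, ?_⟩
  · have h1 : 1 < (p₁ s).1.re := by
      rw [re₁]
      have : 0 ≤ (d : ℝ) * s.re := by positivity
      linarith
    have h2 : (p₁ s).1.re < (d + 1) * A := by rw [re₁]; gcongr
    have h3 : |(p₁ s).2.re| ≤ A := by
      simp only [hp₁]; rw [abs_of_pos (by linarith)]; exact hs2.le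
    have hw : (p₁ s).1 = s + f.natDegree * s := by simp only [hp₁, hd]; ring
    have h := hasSum_of_hasSum_half hf K hw (H1 s (p₁ s) hs1 h1 h2 h3) (G1 s (p₁ s) hs1 h1 h2 h3)
    rw [hw] at h
    simpa only [← zetaTerm_eq hf] using h
  · -- the comparison function: a finite sum of products of zeta values
    set C : ℂ → ℂ := fun s => ∑ i ∈ Finset.range (n * d + 1), (((f ^ n).coeff i : ℝ) : ℂ) *
      riemannZeta (s - i) * riemannZeta (s - d * n + i) with hC
    have hCm : MeromorphicOn C U := fun s _ => by
      refine MeromorphicAt.fun_sum fun i _ => ?_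
      refine ((MeromorphicAt.const _ _).fun_mul ?_).fun_mul ?_
      · exact (meromorphicAt_riemannZeta _).comp_analyticAt (g := fun s => s - (i : ℂ))
          ((differentiable_id.sub_const _).analyticAt s)
      · exact (meromorphicAt_riemannZeta _).comp_analyticAt (g := fun s => s - d * n + (i : ℂ))
          (((differentiable_id.sub_const _).add_const _).analyticAt s)
    have hCc : ContinuousAt C (-(n : ℂ)) := by
      refine tendsto_finsetSum _ fun i hi => ?_
      have hi' : (i : ℝ) ≤ n * d := by
        exact_mod_cast Nat.lt_succ_iff.mp (Finset.mem_range.mp hi)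
      have hi0 : (0 : ℝ) ≤ i := i.cast_nonneg
      have z1 : -(n : ℂ) - i ≠ 1 := fun h => by
        have := congrArg Complex.re h
        simp only [Complex.sub_re, Complex.neg_re, Complex.natCast_re, Complex.one_re] at this
        linarith
      have z2 : -(n : ℂ) - d * n + i ≠ 1 := fun h => by
        have := congrArg Complex.re h
        simp only [Complex.add_re, Complex.sub_re, Complex.neg_re, Complex.mul_re,
          Complex.natCast_re, Complex.natCast_im, Complex.one_re] at this
        linarith
      have c1 : ContinuousAt (fun s : ℂ => riemannZeta (s - i)) (-(n : ℂ)) :=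
        ContinuousAt.comp (g := riemannZeta) (f := fun s : ℂ => s - i)
          (differentiableAt_riemannZeta z1).continuousAt (by fun_prop)
      have c2 : ContinuousAt (fun s : ℂ => riemannZeta (s - d * n + i)) (-(n : ℂ)) :=
        ContinuousAt.comp (g := riemannZeta) (f := fun s : ℂ => s - d * n + i)
          (differentiableAt_riemannZeta z2).continuousAt (by fun_prop)
      exact (continuousAt_const.mul c1).mul c2
    have hx : ((n * d + 2 : ℝ) : ℂ) ∈ U := by
      have : 0 < 1 / ((d : ℝ) + 1) := by positivity
      refine ⟨?_, ?_⟩ <;> rw [Complex.ofReal_re] <;> linarith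
    have hy : -(n : ℂ) ∈ U := by
      have : 0 < 1 / ((d : ℝ) + 1) := by positivity
      refine ⟨?_, ?_⟩ <;> rw [Complex.neg_re, Complex.natCast_re] <;> linarith
    have heq : (fun s => H s (p₂ s) + G s (p₂ s)) =ᶠ[nhdsWithin ((n * d + 2 : ℝ) : ℂ)
        {((n * d + 2 : ℝ) : ℂ)}ᶜ] C := by
      refine nhdsWithin_le_nhds ?_
      filter_upwards [(isOpen_reStrip (n * d + 1) A).mem_nhds (x := ((n * d + 2 : ℝ) : ℂ))
        ⟨by rw [Complex.ofReal_re]; linarith, by rw [Complex.ofReal_re]; linarith⟩] with s hs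
      have hs1 : (n : ℝ) * d + 1 < s.re := hs.1
      have hs2 : s.re < A := hs.2
      have h0 : 1 < s.re := by linarith
      have h1 : 1 < (p₂ s).1.re := by rw [re₂]; linarith
      have h2 : (p₂ s).1.re < (d + 1) * A := by
        rw [re₂]
        have : 0 ≤ (d : ℝ) * A := by positivity
        linarith
      have h3 : |(p₂ s).2.re| ≤ A := by
        simp only [hp₂, Complex.neg_re, Complex.natCast_re, abs_neg, Nat.abs_cast]
        linarith
      have hw : (p₂ s).1 = s + f.natDegree * -(n : ℂ) := by simp only [hp₂, hd]; ring
      have h := hasSum_of_hasSum_half hf K hw (H1 s (p₂ s) h0 h1 h2 h3) (G1 s (p₂ s) h0 h1 h2 h3)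
      exact h.unique (hasSum_comparison hf hd hs1)
    -- the two expressions for the comparison series agree up to `-n`
    have heq' := m2.eventuallyEq_of_isPreconnected hCm (isPreconnected_reStrip _ _) hx hy heq
    have hlim : l₂ + m₂ = C (-(n : ℂ)) :=
      tendsto_nhds_unique ((hl₂.add hm₂).congr' heq')
        (hCc.tendsto.mono_left nhdsWithin_le_nhds)
    have hval : specialValue f d n = l₁ + m₁ := by
      have e : C (-(n : ℂ)) = ∑ i ∈ Finset.range (n * d + 1), (((f ^ n).coeff i : ℝ) : ℂ) *
          riemannZeta (-(n : ℂ) - (i : ℂ)) * riemannZeta (-(((d : ℂ) + 1) * (n : ℂ)) + (i : ℂ)) := by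
        refine Finset.sum_congr rfl fun i _ => ?_
        congr 2
        ring
      rw [specialValue, ← e, ← hlim, mul_add, ← hl, ← hm]
      ring
    rw [hval]
    exact hl₁.add hm₁

/-! ### Gluing the continuations and the special values -/

section Gluing

variable {f : Polynomial ℝ} {d : ℕ}

theorem tsum_zetaTerm_eventuallyEq (hf : ∀ x : ℝ, 0 ≤ x → 0 < f.eval x) {a b : ℝ} (ha : a < 2)
    (hb : 2 < b) {M : ℂ → ℂ} (hM : MeromorphicOn M {s | a < s.re ∧ s.re < b})
    (hsum : ∀ s : ℂ, 1 < s.re → s.re < b → HasSum (zetaTerm f s) (M s)) {s : ℂ}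
    (hs : 2 / ((f.natDegree : ℝ) + 2) < s.re) (has : a < s.re) (hsb : s.re < b) :
    M =ᶠ[nhdsWithin s {s}ᶜ] fun s => ∑' q, zetaTerm f s q := by
  have h1 : 2 / ((f.natDegree : ℝ) + 2) ≤ 1 := by
    rw [div_le_one (by positivity)]
    have : (0 : ℝ) ≤ f.natDegree := Nat.cast_nonneg _
    linarith
  set c := max a (2 / ((f.natDegree : ℝ) + 2)) with hc
  have hM' : MeromorphicOn M {s | c < s.re ∧ s.re < b} := hM.mono_set fun z hz =>
    ⟨(le_max_left _ _).trans_lt hz.1, hz.2⟩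
  have hS : MeromorphicOn (fun s => ∑' q, zetaTerm f s q) {s | c < s.re ∧ s.re < b} := fun z hz =>
    (analyticAt_tsum_zetaTerm hf ((le_max_right _ _).trans_lt hz.1)).meromorphicAt
  refine hM'.eventuallyEq_of_isPreconnected hS (isPreconnected_reStrip c b) (x := 2)
    ⟨max_lt (by simpa using ha) (by simp; linarith), by simpa using hb⟩ ⟨max_lt has hs, hsb⟩ ?_
  refine nhdsWithin_le_nhds ?_
  filter_upwards [(isOpen_reStrip 1 b).mem_nhds (x := 2) ⟨by simp, by simpa using hb⟩] with z hz
  exact (hsum z hz.1 hz.2).tsum_eq.symm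

/-- Two functions, each meromorphic on a vertical strip and equal to the sum of the double series
to the right of the line `Re s = 1`, agree near every common point of the strips. -/
theorem eventuallyEq_of_hasSum_zetaTerm {a b a' b' : ℝ} (ha : a < 2)
    (hb : 2 < b) (ha' : a' < 2) (hb' : 2 < b') {M M' : ℂ → ℂ}
    (hM : MeromorphicOn M {s | a < s.re ∧ s.re < b})
    (hM' : MeromorphicOn M' {s | a' < s.re ∧ s.re < b'})
    (hsum : ∀ s : ℂ, 1 < s.re → s.re < b → HasSum (zetaTerm f s) (M s))
    (hsum' : ∀ s : ℂ, 1 < s.re → s.re < b' → HasSum (zetaTerm f s) (M' s)) {s : ℂ}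
    (hs : a < s.re ∧ s.re < b) (hs' : a' < s.re ∧ s.re < b') : M =ᶠ[nhdsWithin s {s}ᶜ] M' := by
  have h1 : MeromorphicOn M {s | max a a' < s.re ∧ s.re < min b b'} := hM.mono_set fun z hz =>
    ⟨(le_max_left _ _).trans_lt hz.1, hz.2.trans_le (min_le_left _ _)⟩
  have h2 : MeromorphicOn M' {s | max a a' < s.re ∧ s.re < min b b'} := hM'.mono_set fun z hz =>
    ⟨(le_max_right _ _).trans_lt hz.1, hz.2.trans_le (min_le_right _ _)⟩
  refine h1.eventuallyEq_of_isPreconnected h2 (isPreconnected_reStrip _ _) (x := 2)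
    ⟨max_lt (by simpa using ha) (by simpa using ha'), lt_min (by simpa using hb) (by simpa using hb')⟩
    ⟨max_lt hs.1 hs'.1, lt_min hs.2 hs'.2⟩ ?_
  refine nhdsWithin_le_nhds ?_
  filter_upwards [(isOpen_reStrip 1 (min b b')).mem_nhds (x := 2)
    ⟨by simp, lt_min (by simpa using hb) (by simpa using hb')⟩] with z hz
  exact (hsum z hz.1 (hz.2.trans_le (min_le_left _ _))).unique
    (hsum' z hz.1 (hz.2.trans_le (min_le_right _ _)))

theorem exists_isZetaContinuation (hf : ∀ x : ℝ, 0 ≤ x → 0 < f.eval x) :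
    ∃ Z : ℂ → ℂ, IsZetaContinuation f Z := by
  set d := f.natDegree with hd
  set a : ℕ → ℝ := fun N => -(N + 1 / ((d : ℝ) + 1)) with ha
  set b : ℕ → ℕ := fun N => N * d + N + 3 with hb
  set U : ℕ → Set ℂ := fun N => {s | a N < s.re ∧ s.re < b N} with hU
  have ha2 : ∀ N, a N < 2 := fun N => by
    have h1 : 0 < 1 / ((d : ℝ) + 1) := by positivity
    have h2 : (0 : ℝ) ≤ N := N.cast_nonneg
    simp only [ha]; linarith
  have hb2 : ∀ N, (2 : ℝ) < b N := fun N => by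
    have : 2 < b N := by simp only [hb]; omega
    exact_mod_cast this
  have hex : ∀ N : ℕ, ∃ M : ℂ → ℂ, MeromorphicOn M (U N) ∧
      ∀ s : ℂ, 1 < s.re → s.re < b N → HasSum (zetaTerm f s) (M s) := fun N => by
    obtain ⟨M, h1, h2, -⟩ := exists_strip_continuation hf hd.symm N (b N) (by simp only [hb]; omega)
    exact ⟨M, h1, h2⟩
  choose M hM hsum using hex
  -- normal forms that agree on a punctured neighbourhood agree at its centre, so they glue
  set W : ℕ → ℂ → ℂ := fun N => toMeromorphicNFOn (M N) (U N) with hW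
  have hWnf : ∀ N s, s ∈ U N → MeromorphicNFAt (W N) s := fun N s hs =>
    meromorphicNFOn_toMeromorphicNFOn (M N) (U N) hs
  have hWM : ∀ N s, s ∈ U N → M N =ᶠ[nhdsWithin s {s}ᶜ] W N := fun N s hs =>
    (hM N).toMeromorphicNFOn_eq_self_on_nhdsNE hs |>.symm
  have hWW : ∀ N N' s, s ∈ U N → s ∈ U N' → W N s = W N' s := fun N N' s hs hs' => by
    have h1 := eventuallyEq_of_hasSum_zetaTerm (ha2 N) (hb2 N) (ha2 N') (hb2 N') (hM N) (hM N')
      (hsum N) (hsum N') hs hs'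
    have h2 : W N =ᶠ[nhdsWithin s {s}ᶜ] W N' := ((hWM N s hs).symm.trans h1).trans (hWM N' s hs')
    exact (((hWnf N s hs).eventuallyEq_nhdsNE_iff_eventuallyEq_nhds (hWnf N' s hs')).mp h2).self_of_nhds
  set ν : ℂ → ℕ := fun s => ⌈|s.re|⌉₊ with hν
  have hνU : ∀ s, s ∈ U (ν s) := fun s => by
    have h1 : |s.re| ≤ ν s := Nat.le_ceil _
    have h2 := abs_le.mp h1
    have h3 : 0 < 1 / ((d : ℝ) + 1) := by positivity
    have h4 : (0 : ℝ) ≤ (ν s : ℝ) * d := by positivity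
    refine ⟨?_, ?_⟩
    · simp only [ha]; linarith
    · simp only [hb]; push_cast; linarith
  have hZ : ∀ N s, s ∈ U N → (fun s => W (ν s) s) =ᶠ[nhds s] W N := fun N s hs => by
    filter_upwards [(isOpen_reStrip (a N) (b N)).mem_nhds hs] with z hz
    exact hWW _ _ _ (hνU z) hz
  refine ⟨fun s => W (ν s) s, fun s _ => ?_, fun s hs => ?_⟩
  · exact (meromorphicNFAt_congr (hZ _ s (hνU s))).mpr (hWnf _ s (hνU s))
  · have h1 := tsum_zetaTerm_eventuallyEq hf (ha2 _) (hb2 _) (hM (ν s)) (hsum (ν s)) hs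
      (hνU s).1 (hνU s).2
    have h2 := (hWM _ s (hνU s)).symm.trans h1
    have h3 := ((hWnf _ s (hνU s)).eventuallyEq_nhdsNE_iff_eventuallyEq_nhds
      (analyticAt_tsum_zetaTerm hf hs).meromorphicNFAt).mp h2
    have h4 : W (ν s) s = ∑' q, zetaTerm f s q := h3.self_of_nhds
    change HasSum _ (W (ν s) s)
    rw [h4]
    exact (summable_zetaTerm hf hs).hasSum

theorem IsZetaContinuation.analyticAt_neg_natCast {Z : ℂ → ℂ} (hZ : IsZetaContinuation f Z)
    (hf : ∀ x : ℝ, 0 ≤ x → 0 < f.eval x) (hd : f.natDegree = d) (n : ℕ) :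
    AnalyticAt ℂ Z (-(n : ℂ)) ∧ Z (-(n : ℂ)) = specialValue f d n := by
  obtain ⟨M, hM, hsum, hlim⟩ := exists_strip_continuation hf hd n (n * d + n + 3) (by omega)
  have h0 : 0 < 1 / ((d : ℝ) + 1) := by positivity
  have hn : (0 : ℝ) ≤ n := n.cast_nonneg
  have hA : (n : ℝ) + 2 < ((n * d + n + 3 : ℕ) : ℝ) := by
    have : 0 ≤ (n : ℝ) * d := by positivity
    push_cast; linarith
  have h1 : 2 / ((f.natDegree : ℝ) + 2) ≤ 1 := by
    rw [div_le_one (by positivity)]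
    have : (0 : ℝ) ≤ f.natDegree := Nat.cast_nonneg _
    linarith
  have hnf : MeromorphicNFAt Z (-(n : ℂ)) := hZ.1 (Set.mem_univ _)
  have heq : M =ᶠ[nhdsWithin (-(n : ℂ)) {-(n : ℂ)}ᶜ] Z := by
    refine eventuallyEq_of_hasSum_zetaTerm (a' := -n - 1) (b' := 3) (by linarith) (by linarith)
      (by linarith) (by norm_num) hM
      (fun s _ => (hZ.1 (Set.mem_univ s)).meromorphicAt) hsum
      (fun s hs _ => hZ.2 s (h1.trans_lt hs)) (s := -(n : ℂ)) ?_ ?_ <;>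
    · rw [Complex.neg_re, Complex.natCast_re]
      constructor <;> linarith
  have hlim' := hlim.congr' heq
  have han : AnalyticAt ℂ Z (-(n : ℂ)) :=
    hnf.meromorphicOrderAt_nonneg_iff_analyticAt.mp
      ((tendsto_nhds_iff_meromorphicOrderAt_nonneg hnf.meromorphicAt).mp ⟨_, hlim'⟩)
  exact ⟨han, tendsto_nhds_unique (han.continuousAt.tendsto.mono_left nhdsWithin_le_nhds) hlim'⟩

end Gluing

theorem mainTheorem3 (f : Polynomial ℝ) (d : ℕ) (hd : f.natDegree = d)
    (hf : ∀ x : ℝ, 0 ≤ x → 0 < f.eval x) :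
    (∃ Z : ℂ → ℂ, IsZetaContinuation f Z) ∧
    ∀ Z : ℂ → ℂ, IsZetaContinuation f Z → ∀ n : ℕ,
      AnalyticAt ℂ Z (-(n : ℂ)) ∧
      Z (-(n : ℂ)) =
        riemannZeta (-(((d : ℂ) + 2) * (n : ℂ)) - 1) / ((d : ℂ) + 1) *
            ((negPowLogCoeff f n (1 + (1 + d) * n) : ℂ) +
              (negPowLogCoeff f.reverse n (1 + (1 + d) * n) : ℂ)) +
          ∑ i ∈ Finset.range (n * d + 1),
            (((f ^ n).coeff i : ℝ) : ℂ) * riemannZeta (-(n : ℂ) - (i : ℂ)) *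
              riemannZeta (-(((d : ℂ) + 1) * (n : ℂ)) + (i : ℂ)) := by
  exact ⟨exists_isZetaContinuation hf, fun Z hZ n => hZ.analyticAt_neg_natCast hf hd n⟩
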